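/- Let $\kappa\in\{0,1,-1\}$ and $\alpha\in\mathbb{R}$. Let $M_\kappa$ be the three-dimensional space form of curvature $\kappa$, realized in $\mathbb{R}^4$ (canonical basis $e_0,e_1,e_2,e_3$) as $M_0=e_0+\mathbb{R}^3=\{x_0=1\}$, $M_1=S^3$ and $M_{-1}=H^3$, the upper sheet of $-x_0^2+x_1^2+x_2^2+x_3^2=-1$. Let $G_\kappa$ be the identity component of its isometry group, acting linearly on $\mathbb{R}^4$ ($G_0$ the orientation preserving rigid motions, $G_1=SO(4)$, $G_{-1}=O_o(1,3)$). Let $\mathcal{G}_\kappa$ be the four-dimensional manifold of complete oriented geodesics $[\sigma]$ of $M_\kappa$ (unit speed geodesics $\sigma:\mathbb{R}\to M_\kappa$ up to translation of the parameter), with the smooth structure of a homogeneous space of $G_\kappa$, where $g\cdot[\sigma]=[g\circ\sigma]$. Given $\ell=[\sigma]\in\mathcal{G}_\kappa$ with $\sigma(0)=p$ and a unit vector $A\in T_pM_\kappa$ orthogonal to $\sigma'(0)$, let $\gamma_A$ be the geodesic with initial velocity $A$, let $B=A\times\sigma'(0)$, and let $V_t$, $B_t$ be the parallel vector fields along $\gamma_A$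 with initial values $\sigma'(0)$ and $B$. The $\alpha$-helicoidal curve with initial ray $\ell$ and axis $\gamma_A$ is $$\Gamma^\alpha_{\ell,p,A}:\mathbb{R}\to\mathcal{G}_\kappa,\qquad \Gamma^\alpha_{\ell,p,A}(t)=\big[\,s\mapsto\gamma_{\cos(\alpha t)V_t+\sin(\alpha t)B_t}(s)\,\big],$$ where $\gamma_v$ denotes the geodesic with initial velocity $v$. Let $\mathcal{A}_\kappa^\alpha\subset T\mathcal{G}_\kappa$ be the set of initial velocities of all $\alpha$-helicoidal curves in $\mathcal{G}_\kappa$. Then: 1. The canonical projection $\mathcal{A}_\kappa^\alpha\to\mathcal{G}_\kappa$ is a smooth fiber bundle and the inclusion $\iota_\kappa^\alpha:\mathcal{A}_\kappa^\alpha\to T\mathcal{G}_\kappa$ is a fiber subbundle. That is, $\mathcal{A}_\kappa^\alpha$ with the subspace topology carries a smooth manifold structure for which $\iota_\kappa^\alpha$ is a smooth embedding and the projection onto $\mathcal{G}_\kappa$ is a smooth surjection, smoothly locally trivial with typical fiber a smooth manifold $\mathcal{F}$. Thus $\mathcal{A}_\kappa^\alpha$ is a control system on $\mathcal{G}_\kappa$.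 2. $G_\kappa$ acts on $\mathcal{G}_\kappa$ by smooth maps, and $\mathcal{A}_\kappa^\alpha$ is the orbit of a single tangent vector under the isometry group: $$\mathcal{A}_\kappa^\alpha=\{dg_{\ell_o}(X_\alpha)\mid g\in G_\kappa\},$$ where $X_\alpha\in T_{\ell_o}\mathcal{G}_\kappa$ is the initial velocity of $\Gamma^\alpha_{\ell_o,e_0,e_3}$ and $\ell_o$ is the oriented geodesic through $e_0$ with initial velocity $e_1$. -/

import Mathlib

open Set
open scoped ContDiff Manifold Topology Matrix

namespace Helicoidal

/-! ### The three dimensional space forms -/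

/-- The ambient space `ℝ⁴`, with canonical basis `e₀, e₁, e₂, e₃`. -/
abbrev R4 : Type := Fin 4 → ℝ

/-- The bilinear form `⟨x, y⟩_κ = κ x₀ y₀ + x₁ y₁ + x₂ y₂ + x₃ y₃`. -/
def form (κ : SignType) (x y : R4) : ℝ :=
  (κ : ℝ) * (x 0 * y 0) + x 1 * y 1 + x 2 * y 2 + x 3 * y 3

/-- The space form `M_κ`, `κ ∈ {0, 1, -1}`: the affine hyperplane `e₀ + ℝ³` for `κ = 0`, the unit
sphere for `κ = 1`, and the upper sheet of the hyperboloid for `κ = -1`. -/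
def spaceForm : SignType → Set R4
  | .zero => {x | x 0 = 1}
  | .pos => {x | form 1 x x = 1}
  | .neg => {x | form (-1) x x = -1 ∧ 0 < x 0}

/-- The tangent space of `M_κ` at its point `p`, as a set of vectors of `ℝ⁴`.  The Riemannian
metric of `M_κ` is the restriction of `form κ` to it. -/
def tangentAt : SignType → R4 → Set R4
  | .zero, _ => {v | v 0 = 0}
  | .pos, p => {v | form 1 p v = 0}
  | .neg, p => {v | form (-1) p v = 0}

/-- `V` is a smooth vector field along the curve `c` in `M_κ` which is parallel for the Levi-Civita
connection: its covariant derivative, the component of `V'` tangent to `M_κ`, vanishes. -/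
def IsParallelAlong (κ : SignType) (c V : ℝ → R4) : Prop :=
  ContDiff ℝ ∞ V ∧ (∀ t, V t ∈ tangentAt κ (c t)) ∧
    ∀ t, ∀ w ∈ tangentAt κ (c t), form κ (deriv V t) w = 0

/-- `σ : ℝ → M_κ` is a (complete) unit speed geodesic: a smooth curve in `M_κ` of unit speed whose
acceleration has vanishing component tangent to `M_κ`. -/
def IsUnitGeodesic (κ : SignType) (σ : ℝ → R4) : Prop :=
  ContDiff ℝ ∞ σ ∧ (∀ t, σ t ∈ spaceForm κ) ∧ (∀ t, form κ (deriv σ t) (deriv σ t) = 1) ∧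
    ∀ t, ∀ w ∈ tangentAt κ (σ t), form κ (deriv (deriv σ) t) w = 0

/-- The unit speed geodesics `ℝ → M_κ`. -/
structure UnitGeodesic (κ : SignType) where
  /-- the curve -/
  curve : ℝ → R4
  /-- it is a unit speed geodesic -/
  isUnitGeodesic : IsUnitGeodesic κ curve

/-- `σ₁ ∼ σ₂` if `σ₁ t = σ₂ (t + t₀)` for all `t` and some `t₀`. -/
instance geodesicSetoid (κ : SignType) : Setoid (UnitGeodesic κ) where
  r σ₁ σ₂ := ∃ t₀ : ℝ, ∀ t, σ₁.1 t = σ₂.1 (t + t₀)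
  iseqv :=
    { refl := fun σ => ⟨0, fun t => by simp⟩
      symm := by
        rintro σ₁ σ₂ ⟨a, h⟩
        exact ⟨-a, fun t => by rw [h]; simp⟩
      trans := by
        rintro σ₁ σ₂ σ₃ ⟨a, h⟩ ⟨b, h'⟩
        exact ⟨a + b, fun t => by rw [h, h', add_assoc]⟩ }

/-- The space `𝒢_κ` of complete oriented geodesics of `M_κ` up to parametrization. -/
def OrientedGeodesic (κ : SignType) : Type := Quotient (geodesicSetoid κ)

/-- The class `[σ]`. -/
def mkGeodesic {κ : SignType} (σ : UnitGeodesic κ) : OrientedGeodesic κ :=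
  Quotient.mk (geodesicSetoid κ) σ

/-! ### Elementary facts on geodesics of `M_κ` -/

/-- `x₀ y₀ + κ (x₁ y₁ + x₂ y₂ + x₃ y₃)`, an auxiliary form. -/
def dualForm (κ : SignType) (x y : R4) : ℝ :=
  x 0 * y 0 + (κ : ℝ) * (x 1 * y 1 + x 2 * y 2 + x 3 * y 3)

theorem mem_spaceForm_iff (κ : SignType) (x : R4) :
    x ∈ spaceForm κ ↔ dualForm κ x x = 1 ∧ (κ ≠ 1 → 0 < x 0) := by
  rcases κ with _ | _ | _
  · simp only [spaceForm, dualForm, mem_ofPred_eq, SignType.zero_eq_zero, SignType.coe_zero]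
    constructor
    · intro h
      simp [h]
    · rintro ⟨h, h'⟩
      have := h' (by decide)
      nlinarith
  · simp only [spaceForm, dualForm, form, mem_ofPred_eq, SignType.neg_eq_neg_one,
      SignType.coe_neg, SignType.coe_one]
    constructor
    · rintro ⟨h, h'⟩
      exact ⟨by linarith, fun _ => h'⟩
    · rintro ⟨h, h'⟩
      exact ⟨by linarith, h' (by decide)⟩
  · simp only [spaceForm, dualForm, form, mem_ofPred_eq, SignType.pos_eq_one, SignType.coe_one]
    constructor
    · intro h
      exact ⟨by linarith, fun h' => absurd rfl h'⟩
    · rintro ⟨h, h'⟩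
      linarith

theorem mem_tangentAt_iff {κ : SignType} {p : R4} (hp : p ∈ spaceForm κ) (v : R4) :
    v ∈ tangentAt κ p ↔ dualForm κ p v = 0 := by
  rcases κ with _ | _ | _
  · simp only [spaceForm, mem_ofPred_eq] at hp
    simp [tangentAt, dualForm, hp]
  · simp only [tangentAt, dualForm, form, mem_ofPred_eq, SignType.neg_eq_neg_one,
      SignType.coe_neg, SignType.coe_one]
    constructor <;> intro h <;> linarith
  · simp only [tangentAt, dualForm, form, mem_ofPred_eq, SignType.pos_eq_one, SignType.coe_one]
    constructor <;> intro h <;> linarith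

theorem form_pos {κ : SignType} {p v : R4} (hp : p ∈ spaceForm κ) (hv : v ∈ tangentAt κ p)
    (hv0 : v ≠ 0) : 0 < form κ v v := by
  have key : v 0 ≠ 0 ∨ v 1 ≠ 0 ∨ v 2 ≠ 0 ∨ v 3 ≠ 0 := by
    by_contra! h
    apply hv0
    funext i
    fin_cases i <;> simp [h]
  rcases κ with _ | _ | _
  · simp only [tangentAt, mem_ofPred_eq] at hv
    simp only [form, SignType.zero_eq_zero, SignType.coe_zero]
    rcases key with h | h | h | h
    · exact absurd hv h
    all_goals
      have := mul_self_pos.2 h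
      nlinarith [mul_self_nonneg (v 1), mul_self_nonneg (v 2), mul_self_nonneg (v 3)]
  · simp only [tangentAt, spaceForm, form, mem_ofPred_eq, SignType.neg_eq_neg_one,
      SignType.coe_neg, SignType.coe_one] at hp hv ⊢
    obtain ⟨hp, hp0⟩ := hp
    have e : p 0 * v 0 = p 1 * v 1 + p 2 * v 2 + p 3 * v 3 := by linarith
    set N := v 1 * v 1 + v 2 * v 2 + v 3 * v 3 with hN
    have cs : (p 0 * v 0) * (p 0 * v 0) ≤ (p 0 * p 0 - 1) * N := by
      rw [e]
      have : p 0 * p 0 - 1 = p 1 * p 1 + p 2 * p 2 + p 3 * p 3 := by linarith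
      rw [this, hN]
      nlinarith [mul_self_nonneg (p 1 * v 2 - p 2 * v 1), mul_self_nonneg (p 1 * v 3 - p 3 * v 1),
        mul_self_nonneg (p 2 * v 3 - p 3 * v 2)]
    have hNpos : 0 < N := by
      have hN0 : 0 ≤ N := by
        nlinarith [mul_self_nonneg (v 1), mul_self_nonneg (v 2), mul_self_nonneg (v 3)]
      rcases hN0.lt_or_eq with h | h
      · exact h
      · exfalso
        have h1 : v 1 = 0 := by
          nlinarith [mul_self_nonneg (v 1), mul_self_nonneg (v 2), mul_self_nonneg (v 3)]
        have h2 : v 2 = 0 := by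
          nlinarith [mul_self_nonneg (v 1), mul_self_nonneg (v 2), mul_self_nonneg (v 3)]
        have h3 : v 3 = 0 := by
          nlinarith [mul_self_nonneg (v 1), mul_self_nonneg (v 2), mul_self_nonneg (v 3)]
        have h0 : v 0 = 0 := by
          rw [h1, h2, h3] at e
          simp only [mul_zero, add_zero, mul_eq_zero] at e
          rcases e with e | e
          · exact absurd e hp0.ne'
          · exact e
        rcases key with h | h | h | h <;> contradiction
    have hpp : 0 < p 0 * p 0 := mul_pos hp0 hp0
    have : p 0 * p 0 * (v 0 * v 0) < p 0 * p 0 * N := by nlinarith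
    have := lt_of_mul_lt_mul_left this hpp.le
    linarith
  · simp only [form, SignType.pos_eq_one, SignType.coe_one]
    rcases key with h | h | h | h <;>
    · have := mul_self_pos.2 h
      nlinarith [mul_self_nonneg (v 0), mul_self_nonneg (v 1), mul_self_nonneg (v 2),
        mul_self_nonneg (v 3)]

theorem hasDerivAt_form {κ : SignType} {f g : ℝ → R4} {f' g' : R4} {t : ℝ}
    (hf : HasDerivAt f f' t) (hg : HasDerivAt g g' t) :
    HasDerivAt (fun s => form κ (f s) (g s)) (form κ f' (g t) + form κ (f t) g') t := by
  have hf := hasDerivAt_pi.1 hf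
  have hg := hasDerivAt_pi.1 hg
  have := (((((hf 0).mul (hg 0)).const_mul (κ : ℝ)).add ((hf 1).mul (hg 1))).add
    ((hf 2).mul (hg 2))).add ((hf 3).mul (hg 3))
  refine this.congr_deriv ?_
  simp only [form]
  ring

theorem hasDerivAt_dualForm {κ : SignType} {f g : ℝ → R4} {f' g' : R4} {t : ℝ}
    (hf : HasDerivAt f f' t) (hg : HasDerivAt g g' t) :
    HasDerivAt (fun s => dualForm κ (f s) (g s)) (dualForm κ f' (g t) + dualForm κ (f t) g') t := by
  have hf := hasDerivAt_pi.1 hf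
  have hg := hasDerivAt_pi.1 hg
  have := ((hf 0).mul (hg 0)).add (((((hf 1).mul (hg 1))).add
    ((hf 2).mul (hg 2))).add ((hf 3).mul (hg 3)) |>.const_mul (κ : ℝ))
  refine this.congr_deriv ?_
  simp only [dualForm]
  ring

theorem contDiff_hasDerivAt {σ : ℝ → R4} (h : ContDiff ℝ ∞ σ) (t : ℝ) :
    HasDerivAt σ (deriv σ t) t ∧ HasDerivAt (deriv σ) (deriv (deriv σ) t) t := by
  refine ⟨(h.differentiable (by simp) t).hasDerivAt, ?_⟩
  have : ContDiff ℝ ∞ (deriv σ) := by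
    have h' : ContDiff ℝ (∞ + 1) σ := h
    exact (contDiff_succ_iff_deriv.1 h').2.2
  exact (this.differentiable (by simp) t).hasDerivAt

theorem dualForm_comm (κ : SignType) (x y : R4) : dualForm κ x y = dualForm κ y x := by
  simp only [dualForm]; ring

theorem deriv_mem_tangentAt {κ : SignType} {σ : ℝ → R4} (h : ContDiff ℝ ∞ σ)
    (hM : ∀ t, σ t ∈ spaceForm κ) (t : ℝ) : deriv σ t ∈ tangentAt κ (σ t) := by
  rw [mem_tangentAt_iff (hM t)]
  have h1 := hasDerivAt_dualForm (κ := κ) (contDiff_hasDerivAt h t).1 (contDiff_hasDerivAt h t).1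
  have h2 : (fun s => dualForm κ (σ s) (σ s)) = fun _ => 1 := by
    funext s
    exact ((mem_spaceForm_iff κ _).1 (hM s)).1
  rw [h2] at h1
  have := h1.unique (hasDerivAt_const t (1 : ℝ))
  rw [dualForm_comm κ (deriv σ t)] at this
  linarith

/-- A unit speed curve in `M_κ` is a geodesic if and only if `σ'' = -κ σ`. -/
theorem isUnitGeodesic_iff (κ : SignType) (σ : ℝ → R4) :
    IsUnitGeodesic κ σ ↔ ContDiff ℝ ∞ σ ∧ (∀ t, σ t ∈ spaceForm κ) ∧
      (∀ t, form κ (deriv σ t) (deriv σ t) = 1) ∧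
      ∀ t, deriv (deriv σ) t = (-(κ : ℝ)) • σ t := by
  constructor
  · rintro ⟨h, hM, hu, hg⟩
    refine ⟨h, hM, hu, fun t => ?_⟩
    have hT := deriv_mem_tangentAt h hM
    have h1 : dualForm κ (σ t) (deriv (deriv σ) t) + dualForm κ (deriv σ t) (deriv σ t) = 0 := by
      have h1 := hasDerivAt_dualForm (κ := κ) (contDiff_hasDerivAt h t).1
        (contDiff_hasDerivAt h t).2
      have h2 : (fun s => dualForm κ (σ s) (deriv σ s)) = fun _ => 0 := by
        funext s
        exact (mem_tangentAt_iff (hM s) _).1 (hT s)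
      rw [h2] at h1
      have := h1.unique (hasDerivAt_const t (0 : ℝ))
      linarith
    have hp := ((mem_spaceForm_iff κ _).1 (hM t)).1
    have hT' := (mem_tangentAt_iff (hM t) _).1 (hT t)
    have hut := hu t
    set a := deriv (deriv σ) t
    set p := σ t
    set v := deriv σ t
    -- the vector `a + κ p` is tangent and `form κ` of it with itself vanishes
    have hpp : p ∈ spaceForm κ := hM t
    have hw : a + (κ : ℝ) • p ∈ tangentAt κ p := by
      rw [mem_tangentAt_iff hpp]
      have hvt : v ∈ tangentAt κ p := hT t
      rcases κ with _ | _ | _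
      · simp only [tangentAt, mem_ofPred_eq] at hvt
        simp only [dualForm, SignType.zero_eq_zero, SignType.coe_zero, Pi.add_apply,
          Pi.smul_apply, smul_eq_mul, hvt] at h1 ⊢
        linarith
      · simp only [dualForm, form, SignType.neg_eq_neg_one, SignType.coe_neg, SignType.coe_one,
          Pi.add_apply, Pi.smul_apply, smul_eq_mul] at *
        linarith
      · simp only [dualForm, form, SignType.pos_eq_one, SignType.coe_one,
          Pi.add_apply, Pi.smul_apply, smul_eq_mul] at *
        linarith
    have h0 : form κ (a + (κ : ℝ) • p) (a + (κ : ℝ) • p) = 0 := by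
      have e1 := hg t _ hw
      have e2 := (mem_tangentAt_iff hpp _).1 hw
      have e3 : (κ : ℝ) * form κ p (a + (κ : ℝ) • p) = 0 := by
        rcases κ with _ | _ | _
        · simp
        · simp only [dualForm, form, SignType.neg_eq_neg_one, SignType.coe_neg, SignType.coe_one,
            Pi.add_apply, Pi.smul_apply, smul_eq_mul] at *
          linarith
        · simp only [dualForm, form, SignType.pos_eq_one, SignType.coe_one,
            Pi.add_apply, Pi.smul_apply, smul_eq_mul] at *
          linarith
      have e4 : form κ (a + (κ : ℝ) • p) (a + (κ : ℝ) • p)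
          = form κ a (a + (κ : ℝ) • p) + (κ : ℝ) * form κ p (a + (κ : ℝ) • p) := by
        simp only [form, Pi.add_apply, Pi.smul_apply, smul_eq_mul]
        ring
      rw [e4, e3, e1, add_zero]
    have hz : a + (κ : ℝ) • p = 0 := by
      by_contra hne
      exact (form_pos hpp hw hne).ne' h0
    rw [neg_smul]
    exact eq_neg_of_add_eq_zero_left hz
  · rintro ⟨h, hM, hu, hg⟩
    refine ⟨h, hM, hu, fun t w hw => ?_⟩
    rw [hg t]
    rcases κ with _ | _ | _
    · simp [form]
    · simp only [tangentAt, form, mem_ofPred_eq, SignType.neg_eq_neg_one, SignType.coe_neg,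
        SignType.coe_one, Pi.smul_apply, smul_eq_mul] at hw ⊢
      linarith
    · simp only [tangentAt, form, mem_ofPred_eq, SignType.pos_eq_one,
        SignType.coe_one, Pi.smul_apply, smul_eq_mul] at hw ⊢
      linarith

/-- `sin_κ`: `sin_1 = sin`, `sin_0 r = r`, `sin_{-1} = sinh`. -/
noncomputable def sinK : SignType → ℝ → ℝ
  | .zero, r => r
  | .pos, r => Real.sin r
  | .neg, r => Real.sinh r

/-- `cos_κ = sin_κ'`. -/
noncomputable def cosK : SignType → ℝ → ℝ
  | .zero, _ => 1
  | .pos, r => Real.cos r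
  | .neg, r => Real.cosh r

theorem hasDerivAt_sinK (κ : SignType) (t : ℝ) : HasDerivAt (sinK κ) (cosK κ t) t := by
  rcases κ with _ | _ | _
  · exact hasDerivAt_id t
  · exact Real.hasDerivAt_sinh t
  · exact Real.hasDerivAt_sin t

theorem hasDerivAt_cosK (κ : SignType) (t : ℝ) :
    HasDerivAt (cosK κ) (-(κ : ℝ) * sinK κ t) t := by
  rcases κ with _ | _ | _
  · simpa using! hasDerivAt_const t (1 : ℝ)
  · simpa [sinK] using! Real.hasDerivAt_cosh t
  · simpa [sinK] using! Real.hasDerivAt_cos t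

theorem cosK_sq (κ : SignType) (t : ℝ) : cosK κ t ^ 2 + (κ : ℝ) * sinK κ t ^ 2 = 1 := by
  rcases κ with _ | _ | _
  · simp [cosK]
  · have := Real.cosh_sq t
    simp only [cosK, sinK, SignType.neg_eq_neg_one, SignType.coe_neg, SignType.coe_one]
    linarith
  · have := Real.cos_sq_add_sin_sq t
    simp only [cosK, sinK, SignType.pos_eq_one, SignType.coe_one]
    linarith

theorem contDiff_sinK (κ : SignType) : ContDiff ℝ ∞ (sinK κ) := by
  rcases κ with _ | _ | _
  · exact contDiff_id
  · exact Real.contDiff_sinh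
  · exact Real.contDiff_sin

theorem contDiff_cosK (κ : SignType) : ContDiff ℝ ∞ (cosK κ) := by
  rcases κ with _ | _ | _
  · exact contDiff_const
  · exact Real.contDiff_cosh
  · exact Real.contDiff_cos

@[simp] theorem sinK_zero (κ : SignType) : sinK κ 0 = 0 := by
  rcases κ with _ | _ | _ <;> simp [sinK]

@[simp] theorem cosK_zero (κ : SignType) : cosK κ 0 = 1 := by
  rcases κ with _ | _ | _ <;> simp [cosK]

theorem UnitGeodesic.eq_cos_add_sin {κ : SignType} (σ : UnitGeodesic κ) (t : ℝ) :
    σ.1 t = cosK κ t • σ.1 0 + sinK κ t • deriv σ.1 0 ∧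
    deriv σ.1 t = (-(κ : ℝ) * sinK κ t) • σ.1 0 + cosK κ t • deriv σ.1 0 := by
  obtain ⟨h, hM, hu, hg⟩ := (isUnitGeodesic_iff κ σ.1).1 σ.2
  have hA : ∀ s, HasDerivAt (fun s => cosK κ s • σ.1 s - sinK κ s • deriv σ.1 s) 0 s := by
    intro s
    have h1 := ((hasDerivAt_cosK κ s).smul (contDiff_hasDerivAt h s).1).sub
      ((hasDerivAt_sinK κ s).smul (contDiff_hasDerivAt h s).2)
    refine h1.congr_deriv ?_
    rw [hg s]
    module
  have hD : ∀ s, HasDerivAt (fun s => ((κ : ℝ) * sinK κ s) • σ.1 s + cosK κ s • deriv σ.1 s)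
      0 s := by
    intro s
    have h1 := (((hasDerivAt_sinK κ s).const_mul (κ : ℝ)).smul (contDiff_hasDerivAt h s).1).add
      ((hasDerivAt_cosK κ s).smul (contDiff_hasDerivAt h s).2)
    refine h1.congr_deriv ?_
    rw [hg s]
    module
  have hA' := is_const_of_deriv_eq_zero (fun s => (hA s).differentiableAt)
    (fun s => (hA s).deriv) 0 t
  have hD' := is_const_of_deriv_eq_zero (fun s => (hD s).differentiableAt)
    (fun s => (hD s).deriv) 0 t
  simp only [cosK_zero, sinK_zero, one_smul, zero_smul, sub_zero, mul_zero, zero_add] at hA' hD'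
  have hc := cosK_sq κ t
  constructor
  · rw [hA', hD']
    have : σ.1 t = (cosK κ t ^ 2 + (κ : ℝ) * sinK κ t ^ 2) • σ.1 t := by rw [hc, one_smul]
    nth_rewrite 1 [this]
    module
  · rw [hA', hD']
    have : deriv σ.1 t = (cosK κ t ^ 2 + (κ : ℝ) * sinK κ t ^ 2) • deriv σ.1 t := by
      rw [hc, one_smul]
    nth_rewrite 1 [this]
    module

theorem isUnitGeodesic_cos_add_sin {κ : SignType} {p v : R4} (hp : p ∈ spaceForm κ)
    (hv : v ∈ tangentAt κ p) (h1 : form κ v v = 1) :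
    IsUnitGeodesic κ (fun t => cosK κ t • p + sinK κ t • v) ∧
      deriv (fun t => cosK κ t • p + sinK κ t • v)
        = fun t => (-(κ : ℝ) * sinK κ t) • p + cosK κ t • v := by
  have hd : deriv (fun t => cosK κ t • p + sinK κ t • v)
      = fun t => (-(κ : ℝ) * sinK κ t) • p + cosK κ t • v := by
    funext t
    exact (((hasDerivAt_cosK κ t).smul_const p).add ((hasDerivAt_sinK κ t).smul_const v)).deriv
  refine ⟨?_, hd⟩
  rw [isUnitGeodesic_iff, hd]
  have hp' := (mem_spaceForm_iff κ p).1 hp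
  have hv' := (mem_tangentAt_iff hp v).1 hv
  refine ⟨((contDiff_cosK κ).smul contDiff_const).add ((contDiff_sinK κ).smul contDiff_const),
    fun t => ?_, fun t => ?_, fun t => ?_⟩
  · have hc := cosK_sq κ t
    rcases κ with _ | _ | _
    · simp only [spaceForm, tangentAt, mem_ofPred_eq] at hp hv ⊢
      simp [cosK, hp, hv]
    · have e : form SignType.neg p p = -1 := hp.1
      have e' : form SignType.neg p v = 0 := hv
      refine ⟨?_, ?_⟩
      · simp only [form, SignType.neg_eq_neg_one, SignType.coe_neg, SignType.coe_one,
          Pi.add_apply, Pi.smul_apply, smul_eq_mul] at *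
        linear_combination cosK (-1) t ^ 2 * e + 2 * cosK (-1) t * sinK (-1) t * e'
          + sinK (-1) t ^ 2 * h1 - hc
      · have hp0 : 0 < p 0 := hp.2
        have hv0 : v 0 ^ 2 < p 0 ^ 2 := by
          have cs : (p 0 * v 0) ^ 2 ≤ (p 0 ^ 2 - 1) * (1 + v 0 ^ 2) := by
            simp only [form, SignType.neg_eq_neg_one, SignType.coe_neg, SignType.coe_one] at *
            have a1 : p 0 * v 0 = p 1 * v 1 + p 2 * v 2 + p 3 * v 3 := by linarith
            have a2 : p 0 ^ 2 - 1 = p 1 ^ 2 + p 2 ^ 2 + p 3 ^ 2 := by linarith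
            have a3 : 1 + v 0 ^ 2 = v 1 ^ 2 + v 2 ^ 2 + v 3 ^ 2 := by linarith
            rw [a1, a2, a3]
            nlinarith [mul_self_nonneg (p 1 * v 2 - p 2 * v 1),
              mul_self_nonneg (p 1 * v 3 - p 3 * v 1),
              mul_self_nonneg (p 2 * v 3 - p 3 * v 2)]
          nlinarith
        have habs : |v 0| < p 0 := abs_lt_of_sq_lt_sq hv0 hp0.le
        have hs : |Real.sinh t| < Real.cosh t := by
          have := Real.cosh_sq t
          exact abs_lt_of_sq_lt_sq (by linarith) (Real.cosh_pos t).le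
        have : |Real.sinh t * v 0| ≤ Real.cosh t * p 0 - (Real.cosh t - |Real.sinh t|) * p 0 := by
          rw [abs_mul]
          nlinarith [abs_nonneg (Real.sinh t)]
        have h3 : 0 < (Real.cosh t - |Real.sinh t|) * p 0 := mul_pos (by linarith) hp0
        have h4 := neg_abs_le (Real.sinh t * v 0)
        simp only [cosK, sinK, Pi.add_apply, Pi.smul_apply, smul_eq_mul]
        linarith
    · have e : form SignType.pos p p = 1 := hp
      have e' : form SignType.pos p v = 0 := hv
      simp only [spaceForm, mem_ofPred_eq]
      simp only [form, SignType.pos_eq_one, SignType.coe_one,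
          Pi.add_apply, Pi.smul_apply, smul_eq_mul] at *
      linear_combination cosK 1 t ^ 2 * e + 2 * cosK 1 t * sinK 1 t * e'
          + sinK 1 t ^ 2 * h1 + hc
  · have hc := cosK_sq κ t
    rcases κ with _ | _ | _
    · simpa [cosK] using h1
    · have e : form SignType.neg p p = -1 := hp.1
      have e' : form SignType.neg p v = 0 := hv
      simp only [form, SignType.neg_eq_neg_one, SignType.coe_neg, SignType.coe_one,
        Pi.add_apply, Pi.smul_apply, smul_eq_mul] at *
      linear_combination sinK (-1) t ^ 2 * e + 2 * cosK (-1) t * sinK (-1) t * e'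
          + cosK (-1) t ^ 2 * h1 + hc
    · have e : form SignType.pos p p = 1 := hp
      have e' : form SignType.pos p v = 0 := hv
      simp only [form, SignType.pos_eq_one, SignType.coe_one,
          Pi.add_apply, Pi.smul_apply, smul_eq_mul] at *
      linear_combination sinK 1 t ^ 2 * e - 2 * cosK 1 t * sinK 1 t * e'
          + cosK 1 t ^ 2 * h1 + hc
  · have := (((hasDerivAt_sinK κ t).const_mul (-(κ : ℝ))).smul_const p).add
      ((hasDerivAt_cosK κ t).smul_const v)
    refine this.deriv.trans ?_
    module

/-- The unit speed geodesic with initial point `p` and initial velocity `v`. -/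
noncomputable def UnitGeodesic.ofInit {κ : SignType} {p v : R4} (hp : p ∈ spaceForm κ)
    (hv : v ∈ tangentAt κ p) (h1 : form κ v v = 1) : UnitGeodesic κ :=
  ⟨fun t => cosK κ t • p + sinK κ t • v, (isUnitGeodesic_cos_add_sin hp hv h1).1⟩

theorem UnitGeodesic.ofInit_zero {κ : SignType} {p v : R4} (hp : p ∈ spaceForm κ)
    (hv : v ∈ tangentAt κ p) (h1 : form κ v v = 1) :
    (UnitGeodesic.ofInit hp hv h1).1 0 = p ∧ deriv (UnitGeodesic.ofInit hp hv h1).1 0 = v := by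
  constructor
  · simp [UnitGeodesic.ofInit]
  · simp only [UnitGeodesic.ofInit]
    rw [(isUnitGeodesic_cos_add_sin hp hv h1).2]
    simp

/-- The geodesic `σ_o(s) = cos_κ s e₀ + sin_κ s e₁`. -/
noncomputable def standardGeodesic (κ : SignType) : UnitGeodesic κ :=
  UnitGeodesic.ofInit (p := ![1, 0, 0, 0]) (v := ![0, 1, 0, 0])
    (by rcases κ with _ | _ | _ <;> simp [spaceForm, form])
    (by rcases κ with _ | _ | _ <;> simp [tangentAt, form])
    (by simp [form])

/-! ### The smooth structure of `𝒢_κ` -/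

/-- The coordinates `xᵢ yⱼ - xⱼ yᵢ` of the bivector `x ∧ y`. -/
def wedge (x y : R4) (i j : Fin 4) : ℝ := x i * y j - x j * y i

theorem wedge_comb (x y : R4) (a b c d : ℝ) (i j : Fin 4) :
    wedge (a • x + b • y) (c • x + d • y) i j = (a * d - b * c) * wedge x y i j := by
  simp only [wedge, Pi.add_apply, Pi.smul_apply, smul_eq_mul]
  ring

theorem deriv_shift {κ : SignType} {σ₁ σ₂ : UnitGeodesic κ} {t₀ : ℝ}
    (h : ∀ t, σ₁.1 t = σ₂.1 (t + t₀)) : deriv σ₁.1 0 = deriv σ₂.1 t₀ := by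
  have : σ₁.1 = fun t => σ₂.1 (t + t₀) := funext h
  rw [this, deriv_comp_add_const, zero_add]

/-- The bivector `σ(0) ∧ σ'(0)` of the oriented geodesic `[σ]`. -/
noncomputable def plucker {κ : SignType} (l : OrientedGeodesic κ) : Fin 4 → Fin 4 → ℝ :=
  Quotient.lift (s := geodesicSetoid κ) (fun σ => wedge (σ.1 0) (deriv σ.1 0))
    (by
      rintro σ₁ σ₂ ⟨t₀, h⟩
      funext i j
      have e1 := h 0
      rw [zero_add] at e1
      rw [e1, deriv_shift h, (σ₂.eq_cos_add_sin t₀).1, (σ₂.eq_cos_add_sin t₀).2, wedge_comb]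
      have := cosK_sq κ t₀
      rw [show cosK κ t₀ * cosK κ t₀ - sinK κ t₀ * (-(κ : ℝ) * sinK κ t₀)
        = cosK κ t₀ ^ 2 + (κ : ℝ) * sinK κ t₀ ^ 2 by ring, this, one_mul]) l

theorem UnitGeodesic.frame {κ : SignType} (σ : UnitGeodesic κ) :
    σ.1 0 ∈ spaceForm κ ∧ deriv σ.1 0 ∈ tangentAt κ (σ.1 0) ∧
      form κ (deriv σ.1 0) (deriv σ.1 0) = 1 :=
  ⟨σ.2.2.1 0, deriv_mem_tangentAt σ.2.1 σ.2.2.1 0, σ.2.2.2.1 0⟩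

theorem exists_wedge_ne_zero {κ : SignType} {p v : R4} (hp : p ∈ spaceForm κ)
    (hv : v ∈ tangentAt κ p) (h1 : form κ v v = 1) : ∃ i j, wedge p v i j ≠ 0 := by
  by_contra! h
  have hpp := ((mem_spaceForm_iff κ p).1 hp).1
  have hpv := (mem_tangentAt_iff hp v).1 hv
  have : v = 0 := by
    funext i
    have e : v i * dualForm κ p p = p i * dualForm κ p v := by
      have a0 := h i 0
      have a1 := h i 1
      have a2 := h i 2
      have a3 := h i 3
      simp only [wedge, dualForm] at *
      linear_combination (-p 0) * a0 - (κ : ℝ) * p 1 * a1 - (κ : ℝ) * p 2 * a2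
        - (κ : ℝ) * p 3 * a3
    rw [hpp, hpv] at e
    simpa using e
  rw [this] at h1
  simp [form] at h1

theorem exists_angle {κ : SignType} {a b : ℝ} (h : a ^ 2 + (κ : ℝ) * b ^ 2 = 1)
    (ha : κ ≠ 1 → 0 < a) : ∃ t, cosK κ t = a ∧ sinK κ t = b := by
  rcases κ with _ | _ | _
  · have ha := ha (by decide)
    simp only [SignType.zero_eq_zero, SignType.coe_zero, zero_mul, add_zero] at h
    refine ⟨b, ?_, rfl⟩
    simp only [cosK]
    nlinarith
  · have ha := ha (by decide)
    simp only [SignType.neg_eq_neg_one, SignType.coe_neg, SignType.coe_one] at h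
    refine ⟨Real.arsinh b, ?_, Real.sinh_arsinh b⟩
    simp only [cosK]
    rw [Real.cosh_arsinh, show 1 + b ^ 2 = a ^ 2 by linarith, Real.sqrt_sq ha.le]
  · simp only [SignType.pos_eq_one, SignType.coe_one, one_mul] at h
    have hn : ‖(⟨a, b⟩ : ℂ)‖ = 1 := by
      rw [Complex.norm_def, Complex.normSq_mk]
      rw [show a * a + b * b = 1 by linarith, Real.sqrt_one]
    have hz : (⟨a, b⟩ : ℂ) ≠ 0 := by
      intro h0
      rw [h0] at hn
      simp at hn
    refine ⟨Complex.arg ⟨a, b⟩, ?_, ?_⟩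
    · simp only [cosK]
      rw [Complex.cos_arg hz, hn, div_one]
    · simp only [sinK]
      rw [Complex.sin_arg, hn, div_one]

/-- An oriented geodesic is determined by its oriented plane. -/
theorem mkGeodesic_eq_of_wedge {κ : SignType} {σ₁ σ₂ : UnitGeodesic κ} {r : ℝ} (hr : 0 < r)
    (h : ∀ i j, wedge (σ₁.1 0) (deriv σ₁.1 0) i j = r * wedge (σ₂.1 0) (deriv σ₂.1 0) i j) :
    mkGeodesic σ₁ = mkGeodesic σ₂ := by
  obtain ⟨hp₁, hv₁, hu₁⟩ := σ₁.frame
  obtain ⟨hp₂, hv₂, hu₂⟩ := σ₂.frame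
  suffices H : ∃ t, σ₁.1 0 = cosK κ t • σ₂.1 0 + sinK κ t • deriv σ₂.1 0 ∧
      deriv σ₁.1 0 = (-(κ : ℝ) * sinK κ t) • σ₂.1 0 + cosK κ t • deriv σ₂.1 0 by
    obtain ⟨t₀, h0, h0'⟩ := H
    refine Quotient.sound ⟨t₀, fun t => ?_⟩
    have hs : IsUnitGeodesic κ (fun t => σ₂.1 (t + t₀)) := by
      have hd : deriv (fun t => σ₂.1 (t + t₀)) = fun t => deriv σ₂.1 (t + t₀) := by
        funext s
        exact deriv_comp_add_const _ _ _
      obtain ⟨a1, a2, a3, a4⟩ := σ₂.2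
      refine ⟨a1.comp (contDiff_id.add contDiff_const), fun s => a2 _, fun s => ?_, fun s => ?_⟩
      · rw [hd]
        exact a3 _
      · rw [hd, deriv_comp_add_const]
        exact a4 _
    have e1 := (UnitGeodesic.eq_cos_add_sin (UnitGeodesic.mk _ hs) t).1
    simp only [zero_add] at e1
    rw [deriv_comp_add_const, zero_add, (σ₂.eq_cos_add_sin t₀).1, (σ₂.eq_cos_add_sin t₀).2,
      ← h0, ← h0', ← (σ₁.eq_cos_add_sin t).1] at e1
    exact e1.symm
  obtain ⟨i, j, hD⟩ := exists_wedge_ne_zero hp₂ hv₂ hu₂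
  set p := σ₁.1 0
  set v := deriv σ₁.1 0
  set P := σ₂.1 0
  set V := deriv σ₂.1 0
  have comb : ∀ x : R4, (∀ k, x k * wedge p v i j - x i * wedge p v k j + x j * wedge p v k i = 0) →
      ∃ a b : ℝ, x = a • P + b • V := by
    intro x hx
    refine ⟨(x i * V j - x j * V i) / wedge P V i j, (x j * P i - x i * P j) / wedge P V i j, ?_⟩
    funext k
    have := hx k
    rw [h, h, h] at this
    simp only [Pi.add_apply, Pi.smul_apply, smul_eq_mul]
    field_simp
    have h3 : r * (x k * wedge P V i j - x i * wedge P V k j + x j * wedge P V k i) = 0 := by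
      linarith
    have h4 := (mul_eq_zero.1 h3).resolve_left hr.ne'
    simp only [wedge] at h4 ⊢
    linarith
  obtain ⟨a, b, hpe⟩ := comb p (fun k => by simp only [wedge]; ring)
  obtain ⟨c, d, hve⟩ := comb v (fun k => by simp only [wedge]; ring)
  have hdet : a * d - b * c = r := by
    have := h i j
    rw [hpe, hve, wedge_comb] at this
    exact mul_right_cancel₀ hD this
  have hPP := ((mem_spaceForm_iff κ P).1 hp₂).1
  have hPV := (mem_tangentAt_iff hp₂ V).1 hv₂
  have hpp := ((mem_spaceForm_iff κ p).1 hp₁).1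
  have hpv := (mem_tangentAt_iff hp₁ v).1 hv₁
  have hVV : dualForm κ V V = κ := by
    rcases κ with _ | _ | _
    · have : V 0 = 0 := hv₂
      simp [dualForm, this]
    · simp only [dualForm, form, SignType.neg_eq_neg_one, SignType.coe_neg, SignType.coe_one] at *
      linarith
    · simp only [dualForm, form, SignType.pos_eq_one, SignType.coe_one] at *
      linarith
  have hab : a ^ 2 + (κ : ℝ) * b ^ 2 = 1 := by
    have e : dualForm κ p p
        = a ^ 2 * dualForm κ P P + 2 * a * b * dualForm κ P V + b ^ 2 * dualForm κ V V := by
      rw [hpe]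
      simp only [dualForm, Pi.add_apply, Pi.smul_apply, smul_eq_mul]
      ring
    rw [hpp, hPP, hPV, hVV] at e
    linarith
  have hac : a * c + (κ : ℝ) * b * d = 0 := by
    have e : dualForm κ p v
        = a * c * dualForm κ P P + (a * d + b * c) * dualForm κ P V + b * d * dualForm κ V V := by
      rw [hpe, hve]
      simp only [dualForm, Pi.add_apply, Pi.smul_apply, smul_eq_mul]
      ring
    rw [hpv, hPP, hPV, hVV] at e
    linarith
  have hd : d = a * r := by
    have : d = d * (a ^ 2 + (κ : ℝ) * b ^ 2) := by rw [hab, mul_one]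
    rw [this, ← hdet]
    linear_combination b * hac
  have hc : c = -(κ : ℝ) * b * r := by
    have : c = c * (a ^ 2 + (κ : ℝ) * b ^ 2) := by rw [hab, mul_one]
    rw [this, ← hdet]
    linear_combination a * hac
  have hr1 : r = 1 := by
    have e : form κ v v = c ^ 2 * form κ P P + 2 * c * d * form κ P V + d ^ 2 * form κ V V := by
      rw [hve]
      simp only [form, Pi.add_apply, Pi.smul_apply, smul_eq_mul]
      ring
    have hsq : r ^ 2 = 1 := by
      rw [hu₁, hu₂] at e
      rcases κ with _ | _ | _
      · simp only [SignType.zero_eq_zero, SignType.coe_zero, neg_zero, zero_mul, add_zero] at hc hab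
        rw [hc, hd] at e
        have : a ^ 2 * r ^ 2 = 1 := by linarith
        rwa [hab, one_mul] at this
      · have e1 : form SignType.neg P P = -1 := hp₂.1
        have e2 : form SignType.neg P V = 0 := hv₂
        rw [e1, e2, hc, hd] at e
        simp only [SignType.neg_eq_neg_one, SignType.coe_neg, SignType.coe_one] at hab e
        have : (a ^ 2 + -1 * b ^ 2) * r ^ 2 = 1 := by linarith
        rwa [hab, one_mul] at this
      · have e1 : form SignType.pos P P = 1 := hp₂
        have e2 : form SignType.pos P V = 0 := hv₂
        rw [e1, e2, hc, hd] at e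
        simp only [SignType.pos_eq_one, SignType.coe_one] at hab e
        have : (a ^ 2 + 1 * b ^ 2) * r ^ 2 = 1 := by linarith
        rwa [hab, one_mul] at this
    nlinarith
  have hapos : κ ≠ 1 → 0 < a := by
    intro hκ
    rcases κ with _ | _ | _
    · have e0 : p 0 = 1 := hp₁
      have e1 : P 0 = 1 := hp₂
      have e2 : V 0 = 0 := hv₂
      rw [hpe] at e0
      simp only [Pi.add_apply, Pi.smul_apply, smul_eq_mul, e1, e2] at e0
      linarith
    · have e0 : 0 < p 0 := hp₁.2
      have e1 : 0 < P 0 := hp₂.2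
      by_contra! hneg
      have := (isUnitGeodesic_cos_add_sin hp₂ hv₂ hu₂).1.2.1
      obtain ⟨t, ht1, ht2⟩ := exists_angle (κ := SignType.neg) (a := -a) (b := -b)
        (by rw [neg_sq, neg_sq]; exact hab)
        (fun _ => by
          rcases hneg.lt_or_eq with h | h
          · linarith
          · exfalso
            rw [h] at hab
            simp only [SignType.neg_eq_neg_one, SignType.coe_neg, SignType.coe_one] at hab
            nlinarith [sq_nonneg b])
      have h3 := (this t).2
      simp only [ht1, ht2] at h3
      rw [hpe] at e0
      simp only [Pi.add_apply, Pi.smul_apply, smul_eq_mul] at e0 h3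
      linarith
    · exact absurd rfl hκ
  obtain ⟨t, ht1, ht2⟩ := exists_angle hab hapos
  refine ⟨t, by rw [ht1, ht2]; exact hpe, ?_⟩
  rw [ht1, ht2, hve, hc, hd, hr1, mul_one, mul_one]

/-- Every oriented plane containing a vector on which `dualForm κ` is positive contains a
geodesic. -/
theorem exists_geodesic_of_plane {κ : SignType} {x y : R4} (hx : 0 < dualForm κ x x)
    (hxy : ∃ i j, wedge x y i j ≠ 0) :
    ∃ (σ : UnitGeodesic κ) (r : ℝ), 0 < r ∧
      ∀ i j, wedge (σ.1 0) (deriv σ.1 0) i j = r * wedge x y i j := by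
  obtain ⟨ε, hε, hε0⟩ : ∃ ε : ℝ, ε * ε = 1 ∧ (κ ≠ 1 → 0 < ε * x 0) := by
    by_cases h0 : 0 ≤ x 0
    · refine ⟨1, by norm_num, fun hκ => ?_⟩
      rcases h0.lt_or_eq with h | h
      · linarith
      · exfalso
        simp only [dualForm, ← h] at hx
        rcases κ with _ | _ | _
        · simp at hx
        · simp only [SignType.neg_eq_neg_one, SignType.coe_neg, SignType.coe_one] at hx
          nlinarith [mul_self_nonneg (x 1), mul_self_nonneg (x 2), mul_self_nonneg (x 3)]
        · exact hκ rfl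
    · exact ⟨-1, by norm_num, fun _ => by linarith⟩
  set q := dualForm κ x x with hq
  have hsq : 0 < √q := Real.sqrt_pos.2 hx
  have hsq2 : √q * √q = q := Real.mul_self_sqrt hx.le
  set p : R4 := (ε / √q) • x with hp
  have hpM : p ∈ spaceForm κ := by
    rw [mem_spaceForm_iff]
    constructor
    · have : dualForm κ p p = (ε * ε) / (√q * √q) * dualForm κ x x := by
        simp only [hp, dualForm, Pi.smul_apply, smul_eq_mul]
        field_simp
      rw [this, hε, hsq2, ← hq]
      field_simp
    · intro hκ
      have := hε0 hκ
      simp only [hp, Pi.smul_apply, smul_eq_mul]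
      rw [show ε / √q * x 0 = (ε * x 0) / √q by ring]
      positivity
  have hpp := ((mem_spaceForm_iff κ p).1 hpM).1
  set w : R4 := y - dualForm κ p y • p with hw
  have hwT : w ∈ tangentAt κ p := by
    rw [mem_tangentAt_iff hpM]
    have : dualForm κ p w = dualForm κ p y - dualForm κ p y * dualForm κ p p := by
      simp only [hw, dualForm, Pi.sub_apply, Pi.smul_apply, smul_eq_mul]
      ring
    rw [this, hpp]
    ring
  have hxw : ∀ i j, wedge x w i j = wedge x y i j := by
    intro i j
    simp only [hw, hp, wedge, Pi.sub_apply, Pi.smul_apply, smul_eq_mul]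
    ring
  have hw0 : w ≠ 0 := by
    intro h0
    obtain ⟨i, j, hij⟩ := hxy
    rw [← hxw, h0] at hij
    simp [wedge] at hij
  have hn := form_pos hpM hwT hw0
  set n := form κ w w with hn'
  have hsn : 0 < √n := Real.sqrt_pos.2 hn
  have hsn2 : √n * √n = n := Real.mul_self_sqrt hn.le
  have hvT : (ε / √n) • w ∈ tangentAt κ p := by
    rw [mem_tangentAt_iff hpM] at hwT ⊢
    have : dualForm κ p ((ε / √n) • w) = (ε / √n) * dualForm κ p w := by
      simp only [dualForm, Pi.smul_apply, smul_eq_mul]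
      ring
    rw [this, hwT, mul_zero]
  have hv1 : form κ ((ε / √n) • w) ((ε / √n) • w) = 1 := by
    have : form κ ((ε / √n) • w) ((ε / √n) • w) = (ε * ε) / (√n * √n) * form κ w w := by
      simp only [form, Pi.smul_apply, smul_eq_mul]
      field_simp
    rw [this, hε, hsn2, ← hn']
    field_simp
  refine ⟨UnitGeodesic.ofInit hpM hvT hv1, 1 / (√q * √n), by positivity, fun i j => ?_⟩
  rw [(UnitGeodesic.ofInit_zero hpM hvT hv1).1, (UnitGeodesic.ofInit_zero hpM hvT hv1).2, ← hxw]
  have : wedge p ((ε / √n) • w) i j = (ε * ε) / (√q * √n) * wedge x w i j := by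
    simp only [hp, wedge, Pi.smul_apply, smul_eq_mul]
    field_simp
  rw [this, hε]

/-- The first vector `e_{τ 0} + z₀ e_{τ 2} + z₂ e_{τ 3}` of the basis of a plane which is a graph
over the coordinate plane `(τ 0, τ 1)`. -/
def graphU (τ : Equiv.Perm (Fin 4)) (z : Fin 4 → ℝ) : R4 :=
  fun i => (![1, 0, z 0, z 2] : Fin 4 → ℝ) (τ.symm i)

/-- The second vector `e_{τ 1} + z₁ e_{τ 2} + z₃ e_{τ 3}` of that basis. -/
def graphW (τ : Equiv.Perm (Fin 4)) (z : Fin 4 → ℝ) : R4 :=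
  fun i => (![0, 1, z 1, z 3] : Fin 4 → ℝ) (τ.symm i)

/-- The oriented plane with bivector `P` with `P (τ 0) (τ 1) > 0` is the graph with these
parameters. -/
noncomputable def graphCoord (τ : Equiv.Perm (Fin 4)) (P : Fin 4 → Fin 4 → ℝ) : Fin 4 → ℝ :=
  ![P (τ 2) (τ 1) / P (τ 0) (τ 1), P (τ 0) (τ 2) / P (τ 0) (τ 1),
    P (τ 3) (τ 1) / P (τ 0) (τ 1), P (τ 0) (τ 3) / P (τ 0) (τ 1)]

theorem graphCoord_smul (τ : Equiv.Perm (Fin 4)) {P Q : Fin 4 → Fin 4 → ℝ} {r : ℝ} (hr : r ≠ 0)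
    (h : ∀ i j, P i j = r * Q i j) : graphCoord τ P = graphCoord τ Q := by
  simp only [graphCoord, h, mul_div_mul_left _ _ hr]

theorem wedge_graph (τ : Equiv.Perm (Fin 4)) (z : Fin 4 → ℝ) :
    wedge (graphU τ z) (graphW τ z) (τ 0) (τ 1) = 1 := by
  simp [wedge, graphU, graphW]

theorem graphCoord_graph (τ : Equiv.Perm (Fin 4)) (z : Fin 4 → ℝ) :
    graphCoord τ (wedge (graphU τ z) (graphW τ z)) = z := by
  funext k
  fin_cases k <;> simp [graphCoord, wedge, graphU, graphW]

theorem eq_graph_comb (τ : Equiv.Perm (Fin 4)) {p v : R4} (h : wedge p v (τ 0) (τ 1) ≠ 0) :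
    p = p (τ 0) • graphU τ (graphCoord τ (wedge p v))
        + p (τ 1) • graphW τ (graphCoord τ (wedge p v)) ∧
    v = v (τ 0) • graphU τ (graphCoord τ (wedge p v))
        + v (τ 1) • graphW τ (graphCoord τ (wedge p v)) := by
  constructor <;>
  · funext k
    obtain ⟨k, rfl⟩ := τ.surjective k
    simp only [Pi.add_apply, Pi.smul_apply, smul_eq_mul, graphU, graphW, graphCoord,
      Equiv.symm_apply_apply]
    fin_cases k
    · simp
    · simp
    all_goals
      simp
      field_simp
      simp only [wedge]
      ring

theorem wedge_eq_graph (τ : Equiv.Perm (Fin 4)) {p v : R4} (h : wedge p v (τ 0) (τ 1) ≠ 0)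
    (i j : Fin 4) :
    wedge p v i j = wedge p v (τ 0) (τ 1) *
      wedge (graphU τ (graphCoord τ (wedge p v))) (graphW τ (graphCoord τ (wedge p v))) i j := by
  obtain ⟨h1, h2⟩ := eq_graph_comb τ h
  have h3 := congrArg₂ (fun x y => wedge x y i j) h1 h2
  simp only [wedge_comb] at h3
  rw [h3]
  rfl

theorem plucker_mk {κ : SignType} (σ : UnitGeodesic κ) :
    plucker (mkGeodesic σ) = wedge (σ.1 0) (deriv σ.1 0) := rfl

theorem exists_mk {κ : SignType} (l : OrientedGeodesic κ) : ∃ σ, mkGeodesic σ = l :=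
  Quotient.exists_rep l

theorem plucker_injective {κ : SignType} {l m : OrientedGeodesic κ} {r : ℝ} (hr : 0 < r)
    (h : ∀ i j, plucker l i j = r * plucker m i j) : l = m := by
  obtain ⟨σ₁, rfl⟩ := exists_mk l
  obtain ⟨σ₂, rfl⟩ := exists_mk m
  exact mkGeodesic_eq_of_wedge hr h

theorem plucker_eq_graph {κ : SignType} (τ : Equiv.Perm (Fin 4)) {l : OrientedGeodesic κ}
    (h : plucker l (τ 0) (τ 1) ≠ 0) (i j : Fin 4) :
    plucker l i j = plucker l (τ 0) (τ 1) *
      wedge (graphU τ (graphCoord τ (plucker l))) (graphW τ (graphCoord τ (plucker l))) i j := by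
  obtain ⟨σ, rfl⟩ := exists_mk l
  exact wedge_eq_graph τ h i j

instance instNonemptyOrientedGeodesic (κ : SignType) : Nonempty (OrientedGeodesic κ) :=
  ⟨mkGeodesic (standardGeodesic κ)⟩

/-- The chart of `𝒢_κ` with domain the oriented geodesics `[σ]` whose oriented plane
`span (σ(0), σ'(0))` projects isomorphically and preserving the orientation onto the coordinate
plane `(τ 0, τ 1)` of `ℝ⁴`; its value is the `2 × 2` matrix `z` whose graph is that plane, that is,
`span (σ(0), σ'(0)) = {x | x_{τ 2} = z₀ x_{τ 0} + z₁ x_{τ 1}, x_{τ 3} = z₂ x_{τ 0} + z₃ x_{τ 1}}`. -/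
noncomputable def geodesicChart (κ : SignType) (τ : Equiv.Perm (Fin 4)) :
    PartialEquiv (OrientedGeodesic κ) (Fin 4 → ℝ) :=
  Set.InjOn.toPartialEquiv (fun l => graphCoord τ (plucker l))
    {l | 0 < plucker l (τ 0) (τ 1)}
    (by
      intro l hl m hm h
      simp only [mem_ofPred_eq] at hl hm h
      refine plucker_injective (div_pos hl hm) fun i j => ?_
      rw [plucker_eq_graph τ hl.ne' i j, plucker_eq_graph τ hm.ne' i j, h]
      field_simp)

theorem geodesicChart_target (κ : SignType) (τ : Equiv.Perm (Fin 4)) :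
    (geodesicChart κ τ).target = {z | ∃ s t : ℝ,
      0 < dualForm κ (s • graphU τ z + t • graphW τ z) (s • graphU τ z + t • graphW τ z)} := by
  ext z
  constructor
  · rintro ⟨l, hl, rfl⟩
    obtain ⟨σ, rfl⟩ := exists_mk l
    have hne : wedge (σ.1 0) (deriv σ.1 0) (τ 0) (τ 1) ≠ 0  :=
      ne_of_gt hl
    have h := (eq_graph_comb τ hne).1
    refine ⟨σ.1 0 (τ 0), σ.1 0 (τ 1), ?_⟩
    simp only [plucker_mk]
    rw [← h, ((mem_spaceForm_iff κ _).1 σ.frame.1).1]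
    exact one_pos
  · rintro ⟨s, t, h⟩
    have hst : 0 < s * s - t * -t := by
      by_contra! hc
      have hs : s = 0 := by nlinarith [mul_self_nonneg s, mul_self_nonneg t]
      have ht : t = 0 := by nlinarith [mul_self_nonneg s, mul_self_nonneg t]
      rw [hs, ht] at h
      simp [dualForm] at h
    obtain ⟨σ, r, hr, hσ⟩ := exists_geodesic_of_plane
      (y := (-t) • graphU τ z + s • graphW τ z) h
      ⟨τ 0, τ 1, by rw [wedge_comb, wedge_graph, mul_one]; exact hst.ne'⟩
    simp only [wedge_comb, ← mul_assoc] at hσ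
    have hr' : 0 < r * (s * s - t * -t) := mul_pos hr hst
    refine ⟨mkGeodesic σ, ?_, ?_⟩
    · simp only [mem_ofPred_eq, plucker_mk]
      rw [hσ, wedge_graph, mul_one]
      exact hr'
    · simp only [plucker_mk]
      rw [graphCoord_smul τ hr'.ne' hσ, graphCoord_graph]

theorem plucker_geodesicChart_symm {κ : SignType} {τ : Equiv.Perm (Fin 4)} {z : Fin 4 → ℝ}
    (hz : z ∈ (geodesicChart κ τ).target) :
    ∃ r : ℝ, 0 < r ∧ ∀ i j, plucker ((geodesicChart κ τ).symm z) i j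
      = r * wedge (graphU τ z) (graphW τ z) i j := by
  have h1 : 0 < plucker ((geodesicChart κ τ).symm z) (τ 0) (τ 1) :=
    (geodesicChart κ τ).map_target hz
  have h2 : graphCoord τ (plucker ((geodesicChart κ τ).symm z)) = z :=
    (geodesicChart κ τ).right_inv hz
  refine ⟨_, h1, fun i j => ?_⟩
  have := plucker_eq_graph τ h1.ne' i j
  rwa [h2] at this

theorem geodesicChart_trans_source (κ : SignType) (τ τ' : Equiv.Perm (Fin 4)) :
    ((geodesicChart κ τ).symm.trans (geodesicChart κ τ')).source
      = (geodesicChart κ τ).target ∩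
        {z | 0 < wedge (graphU τ z) (graphW τ z) (τ' 0) (τ' 1)} := by
  ext z
  rw [PartialEquiv.trans_source, PartialEquiv.symm_source]
  refine and_congr_right fun hz => ?_
  obtain ⟨r, hr, h⟩ := plucker_geodesicChart_symm hz
  change 0 < plucker ((geodesicChart κ τ).symm z) (τ' 0) (τ' 1) ↔ _
  rw [h]
  exact mul_pos_iff_of_pos_left hr

theorem contDiff_graph (τ : Equiv.Perm (Fin 4)) :
    ContDiff ℝ ∞ (graphU τ) ∧ ContDiff ℝ ∞ (graphW τ) := by
  constructor <;>
  · rw [contDiff_pi]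
    intro i
    obtain ⟨i, rfl⟩ := τ.surjective i
    simp only [graphU, graphW, Equiv.symm_apply_apply]
    fin_cases i
    · exact contDiff_const
    · exact contDiff_const
    · exact contDiff_apply ℝ ℝ _
    · exact contDiff_apply ℝ ℝ _

theorem contDiff_wedge_graph (τ : Equiv.Perm (Fin 4)) (i j : Fin 4) :
    ContDiff ℝ ∞ (fun z => wedge (graphU τ z) (graphW τ z) i j) := by
  have hu := contDiff_pi.1 (contDiff_graph τ).1
  have hw := contDiff_pi.1 (contDiff_graph τ).2
  exact ((hu i).mul (hw j)).sub ((hu j).mul (hw i))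

theorem isOpen_geodesicChart_target (κ : SignType) (τ : Equiv.Perm (Fin 4)) :
    IsOpen (geodesicChart κ τ).target := by
  rw [geodesicChart_target]
  have : {z | ∃ s t : ℝ, 0 < dualForm κ (s • graphU τ z + t • graphW τ z)
      (s • graphU τ z + t • graphW τ z)} = ⋃ (s : ℝ) (t : ℝ), {z | 0 < dualForm κ
      (s • graphU τ z + t • graphW τ z) (s • graphU τ z + t • graphW τ z)} := by
    ext z
    simp
  rw [this]
  refine isOpen_iUnion fun s => isOpen_iUnion fun t => isOpen_lt continuous_const ?_
  have hu := continuous_pi_iff.1 (contDiff_graph τ).1.continuous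
  have hw := continuous_pi_iff.1 (contDiff_graph τ).2.continuous
  simp only [dualForm, Pi.add_apply, Pi.smul_apply, smul_eq_mul]
  fun_prop

theorem isOpen_geodesicChart_trans_source (κ : SignType) (τ τ' : Equiv.Perm (Fin 4)) :
    IsOpen ((geodesicChart κ τ).symm.trans (geodesicChart κ τ')).source := by
  rw [geodesicChart_trans_source]
  exact (isOpen_geodesicChart_target κ τ).inter
    (isOpen_lt continuous_const (contDiff_wedge_graph τ _ _).continuous)

theorem contDiffOn_geodesicChart_trans (κ : SignType) (τ τ' : Equiv.Perm (Fin 4)) :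
    ContDiffOn ℝ ∞ ((geodesicChart κ τ).symm.trans (geodesicChart κ τ'))
      ((geodesicChart κ τ).symm.trans (geodesicChart κ τ')).source := by
  have key : ContDiffOn ℝ ∞ (fun z => graphCoord τ' (wedge (graphU τ z) (graphW τ z)))
      ((geodesicChart κ τ).symm.trans (geodesicChart κ τ')).source := by
    rw [geodesicChart_trans_source, contDiffOn_pi]
    intro k
    fin_cases k <;>
    exact ((contDiff_wedge_graph τ _ _).contDiffOn).div (contDiff_wedge_graph τ _ _).contDiffOn
      (fun z hz => ne_of_gt hz.2)
  refine key.congr fun z hz => ?_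
  rw [geodesicChart_trans_source] at hz
  obtain ⟨r, hr, h⟩ := plucker_geodesicChart_symm hz.1
  exact graphCoord_smul τ' hr.ne' h

theorem exists_mem_geodesicChart_source {κ : SignType} (l : OrientedGeodesic κ) :
    ∃ τ, l ∈ (geodesicChart κ τ).source := by
  obtain ⟨σ, rfl⟩ := exists_mk l
  obtain ⟨i, j, h⟩ := exists_wedge_ne_zero σ.frame.1 σ.frame.2.1 σ.frame.2.2
  have aux : ∀ i j : Fin 4, i ≠ j → ∃ τ : Equiv.Perm (Fin 4), τ 0 = i ∧ τ 1 = j := by decide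
  have hij : i ≠ j := by
    rintro rfl
    simp [wedge] at h
  rcases lt_or_gt_of_ne h with h | h
  · obtain ⟨τ, h0, h1⟩ := aux j i hij.symm
    refine ⟨τ, ?_⟩
    change 0 < wedge (σ.1 0) (deriv σ.1 0) (τ 0) (τ 1)
    rw [h0, h1]
    simp only [wedge] at h ⊢
    linarith
  · obtain ⟨τ, h0, h1⟩ := aux i j hij
    refine ⟨τ, ?_⟩
    change 0 < wedge (σ.1 0) (deriv σ.1 0) (τ 0) (τ 1)
    rw [h0, h1]
    exact h

/-- The atlas of the `geodesicChart`s. -/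
noncomputable def geodesicCore (κ : SignType) :
    ChartedSpaceCore (Fin 4 → ℝ) (OrientedGeodesic κ) where
  atlas := range (geodesicChart κ)
  chartAt l := geodesicChart κ (exists_mem_geodesicChart_source l).choose
  mem_chart_source l := (exists_mem_geodesicChart_source l).choose_spec
  chart_mem_atlas l := mem_range_self _
  open_source := by
    rintro _ _ ⟨τ, rfl⟩ ⟨τ', rfl⟩
    exact isOpen_geodesicChart_trans_source κ τ τ'
  continuousOn_toFun := by
    rintro _ _ ⟨τ, rfl⟩ ⟨τ', rfl⟩
    exact (contDiffOn_geodesicChart_trans κ τ τ').continuousOn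

noncomputable instance instTopologicalSpaceOrientedGeodesic (κ : SignType) :
    TopologicalSpace (OrientedGeodesic κ) :=
  (geodesicCore κ).toTopologicalSpace

/-- The manifold `𝒢_κ`, of dimension four.  Sending `[σ]` to the oriented plane
`span (σ(0), σ'(0))` identifies `𝒢_κ` with an open subset of the Grassmannian of oriented planes
of `ℝ⁴`, and the smooth structure is that of this open subset.  The group `G_κ ⊆ GL(4, ℝ)` acts
smoothly and transitively on it, so this is also the structure of the homogeneous space
`G_κ / K_κ`. -/
noncomputable instance instChartedSpaceOrientedGeodesic (κ : SignType) :
    ChartedSpace (Fin 4 → ℝ) (OrientedGeodesic κ) :=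
  (geodesicCore κ).toChartedSpace

instance instIsManifoldOrientedGeodesic (κ : SignType) :
    IsManifold 𝓘(ℝ, Fin 4 → ℝ) ∞ (OrientedGeodesic κ) := by
  apply isManifold_of_contDiffOn
  intro e e' he he'
  obtain ⟨_, ⟨_, rfl⟩, he⟩ := he
  obtain ⟨⟨τ, rfl⟩, rfl⟩ := mem_iUnion.1 he
  obtain ⟨_, ⟨_, rfl⟩, he'⟩ := he'
  obtain ⟨⟨τ', rfl⟩, rfl⟩ := mem_iUnion.1 he'
  simpa using! contDiffOn_geodesicChart_trans κ τ τ'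

theorem continuous_normalized_plucker (κ : SignType) :
    Continuous (fun l : OrientedGeodesic κ => ‖plucker l‖⁻¹ • plucker l) := by
  rw [continuous_iff_continuousAt]
  intro l
  obtain ⟨τ, hτ⟩ : ∃ τ, ⇑(chartAt (Fin 4 → ℝ) l) = geodesicChart κ τ ∧
      (chartAt (Fin 4 → ℝ) l).source = (geodesicChart κ τ).source := ⟨_, rfl, rfl⟩
  have hcont : ContinuousAt (fun z => ‖wedge (graphU τ z) (graphW τ z)‖⁻¹ •
      wedge (graphU τ z) (graphW τ z)) (chartAt (Fin 4 → ℝ) l l) := by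
    have hc : Continuous (fun z => wedge (graphU τ z) (graphW τ z)) :=
      continuous_pi fun i => continuous_pi fun j => (contDiff_wedge_graph τ i j).continuous
    refine (hc.norm.continuousAt.inv₀ ?_).smul hc.continuousAt
    rw [norm_ne_zero_iff]
    intro h0
    have := wedge_graph τ (chartAt (Fin 4 → ℝ) l l)
    rw [h0] at this
    simp at this
  have h1 := ContinuousAt.comp (f := chartAt (Fin 4 → ℝ) l) hcont
    ((chartAt (Fin 4 → ℝ) l).continuousAt (mem_chart_source _ l))
  refine h1.congr ?_
  filter_upwards [(chartAt (Fin 4 → ℝ) l).open_source.mem_nhds (mem_chart_source _ l)] with m hm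
  rw [hτ.2] at hm
  have hm : 0 < plucker m (τ 0) (τ 1) := hm
  have h2 : plucker m = plucker m (τ 0) (τ 1) •
      wedge (graphU τ (graphCoord τ (plucker m))) (graphW τ (graphCoord τ (plucker m))) := by
    funext i j
    exact plucker_eq_graph τ hm.ne' i j
  simp only [Function.comp, hτ.1]
  change _ = ‖plucker m‖⁻¹ • plucker m
  rw [h2, norm_smul, Real.norm_of_nonneg hm.le, smul_smul]
  have h3 : (plucker m (τ 0) (τ 1) * ‖wedge (graphU τ (graphCoord τ (plucker m)))
      (graphW τ (graphCoord τ (plucker m)))‖)⁻¹ * plucker m (τ 0) (τ 1)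
      = ‖wedge (graphU τ (graphCoord τ (plucker m)))
      (graphW τ (graphCoord τ (plucker m)))‖⁻¹ := by
    rw [mul_inv]
    field_simp
  rw [h3]
  rfl

instance instT2SpaceOrientedGeodesic (κ : SignType) : T2Space (OrientedGeodesic κ) := by
  refine T2Space.of_injective_continuous (fun l m h => ?_) (continuous_normalized_plucker κ)
  have hpos : ∀ l : OrientedGeodesic κ, 0 < ‖plucker l‖ := by
    intro l
    obtain ⟨τ, hτ⟩ := exists_mem_geodesicChart_source l
    have hτ : 0 < plucker l (τ 0) (τ 1) := hτ
    rw [norm_pos_iff]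
    intro h0
    rw [h0] at hτ
    simp at hτ
  refine plucker_injective (div_pos (hpos l) (hpos m)) fun i j => ?_
  have hij := congrFun (congrFun h i) j
  simp only [Pi.smul_apply, smul_eq_mul] at hij
  have h1 := (hpos l).ne'
  have h2 := (hpos m).ne'
  field_simp at hij ⊢
  linarith

instance instSecondCountableTopologyOrientedGeodesic (κ : SignType) :
    SecondCountableTopology (OrientedGeodesic κ) := by
  classical
  choose f hf using fun l : OrientedGeodesic κ =>
    (⟨_, rfl⟩ : ∃ τ, (geodesicChart κ τ).source = (chartAt (Fin 4 → ℝ) l).source)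
  let r : Equiv.Perm (Fin 4) → OrientedGeodesic κ := fun τ =>
    if h : ∃ l, f l = τ then h.choose else Classical.arbitrary _
  refine ChartedSpace.secondCountable_of_countable_cover (Fin 4 → ℝ) (s := range r) ?_
    (countable_range r)
  rw [eq_univ_iff_forall]
  intro l
  have h : ∃ m, f m = f l := ⟨l, rfl⟩
  refine mem_iUnion₂.2 ⟨r (f l), mem_range_self _, ?_⟩
  have hr : f (r (f l)) = f l := by
    simp only [r, dif_pos h]
    exact h.choose_spec
  rw [← hf, hr, hf]
  exact mem_chart_source _ l

/-! ### The isometry group -/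

/-- The identity component `G_κ` of the isometry group of `M_κ`, acting linearly on `ℝ⁴`: the
orientation preserving rigid motions of `ℝ³ ≡ e₀ + ℝ³` for `κ = 0`, `SO(4)` for `κ = 1` and
`O_o(1, 3)` for `κ = -1`. -/
def isometryGroup : SignType → Set (Matrix (Fin 4) (Fin 4) ℝ)
  | .zero => {g | g 0 0 = 1 ∧ (∀ i : Fin 3, g 0 i.succ = 0) ∧
      g.submatrix Fin.succ Fin.succ ∈ Matrix.specialOrthogonalGroup (Fin 3) ℝ}
  | .pos => {g | (∀ x y, form 1 (g *ᵥ x) (g *ᵥ y) = form 1 x y) ∧ g.det = 1}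
  | .neg => {g | (∀ x y, form (-1) (g *ᵥ x) (g *ᵥ y) = form (-1) x y) ∧ g.det = 1 ∧
      0 < (g *ᵥ ![1, 0, 0, 0]) 0}

theorem form_mulVec {κ : SignType} {g : Matrix (Fin 4) (Fin 4) ℝ} (hg : g ∈ isometryGroup κ)
    {p v w : R4} (hv : v ∈ tangentAt κ p) (hw : w ∈ tangentAt κ p) :
    form κ (g *ᵥ v) (g *ᵥ w) = form κ v w := by
  rcases κ with _ | _ | _
  · obtain ⟨h0, h1, h2⟩ := hg
    have hv : v 0 = 0 := hv
    have hw : w 0 = 0 := hw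
    have h3 := (Matrix.mem_specialOrthogonalGroup_iff.1 h2).1
    rw [Matrix.mem_orthogonalGroup_iff'] at h3
    have h4 : ∀ i j : Fin 3, ∑ k : Fin 3, g k.succ i.succ * g k.succ j.succ
        = (1 : Matrix (Fin 3) (Fin 3) ℝ) i j := by
      intro i j
      rw [← h3]
      simp [Matrix.mul_apply]
    have a00 := h4 0 0
    have a01 := h4 0 1
    have a02 := h4 0 2
    have a11 := h4 1 1
    have a12 := h4 1 2
    have a22 := h4 2 2
    simp only [Fin.sum_univ_three, Fin.isValue, Matrix.one_apply_eq, ne_eq, Fin.reduceEq,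
      not_false_eq_true, Matrix.one_apply_ne, Fin.succ_zero_eq_one, Fin.succ_one_eq_two,
      show Fin.succ (2 : Fin 3) = (3 : Fin 4) from rfl, zero_ne_one] at a00 a01 a02 a11 a12 a22
    simp only [form, SignType.zero_eq_zero, SignType.coe_zero, Matrix.mulVec, dotProduct,
      Fin.sum_univ_four, hv, hw]
    linear_combination v 1 * w 1 * a00 + (v 1 * w 2 + v 2 * w 1) * a01
      + (v 1 * w 3 + v 3 * w 1) * a02 + v 2 * w 2 * a11 + (v 2 * w 3 + v 3 * w 2) * a12
      + v 3 * w 3 * a22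
  · exact hg.1 v w
  · exact hg.1 v w

theorem mulVec_mem_spaceForm {κ : SignType} {g : Matrix (Fin 4) (Fin 4) ℝ}
    (hg : g ∈ isometryGroup κ) {p : R4} (hp : p ∈ spaceForm κ) : g *ᵥ p ∈ spaceForm κ := by
  rcases κ with _ | _ | _
  · obtain ⟨h0, h1, h2⟩ := hg
    have hp : p 0 = 1 := hp
    have a0 : g 0 1 = 0 := h1 0
    have a1 : g 0 2 = 0 := h1 1
    have a2 : g 0 3 = 0 := h1 2
    simp [spaceForm, Matrix.mulVec, dotProduct, Fin.sum_univ_four, h0, a0, a1, a2, hp]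
  · obtain ⟨h0, h1, h2⟩ := hg
    have e1 := h0 p p
    have e2 := h0 ![1, 0, 0, 0] ![1, 0, 0, 0]
    have e3 := h0 p ![1, 0, 0, 0]
    obtain ⟨hp, hp0⟩ := hp
    refine ⟨by rw [e1]; exact hp, ?_⟩
    rw [hp] at e1
    set a := g *ᵥ p
    set b := g *ᵥ ![1, 0, 0, 0]
    simp [form] at e1 e2 e3
    by_contra! hneg
    have hA : a 1 ^ 2 + a 2 ^ 2 + a 3 ^ 2 = a 0 ^ 2 - 1 := by linarith
    have hB : b 1 ^ 2 + b 2 ^ 2 + b 3 ^ 2 = b 0 ^ 2 - 1 := by linarith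
    have hAB : a 1 * b 1 + a 2 * b 2 + a 3 * b 3 = a 0 * b 0 - p 0 := by linarith
    have cs : (a 0 * b 0 - p 0) ^ 2 ≤ (a 0 ^ 2 - 1) * (b 0 ^ 2 - 1) := by
      rw [← hA, ← hB, ← hAB]
      nlinarith [mul_self_nonneg (a 1 * b 2 - a 2 * b 1), mul_self_nonneg (a 1 * b 3 - a 3 * b 1),
        mul_self_nonneg (a 2 * b 3 - a 3 * b 2)]
    have hab : a 0 * b 0 ≤ 0 := mul_nonpos_of_nonpos_of_nonneg hneg h2.le
    have ha1 : 1 ≤ a 0 ^ 2 := by nlinarith [sq_nonneg (a 1), sq_nonneg (a 2), sq_nonneg (a 3)]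
    have hb1 : 1 ≤ b 0 ^ 2 := by nlinarith [sq_nonneg (b 1), sq_nonneg (b 2), sq_nonneg (b 3)]
    nlinarith [mul_nonneg hp0.le (neg_nonneg.2 hab)]
  · have hp : form 1 p p = 1 := hp
    change form 1 _ _ = 1
    rw [hg.1, hp]

theorem isUnitGeodesic_mulVec {κ : SignType} {g : Matrix (Fin 4) (Fin 4) ℝ}
    (hg : g ∈ isometryGroup κ) (σ : UnitGeodesic κ) :
    IsUnitGeodesic κ (fun t => g *ᵥ σ.1 t) := by
  obtain ⟨h, hM, hu, hd⟩ := (isUnitGeodesic_iff κ σ.1).1 σ.2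
  have hL : ∀ (f : ℝ → R4) (f' : R4) (t : ℝ), HasDerivAt f f' t →
      HasDerivAt (fun t => g *ᵥ f t) (g *ᵥ f') t := by
    intro f f' t hf
    exact (LinearMap.toContinuousLinearMap g.mulVecLin).hasFDerivAt.comp_hasDerivAt t hf
  have d1 : deriv (fun t => g *ᵥ σ.1 t) = fun t => g *ᵥ deriv σ.1 t :=
    funext fun t => (hL _ _ t (contDiff_hasDerivAt h t).1).deriv
  have d2 : deriv (fun t => g *ᵥ deriv σ.1 t) = fun t => g *ᵥ deriv (deriv σ.1) t :=
    funext fun t => (hL _ _ t (contDiff_hasDerivAt h t).2).deriv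
  rw [isUnitGeodesic_iff, d1, d2]
  refine ⟨(LinearMap.toContinuousLinearMap g.mulVecLin).contDiff.comp h,
    fun t => mulVec_mem_spaceForm hg (hM t), fun t => ?_, fun t => ?_⟩
  · have hT := deriv_mem_tangentAt h hM t
    rw [form_mulVec hg hT hT, hu]
  · change g *ᵥ deriv (deriv σ.1) t = _
    rw [hd t, Matrix.mulVec_smul]

/-- The action `g · [σ] = [g ∘ σ]` of `G_κ` on `𝒢_κ`. -/
def act {κ : SignType} (g : isometryGroup κ) : OrientedGeodesic κ → OrientedGeodesic κ :=
  Quotient.map (sa := geodesicSetoid κ) (sb := geodesicSetoid κ)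
    (fun σ => ⟨fun t => g.1 *ᵥ σ.1 t, isUnitGeodesic_mulVec g.2 σ⟩)
    (by
      rintro σ₁ σ₂ ⟨t₀, h⟩
      refine ⟨t₀, fun t => ?_⟩
      simp only [h t])

/-! ### Helicoidal curves and the set of their initial velocities -/

/-- `B = u × v` in `T_p M_κ`, for an orthonormal subset `{u, v}` of `T_p M_κ`: `B` is the unit
tangent vector such that `{p, u, v, B}` is a positively oriented orthogonal basis. -/
def IsCross (κ : SignType) (p u v B : R4) : Prop :=
  B ∈ tangentAt κ p ∧ form κ B B = 1 ∧ form κ u B = 0 ∧ form κ v B = 0 ∧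
    0 < (Matrix.of ![p, u, v, B]).det

/-- `φ t`, the curve `s ↦ φ(s, t)`, is the `α`-helicoidal parametrized surface in `M_κ` with initial
ray `[σ]` and axis the geodesic `γ_A` through `σ(0)` with initial velocity `A`, where `A` is a unit
vector of `T_{σ(0)} M_κ` orthogonal to `σ'(0)`: the ray `φ t` is the geodesic with initial velocity
`cos (α t) V_t + sin (α t) B_t ∈ T_{γ_A(t)} M_κ`, where `V` and `B` are the parallel vector fields
along `γ_A` with initial values `σ'(0)` and `A × σ'(0)`. -/
def IsHelicoidalSurface (κ : SignType) (α : ℝ) (σ : UnitGeodesic κ) (A : R4)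
    (φ : ℝ → UnitGeodesic κ) : Prop :=
  A ∈ tangentAt κ (σ.curve 0) ∧ form κ A A = 1 ∧ form κ A (deriv σ.curve 0) = 0 ∧
  ∃ (c : UnitGeodesic κ) (V B : ℝ → R4),
    c.curve 0 = σ.curve 0 ∧ deriv c.curve 0 = A ∧
    IsParallelAlong κ c.curve V ∧ V 0 = deriv σ.curve 0 ∧
    IsParallelAlong κ c.curve B ∧ IsCross κ (σ.curve 0) A (deriv σ.curve 0) (B 0) ∧
    ∀ t, (φ t).curve 0 = c.curve t ∧
      deriv (φ t).curve 0 = Real.cos (α * t) • V t + Real.sin (α * t) • B t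

/-- `Γ` is the `α`-helicoidal curve in `𝒢_κ` with initial ray `[σ]` and axis the geodesic through
`σ(0)` with initial velocity `A`, that is, `Γ(t) = [s ↦ φ(s, t)]` for the corresponding
`α`-helicoidal surface. -/
def IsHelicoidalCurve (κ : SignType) (α : ℝ) (σ : UnitGeodesic κ) (A : R4)
    (Γ : ℝ → OrientedGeodesic κ) : Prop :=
  ∃ φ : ℝ → UnitGeodesic κ, IsHelicoidalSurface κ α σ A φ ∧ ∀ t, Γ t = mkGeodesic (φ t)

/-- The tangent bundle `T𝒢_κ`. -/
abbrev TangentGeodesic (κ : SignType) : Type :=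
  TangentBundle 𝓘(ℝ, Fin 4 → ℝ) (OrientedGeodesic κ)

/-- The curve `Γ` in `𝒢_κ` is differentiable at `0` and `X ∈ T𝒢_κ` is its initial velocity. -/
def IsInitialVelocity {κ : SignType} (Γ : ℝ → OrientedGeodesic κ) (X : TangentGeodesic κ) : Prop :=
  ∃ v : TangentSpace 𝓘(ℝ, Fin 4 → ℝ) (Γ 0),
    HasMFDerivAt 𝓘(ℝ, ℝ) 𝓘(ℝ, Fin 4 → ℝ) Γ 0 (ContinuousLinearMap.toSpanSingleton ℝ v) ∧
    X = ⟨Γ 0, v⟩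

/-- The set `𝒜_κ^α ⊆ T𝒢_κ` of initial velocities of `α`-helicoidal curves in `𝒢_κ`. -/
def admissible (κ : SignType) (α : ℝ) : Set (TangentGeodesic κ) :=
  {X | ∃ (σ : UnitGeodesic κ) (A : R4) (Γ : ℝ → OrientedGeodesic κ),
    IsHelicoidalCurve κ α σ A Γ ∧ IsInitialVelocity Γ X}

/-! ### Fiber bundles and fiber subbundles of a tangent bundle -/

/-- `π : E → B` is a smooth fiber bundle with typical fiber `F`: a smooth surjection such that over
a neighborhood `U` of any point of `B` there is a diffeomorphism `π⁻¹(U) → U × F` over `U`. -/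
def IsSmoothFiberBundle {VE HE VB HB VF HF : Type*}
    [NormedAddCommGroup VE] [NormedSpace ℝ VE] [TopologicalSpace HE] (IE : ModelWithCorners ℝ VE HE)
    [NormedAddCommGroup VB] [NormedSpace ℝ VB] [TopologicalSpace HB] (IB : ModelWithCorners ℝ VB HB)
    [NormedAddCommGroup VF] [NormedSpace ℝ VF] [TopologicalSpace HF] (IF : ModelWithCorners ℝ VF HF)
    {E B : Type*} (F : Type*)
    [TopologicalSpace E] [ChartedSpace HE E] [TopologicalSpace B] [ChartedSpace HB B]
    [TopologicalSpace F] [ChartedSpace HF F] (π : E → B) : Prop :=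
  ContMDiff IE IB ∞ π ∧ Function.Surjective π ∧
  ∀ b : B, ∃ e : Bundle.Trivialization F π, b ∈ e.baseSet ∧
    ContMDiffOn IE (IB.prod IF) ∞ e e.source ∧
    ContMDiffOn (IB.prod IF) IE ∞ e.toOpenPartialHomeomorph.symm e.target

/-- The subset `A` of the tangent bundle `TN` of a manifold `N` is a fiber subbundle of `TN`, that
is, a control system on `N`: it carries the structure of a smooth manifold, with the subspace
topology, for which the inclusion `A → TN` is a smooth embedding and the canonical projection
`A → N` is a smooth fiber bundle, whose typical fiber `F` is a smooth manifold. -/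
def IsFiberSubbundle {V H : Type*} [NormedAddCommGroup V] [NormedSpace ℝ V] [TopologicalSpace H]
    (I : ModelWithCorners ℝ V H) {N : Type*} [TopologicalSpace N] [ChartedSpace H N]
    [IsManifold I ∞ N] (A : Set (TangentBundle I N)) : Prop :=
  ∃ (VA : Type) (_ : NormedAddCommGroup VA) (_ : NormedSpace ℝ VA) (_ : FiniteDimensional ℝ VA)
    (_ : ChartedSpace VA A) (_ : IsManifold 𝓘(ℝ, VA) ∞ A)
    (VF : Type) (_ : NormedAddCommGroup VF) (_ : NormedSpace ℝ VF) (_ : FiniteDimensional ℝ VF)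
    (F : Type) (_ : TopologicalSpace F) (_ : T2Space F) (_ : SecondCountableTopology F)
    (_ : ChartedSpace VF F) (_ : IsManifold 𝓘(ℝ, VF) ∞ F),
    Manifold.IsSmoothEmbedding 𝓘(ℝ, VA) I.tangent ∞ (Subtype.val : A → TangentBundle I N) ∧
    IsSmoothFiberBundle 𝓘(ℝ, VA) I 𝓘(ℝ, VF) F (fun X : A => X.1.proj)

end Helicoidal

set_option linter.unusedSectionVars false

/-! The three geometries are treated at once inside `ℝ⁴`. A parallel field orthogonal to a geodesic
of `M_κ` is a constant vector of `ℝ⁴` (`IsParallelAlong.eq_const`). Hence a helicoidal curve is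
given by one formula in terms of a positively oriented orthonormal frame `(p; v, b, a)`: at time `t`
the ray starts at `cos_κ t p + sin_κ t a` with velocity `cos (α t) v + sin (α t) b`. The elements of
`G_κ` are exactly the matrices whose columns form such a frame, and the formula is equivariant. So
every helicoidal curve is the image of the standard one under some `g`, and the chain rule gives the
orbit statement (`admissible_eq_range`).

An orbit need not be embedded, so the bundle statement requires two more facts. The first is local
triviality. Gram–Schmidt applied to a basis of a plane gives a smooth local section `z ↦ g_z` of
`G_κ → 𝒢_κ` near the standard ray; sending a tangent vector `X` over `z` to `dg_z⁻¹ X` trivializes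
`T𝒢_κ`, and by invariance carries the admissible set to a constant fiber
(`isAdaptedTrivialization_standard`). The action of `G_κ` moves this trivialization to any other
geodesic.

The second is that the fiber over the standard ray is an embedded submanifold. A tangent vector
there is a linear map from the plane `(e₀, e₁)` to the plane `(e₂, e₃) = ℂ`, that is, a pair `(A,
B)` of complex numbers, the images of `e₀` and `e₁`. The frames over this ray depend on a
translation `s` along it and a rotation `θ` about it, and the velocities are `A = e^{iθ} (i cos_κ s
- α sin_κ s)`, `B = e^{iθ} (α cos_κ s + i κ sin_κ s)`. After a real linear change of coordinates
this set is recognized: for `κ = 1`, a product of circles of radii `|1 + α|` and `|1 - α|`, one of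
which may be a point; for `κ = -1`, the complex hyperbola `x y = -(i + α)²`; for `κ = 0`, a cylinder
if `α ≠ 0` and a circle if `α = 0`. Each is locally a coordinate slice, and
`isFiberSubbundle_of_adapted` combines the two facts. -/

namespace Helicoidal

/-! ### Slice subsets of a manifold -/

section Slice

variable {EM HM EN HN EP HP : Type*}
  [NormedAddCommGroup EM] [NormedSpace ℝ EM] [TopologicalSpace HM]
  [NormedAddCommGroup EN] [NormedSpace ℝ EN] [TopologicalSpace HN]
  [NormedAddCommGroup EP] [NormedSpace ℝ EP] [TopologicalSpace HP]
  {M N P : Type*} [TopologicalSpace M] [ChartedSpace HM M] [TopologicalSpace N] [ChartedSpace HN N]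
  [TopologicalSpace P] [ChartedSpace HP P]

/-- The partial homeomorphism `φ` is smooth in both directions. -/
def IsSmoothPartial (IM : ModelWithCorners ℝ EM HM) (IN : ModelWithCorners ℝ EN HN)
    (φ : OpenPartialHomeomorph M N) : Prop :=
  ContMDiffOn IM IN ∞ φ φ.source ∧ ContMDiffOn IN IM ∞ φ.symm φ.target

variable {IM : ModelWithCorners ℝ EM HM} {IN : ModelWithCorners ℝ EN HN}
  {IP : ModelWithCorners ℝ EP HP}

theorem IsSmoothPartial.trans {φ : OpenPartialHomeomorph M N} {ψ : OpenPartialHomeomorph N P}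
    (hφ : IsSmoothPartial IM IN φ) (hψ : IsSmoothPartial IN IP ψ) :
    IsSmoothPartial IM IP (φ.trans ψ) := by
  constructor
  · rw [φ.trans_source]
    exact hψ.1.comp (hφ.1.mono inter_subset_left) fun x hx => hx.2
  · rw [φ.trans_target]
    exact hφ.2.comp (hψ.2.mono inter_subset_left) fun x hx => hx.2

theorem IsSmoothPartial.symm {φ : OpenPartialHomeomorph M N} (hφ : IsSmoothPartial IM IN φ) :
    IsSmoothPartial IN IM φ.symm :=
  ⟨hφ.2, by simpa using hφ.1⟩

theorem isSmoothPartial_continuousLinearEquiv (e : EM ≃L[ℝ] EN) :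
    IsSmoothPartial 𝓘(ℝ, EM) 𝓘(ℝ, EN) e.toHomeomorph.toOpenPartialHomeomorph :=
  ⟨e.contDiff.contMDiff.contMDiffOn, e.symm.contDiff.contMDiff.contMDiffOn⟩

theorem isSmoothPartial_of_mem_maximalAtlas [IsManifold IM ∞ M] {φ : OpenPartialHomeomorph M HM}
    (h : φ ∈ IsManifold.maximalAtlas IM ∞ M) : IsSmoothPartial IM IM φ :=
  ⟨contMDiffOn_of_mem_maximalAtlas h, contMDiffOn_symm_of_mem_maximalAtlas h⟩

/-- The subset `S` of the manifold `M` is locally the slice `V₁ × {0}` of a chart with values in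
`V₁ × V₂`. -/
def IsSliceSet (IM : ModelWithCorners ℝ EM HM) (V₁ V₂ : Type*) [NormedAddCommGroup V₁]
    [NormedSpace ℝ V₁] [NormedAddCommGroup V₂] [NormedSpace ℝ V₂] (S : Set M) : Prop :=
  ∀ x ∈ S, ∃ φ : OpenPartialHomeomorph M (V₁ × V₂), x ∈ φ.source ∧
    IsSmoothPartial IM 𝓘(ℝ, V₁ × V₂) φ ∧ ∀ y ∈ φ.source, y ∈ S ↔ (φ y).2 = 0

variable {V₁ V₂ W₁ W₂ : Type*} [NormedAddCommGroup V₁] [NormedSpace ℝ V₁] [NormedAddCommGroup V₂]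
  [NormedSpace ℝ V₂] [NormedAddCommGroup W₁] [NormedSpace ℝ W₁] [NormedAddCommGroup W₂]
  [NormedSpace ℝ W₂] {S : Set M}

/-- A slice chart for `T` pulled back by a diffeomorphism is a slice chart for `S`. Only a local
diffeomorphism near each point of `S` is asked for, so that logarithms and trivializations can be
used as `χ`. -/
theorem IsSliceSet.comap {T : Set N} (hT : IsSliceSet IN V₁ V₂ T)
    (h : ∀ x ∈ S, ∃ χ : OpenPartialHomeomorph M N, x ∈ χ.source ∧ IsSmoothPartial IM IN χ ∧
      ∀ y ∈ χ.source, y ∈ S ↔ χ y ∈ T) : IsSliceSet IM V₁ V₂ S := by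
  intro x hx
  obtain ⟨χ, hxχ, hχ, hS⟩ := h x hx
  obtain ⟨φ, hxφ, hφ, hT⟩ := hT (χ x) ((hS x hxχ).1 hx)
  refine ⟨χ.trans φ, by simp [hxχ, hxφ], hχ.trans hφ, fun y hy => ?_⟩
  rw [χ.trans_source] at hy
  rw [hS y hy.1, hT _ hy.2]
  rfl

/-- The product of two slice charts has its factors in the order `V₁, V₂, W₁, W₂`; exchanging the
middle ones puts the two normal directions last. -/
theorem IsSliceSet.prod {S : Set EM} {T : Set EN} (hS : IsSliceSet 𝓘(ℝ, EM) V₁ V₂ S)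
    (hT : IsSliceSet 𝓘(ℝ, EN) W₁ W₂ T) :
    IsSliceSet 𝓘(ℝ, EM × EN) (V₁ × W₁) (V₂ × W₂) (S ×ˢ T) := by
  rintro ⟨x, y⟩ ⟨hx, hy⟩
  obtain ⟨φ, hxφ, hφ, hS⟩ := hS x hx
  obtain ⟨ψ, hyψ, hψ, hT⟩ := hT y hy
  refine ⟨(φ.prod ψ).trans
    (ContinuousLinearEquiv.prodProdProdComm ℝ V₁ V₂ W₁ W₂).toHomeomorph.toOpenPartialHomeomorph,
    by simpa using ⟨hxφ, hyψ⟩, IsSmoothPartial.trans (IN := 𝓘(ℝ, (V₁ × V₂) × (W₁ × W₂))) ⟨?_, ?_⟩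
      (isSmoothPartial_continuousLinearEquiv _), ?_⟩
  · have h1 := contMDiffOn_iff_contDiffOn.1 hφ.1
    have h2 := contMDiffOn_iff_contDiffOn.1 hψ.1
    exact contMDiffOn_iff_contDiffOn.2 (h1.prodMap h2)
  · have h1 := contMDiffOn_iff_contDiffOn.1 hφ.2
    have h2 := contMDiffOn_iff_contDiffOn.1 hψ.2
    exact contMDiffOn_iff_contDiffOn.2 (h1.prodMap h2)
  · rintro ⟨x', y'⟩ h
    simp only [OpenPartialHomeomorph.trans_source, OpenPartialHomeomorph.prod_source, mem_inter_iff,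
      mem_prod] at h
    rw [mem_prod, hS _ h.1.1, hT _ h.1.2]
    simp [Prod.ext_iff]

/-- The chart of the slice set `S` given by a slice chart of `M`. -/
noncomputable def sliceChart (φ : OpenPartialHomeomorph M (V₁ × V₂)) (h : ∀ y ∈ φ.source, y ∈ S ↔ (φ y).2 = 0)
    (x₀ : S) : OpenPartialHomeomorph S V₁ := by
  classical exact
  { toFun := fun y => (φ y).1
    -- Outside the target there is no point of `S` to return, so `x₀` serves as the default value.
    invFun := fun v => if hv : (v, (0 : V₂)) ∈ φ.target then
      ⟨φ.symm (v, 0), (h _ (φ.map_target hv)).2 (by rw [φ.right_inv hv])⟩ else x₀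
    source := Subtype.val ⁻¹' φ.source
    target := {v | (v, (0 : V₂)) ∈ φ.target}
    map_source' := by
      intro y hy
      have h2 := (h _ hy).1 y.2
      have h3 := φ.map_source hy
      rwa [← Prod.mk.eta (p := φ y), h2] at h3
    map_target' := by
      intro v hv
      simp only [mem_ofPred_eq] at hv
      simp only [hv, dif_pos, mem_preimage]
      exact φ.map_target hv
    left_inv' := by
      intro y hy
      have h2 := (h _ hy).1 y.2
      have h3 := φ.map_source hy
      rw [← Prod.mk.eta (p := φ y), h2] at h3
      rw [dif_pos h3]
      apply Subtype.ext
      change φ.symm ((φ y).1, 0) = y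
      rw [← h2, Prod.mk.eta, φ.left_inv hy]
    right_inv' := by
      intro v hv
      simp only [mem_ofPred_eq] at hv
      rw [dif_pos hv]
      simp only
      rw [φ.right_inv hv]
    open_source := φ.open_source.preimage continuous_subtype_val
    open_target := φ.open_target.preimage (Continuous.prodMk_left (0 : V₂))
    continuousOn_toFun :=
      continuous_fst.comp_continuousOn
        (φ.continuousOn.comp continuous_subtype_val.continuousOn fun _ hy => hy)
    continuousOn_invFun := by
      rw [Topology.IsInducing.subtypeVal.continuousOn_iff]
      have : ContinuousOn (fun v : V₁ => φ.symm (v, (0 : V₂))) {v | (v, (0 : V₂)) ∈ φ.target} :=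
        φ.symm.continuousOn.comp (Continuous.prodMk_left (0 : V₂)).continuousOn fun _ hv => hv
      refine this.congr fun v hv => ?_
      simp only [mem_ofPred_eq] at hv
      simp [hv] }

theorem sliceChart_apply (φ : OpenPartialHomeomorph M (V₁ × V₂))
    (h : ∀ y ∈ φ.source, y ∈ S ↔ (φ y).2 = 0) (x₀ y : S) : sliceChart φ h x₀ y = (φ y).1 := rfl

theorem sliceChart_source (φ : OpenPartialHomeomorph M (V₁ × V₂))
    (h : ∀ y ∈ φ.source, y ∈ S ↔ (φ y).2 = 0) (x₀ : S) :
    (sliceChart φ h x₀).source = Subtype.val ⁻¹' φ.source := rfl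

theorem coe_sliceChart_symm (φ : OpenPartialHomeomorph M (V₁ × V₂))
    (h : ∀ y ∈ φ.source, y ∈ S ↔ (φ y).2 = 0) (x₀ : S) {v : V₁} (hv : (v, (0 : V₂)) ∈ φ.target) :
    ((sliceChart φ h x₀).symm v : M) = φ.symm (v, 0) := by
  classical
  change Subtype.val (p := (· ∈ S)) (if hv : (v, (0 : V₂)) ∈ φ.target then
    ⟨φ.symm (v, 0), (h _ (φ.map_target hv)).2 (by rw [φ.right_inv hv])⟩ else x₀) = _
  rw [dif_pos hv]

/-- A slice chart of `M` at a point of the slice set `S`. -/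
noncomputable def IsSliceSet.chart (hS : IsSliceSet IM V₁ V₂ S) (x : S) :
    OpenPartialHomeomorph M (V₁ × V₂) :=
  (hS x x.2).choose

theorem IsSliceSet.chart_spec (hS : IsSliceSet IM V₁ V₂ S) (x : S) :
    (x : M) ∈ (hS.chart x).source ∧ IsSmoothPartial IM 𝓘(ℝ, V₁ × V₂) (hS.chart x) ∧
      ∀ y ∈ (hS.chart x).source, y ∈ S ↔ (hS.chart x y).2 = 0 :=
  (hS x x.2).choose_spec

/-- The manifold structure of a slice set. -/
@[reducible]
noncomputable def IsSliceSet.chartedSpace (hS : IsSliceSet IM V₁ V₂ S) : ChartedSpace V₁ S where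
  atlas := range fun x : S => sliceChart (hS.chart x) (hS.chart_spec x).2.2 x
  chartAt x := sliceChart (hS.chart x) (hS.chart_spec x).2.2 x
  mem_chart_source x := (hS.chart_spec x).1
  chart_mem_atlas x := mem_range_self x

/-- The transition from the chart at `x` to the chart at `y` is `v ↦ (φ_y (φ_x⁻¹ (v, 0))).1`, a
restriction of a smooth map followed by a linear projection. -/
theorem IsSliceSet.isManifold (hS : IsSliceSet IM V₁ V₂ S) :
    letI := hS.chartedSpace
    IsManifold 𝓘(ℝ, V₁) ∞ S := by
  let _ := hS.chartedSpace
  apply isManifold_of_contDiffOn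
  rintro _ _ ⟨x, rfl⟩ ⟨y, rfl⟩
  have hx := (hS.chart_spec x).2
  have hy := (hS.chart_spec y).2
  simp only [modelWithCornersSelf_coe, modelWithCornersSelf_coe_symm, Function.comp_id,
    Function.id_comp, preimage_id, range_id, inter_univ]
  rw [← contMDiffOn_iff_contDiffOn]
  have hi : ContMDiff 𝓘(ℝ, V₁) 𝓘(ℝ, V₁ × V₂) ∞ fun v : V₁ => (v, (0 : V₂)) :=
    (contDiff_prodMk_left (0 : V₂)).contMDiff
  have hp : ContMDiff 𝓘(ℝ, V₁ × V₂) 𝓘(ℝ, V₁) ∞ (Prod.fst : V₁ × V₂ → V₁) :=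
    contDiff_fst.contMDiff
  have key : ContMDiffOn 𝓘(ℝ, V₁) 𝓘(ℝ, V₁) ∞
      (fun v => (hS.chart y ((hS.chart x).symm (v, 0))).1)
      {v | (v, (0 : V₂)) ∈ (hS.chart x).target ∧
        (hS.chart x).symm (v, 0) ∈ (hS.chart y).source} :=
    hp.comp_contMDiffOn (hy.1.1.comp (hx.1.2.comp hi.contMDiffOn fun v hv => hv.1)
      fun v hv => hv.2)
  refine (key.mono ?_).congr ?_
  · intro v hv
    rw [OpenPartialHomeomorph.trans_source] at hv
    have h1 : (v, (0 : V₂)) ∈ (hS.chart x).target := hv.1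
    refine ⟨h1, ?_⟩
    have := hv.2
    rw [mem_preimage, sliceChart_source, mem_preimage, coe_sliceChart_symm _ _ _ h1] at this
    exact this
  · intro v hv
    rw [OpenPartialHomeomorph.trans_source] at hv
    have h1 : (v, (0 : V₂)) ∈ (hS.chart x).target := hv.1
    simp only [OpenPartialHomeomorph.coe_trans, Function.comp_apply, sliceChart_apply]
    rw [coe_sliceChart_symm _ _ _ h1]

/-- In a slice chart of `M` and the induced chart of `S` the inclusion reads `v ↦ (v, 0)`, which is
the normal form of an immersion with complement `V₂`. -/
theorem IsSliceSet.isImmersion [IM.Boundaryless] [IsManifold IM ∞ M]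
    (hS : IsSliceSet IM V₁ V₂ S) (e : (V₁ × V₂) ≃L[ℝ] EM) :
    letI := hS.chartedSpace
    Manifold.IsImmersionOfComplement V₂ 𝓘(ℝ, V₁) IM ∞ (Subtype.val : S → M) := by
  let _ := hS.chartedSpace
  have := hS.isManifold
  intro x
  obtain ⟨hxφ, hφ, hiff⟩ := hS.chart_spec x
  -- Charts in the maximal atlas of `M` take values in `HM`, whereas a slice chart takes values in
  -- `V₁ × V₂`. Without boundary, `IM` is a homeomorphism onto `EM`, so `e` followed by its inverse
  -- makes up the difference.
  have hI : IsSmoothPartial 𝓘(ℝ, EM) IM IM.toHomeomorph.symm.toOpenPartialHomeomorph := by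
    constructor
    · have := IM.contMDiffOn_symm (n := ∞)
      rw [IM.range_eq_univ] at this
      exact this
    · exact IM.contMDiff.contMDiffOn
  have hc := (hφ.trans (isSmoothPartial_continuousLinearEquiv e)).trans hI
  refine Manifold.IsImmersionAtOfComplement.mk_of_charts e
    (sliceChart (hS.chart x) hiff x) _ ?_ ?_
    (IsManifold.chart_mem_maximalAtlas (I := 𝓘(ℝ, V₁)) (n := ∞) x)
    (OpenPartialHomeomorph.mem_maximalAtlas_of_contMDiffOn _ hc.1 hc.2) ?_ ?_
  · exact hxφ
  · simpa using hxφ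
  · intro y hy
    simpa using! hy
  · intro v hv
    have h1 : (v, (0 : V₂)) ∈ (hS.chart x).target := by simpa using! hv
    have h2 : ∀ w, IM (IM.symm w) = w := IM.toHomeomorph.apply_symm_apply
    simp [coe_sliceChart_symm _ _ _ h1, (hS.chart x).right_inv h1, h2]

/-- Smoothness into an embedded submanifold can be tested in the ambient manifold: `S` has the
subspace topology, so continuity is automatic, and an immersion detects smoothness of continuous
maps. -/
theorem IsSliceSet.contMDiffOn_iff [IM.Boundaryless] [IsManifold IM ∞ M] [IsManifold IN ∞ N]
    (hS : IsSliceSet IM V₁ V₂ S) (e : (V₁ × V₂) ≃L[ℝ] EM) {f : N → S} {u : Set N}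
    (hu : IsOpen u) :
    letI := hS.chartedSpace
    ContMDiffOn IN 𝓘(ℝ, V₁) ∞ f u ↔ ContMDiffOn IN IM ∞ (fun x => (f x : M)) u := by
  let _ := hS.chartedSpace
  have := hS.isManifold
  have hi := hS.isImmersion e
  constructor
  · intro h
    exact hi.contMDiff.comp_contMDiffOn h
  · intro h x hx
    refine ContMDiffAt.contMDiffWithinAt ?_
    have h' := h.contMDiffAt (hu.mem_nhds hx)
    rw [ContMDiffAt.iff_comp_isImmersionAtOfComplement (hi (f x))]
    exact ⟨Topology.IsInducing.subtypeVal.continuousAt_iff.2 h'.continuousAt, h'⟩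

end Slice

theorem isSliceSet_univ {E : Type*} [NormedAddCommGroup E] [NormedSpace ℝ E] :
    IsSliceSet 𝓘(ℝ, E) E PUnit.{1} (univ : Set E) := fun x _ =>
  ⟨(ContinuousLinearEquiv.prodUnique ℝ E PUnit.{1}).symm.toHomeomorph.toOpenPartialHomeomorph,
    by simp, isSmoothPartial_continuousLinearEquiv _, fun y _ => by simp⟩

/-! ### A criterion for fiber subbundles -/

section Criterion

variable {V : Type} [NormedAddCommGroup V] [NormedSpace ℝ V] [FiniteDimensional ℝ V]
  {N : Type} [TopologicalSpace N] [ChartedSpace V N] [IsManifold 𝓘(ℝ, V) ∞ N]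
  {V₁ V₂ : Type} [NormedAddCommGroup V₁] [NormedSpace ℝ V₁] [NormedAddCommGroup V₂]
  [NormedSpace ℝ V₂]

/-- `Θ` is a smooth trivialization of `TN` over the domain of the chart `φ` which carries `A` to the
product with the subset `F` of `V`. -/
structure IsAdaptedTrivialization (A : Set (TangentBundle 𝓘(ℝ, V) N)) (F : Set V)
    (φ : OpenPartialHomeomorph N V)
    (Θ : OpenPartialHomeomorph (TangentBundle 𝓘(ℝ, V) N) (V × V)) : Prop where
  smooth_base : IsSmoothPartial 𝓘(ℝ, V) 𝓘(ℝ, V) φ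
  smooth : IsSmoothPartial 𝓘(ℝ, V).tangent 𝓘(ℝ, V × V) Θ
  source_eq : Θ.source = Bundle.TotalSpace.proj ⁻¹' φ.source
  target_eq : Θ.target = φ.target ×ˢ univ
  fst_eq : ∀ X ∈ Θ.source, (Θ X).1 = φ X.proj
  mem_iff : ∀ X ∈ Θ.source, X ∈ A ↔ (Θ X).2 ∈ F

variable {A : Set (TangentBundle 𝓘(ℝ, V) N)} {F : Set V}

theorem IsAdaptedTrivialization.proj_symm {φ : OpenPartialHomeomorph N V}
    {Θ : OpenPartialHomeomorph (TangentBundle 𝓘(ℝ, V) N) (V × V)}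
    (h : IsAdaptedTrivialization A F φ Θ) {z w : V} (hz : z ∈ φ.target) :
    (Θ.symm (z, w)).proj = φ.symm z := by
  have ht : (z, w) ∈ Θ.target := by rw [h.target_eq]; exact ⟨hz, mem_univ _⟩
  have h1 := Θ.map_target ht
  have h2 := h.fst_eq _ h1
  rw [Θ.right_inv ht] at h2
  rw [h.source_eq] at h1
  have h3 : z = φ (Θ.symm (z, w)).proj := h2
  exact (φ.left_inv h1).symm.trans (congrArg φ.symm h3.symm)

/-- The trivialization of `A` given by an adapted trivialization of `TN`. -/
noncomputable def IsAdaptedTrivialization.trivialization {φ : OpenPartialHomeomorph N V}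
    {Θ : OpenPartialHomeomorph (TangentBundle 𝓘(ℝ, V) N) (V × V)}
    (h : IsAdaptedTrivialization A F φ Θ) (f₀ : F) (a₀ : A) :
    Bundle.Trivialization F (fun X : A => X.1.proj) := by
  classical exact
  -- Over the base set the map is `Θ` with its first component read in `N` instead of in the chart.
  -- The points `f₀` and `a₀` are default values outside the domains.
  { toFun := fun X => (X.1.proj, if hX : (Θ X).2 ∈ F then ⟨(Θ X).2, hX⟩ else f₀)
    invFun := fun mf => if hA : Θ.symm (φ mf.1, mf.2) ∈ A then
      ⟨Θ.symm (φ mf.1, mf.2), hA⟩ else a₀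
    source := (fun X : A => X.1.proj) ⁻¹' φ.source
    target := φ.source ×ˢ univ
    map_source' := fun X hX => ⟨hX, mem_univ _⟩
    map_target' := by
      rintro ⟨m, f⟩ ⟨hm, -⟩
      simp only at hm
      have ht : (φ m, (f : V)) ∈ Θ.target := by
        rw [h.target_eq]; exact ⟨φ.map_source hm, mem_univ _⟩
      have hA : Θ.symm (φ m, (f : V)) ∈ A := by
        rw [h.mem_iff _ (Θ.map_target ht), Θ.right_inv ht]; exact f.2
      simp only [hA, dif_pos, mem_preimage]
      rw [h.proj_symm (φ.map_source hm), φ.left_inv hm]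
      exact hm
    left_inv' := by
      intro X hX
      have hs : (X : TangentBundle 𝓘(ℝ, V) N) ∈ Θ.source := by rw [h.source_eq]; exact hX
      have hF := (h.mem_iff _ hs).1 X.2
      have e : (φ X.1.proj, (Θ X).2) = Θ X := by rw [← h.fst_eq _ hs]
      have e' : Θ.symm (φ X.1.proj, (Θ X).2) = X := by rw [e, Θ.left_inv hs]
      simp only [hF, dif_pos]
      rw [dif_pos (by rw [e']; exact X.2)]
      exact Subtype.ext e'
    right_inv' := by
      rintro ⟨m, f⟩ ⟨hm, -⟩
      simp only at hm
      have ht : (φ m, (f : V)) ∈ Θ.target := by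
        rw [h.target_eq]; exact ⟨φ.map_source hm, mem_univ _⟩
      have hA : Θ.symm (φ m, (f : V)) ∈ A := by
        rw [h.mem_iff _ (Θ.map_target ht), Θ.right_inv ht]; exact f.2
      simp only [hA, dif_pos]
      rw [dif_pos (by rw [Θ.right_inv ht]; exact f.2)]
      refine Prod.ext ?_ (Subtype.ext ?_)
      · simp only
        rw [h.proj_symm (φ.map_source hm), φ.left_inv hm]
      · simp only
        rw [Θ.right_inv ht]
    open_source := by
      have h1 : IsOpen (Subtype.val ⁻¹' Θ.source : Set A) :=
        Θ.open_source.preimage continuous_subtype_val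
      rw [h.source_eq] at h1
      exact h1
    open_target := φ.open_source.prod isOpen_univ
    continuousOn_toFun := by
      have hs : ∀ X : A, X.1.proj ∈ φ.source → (X : TangentBundle 𝓘(ℝ, V) N) ∈ Θ.source := by
        intro X hX
        rw [h.source_eq]; exact hX
      have hc : ContinuousOn (fun X : A => Θ X) ((fun X : A => X.1.proj) ⁻¹' φ.source) :=
        Θ.continuousOn.comp continuous_subtype_val.continuousOn fun X hX => hs X hX
      refine ContinuousOn.prodMk ?_ ?_
      · exact ((FiberBundle.continuous_proj V (TangentSpace 𝓘(ℝ, V))).comp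
          continuous_subtype_val).continuousOn
      · rw [Topology.IsInducing.subtypeVal.continuousOn_iff]
        refine (continuous_snd.comp_continuousOn hc).congr fun X hX => ?_
        have hF := (h.mem_iff _ (hs X hX)).1 X.2
        simp [hF]
    continuousOn_invFun := by
      rw [Topology.IsInducing.subtypeVal.continuousOn_iff]
      have hc : ContinuousOn (fun mf : N × F => Θ.symm (φ mf.1, (mf.2 : V)))
          (φ.source ×ˢ univ) := by
        refine Θ.symm.continuousOn.comp (ContinuousOn.prodMk
          (φ.continuousOn.comp continuous_fst.continuousOn fun x hx => hx.1)
          (continuous_subtype_val.comp continuous_snd).continuousOn) ?_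
        rintro ⟨m, f⟩ ⟨hm, -⟩
        change _ ∈ Θ.target
        rw [h.target_eq]; exact ⟨φ.map_source hm, mem_univ _⟩
      refine hc.congr ?_
      rintro ⟨m, f⟩ ⟨hm, -⟩
      simp only at hm
      have ht : (φ m, (f : V)) ∈ Θ.target := by
        rw [h.target_eq]; exact ⟨φ.map_source hm, mem_univ _⟩
      have hA : Θ.symm (φ m, (f : V)) ∈ A := by
        rw [h.mem_iff _ (Θ.map_target ht), Θ.right_inv ht]; exact f.2
      simp [hA]
    baseSet := φ.source
    open_baseSet := φ.open_source
    source_eq := rfl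
    target_eq := rfl
    proj_toFun := fun _ _ => rfl }

theorem IsAdaptedTrivialization.trivialization_snd {φ : OpenPartialHomeomorph N V}
    {Θ : OpenPartialHomeomorph (TangentBundle 𝓘(ℝ, V) N) (V × V)}
    (h : IsAdaptedTrivialization A F φ Θ) (f₀ : F) (a₀ : A) {X : A} (hX : X.1.proj ∈ φ.source) :
    ((h.trivialization f₀ a₀ X).2 : V) = (Θ X).2 := by
  classical
  have hs : (X : TangentBundle 𝓘(ℝ, V) N) ∈ Θ.source := by rw [h.source_eq]; exact hX
  have hF := (h.mem_iff _ hs).1 X.2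
  change Subtype.val (p := (· ∈ F)) (if hX : (Θ X).2 ∈ F then ⟨(Θ X).2, hX⟩ else f₀) = _
  rw [dif_pos hF]

theorem IsAdaptedTrivialization.coe_trivialization_symm {φ : OpenPartialHomeomorph N V}
    {Θ : OpenPartialHomeomorph (TangentBundle 𝓘(ℝ, V) N) (V × V)}
    (h : IsAdaptedTrivialization A F φ Θ) (f₀ : F) (a₀ : A) {m : N} (hm : m ∈ φ.source) (f : F) :
    ((h.trivialization f₀ a₀).toOpenPartialHomeomorph.symm (m, f) : TangentBundle 𝓘(ℝ, V) N)
      = Θ.symm (φ m, (f : V)) := by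
  classical
  have ht : (φ m, (f : V)) ∈ Θ.target := by
    rw [h.target_eq]; exact ⟨φ.map_source hm, mem_univ _⟩
  have hA : Θ.symm (φ m, (f : V)) ∈ A := by
    rw [h.mem_iff _ (Θ.map_target ht), Θ.right_inv ht]; exact f.2
  change Subtype.val (p := (· ∈ A)) (if hA : Θ.symm (φ m, (f : V)) ∈ A then
      ⟨Θ.symm (φ m, (f : V)), hA⟩ else a₀) = _
  rw [dif_pos hA]

/-- In a trivialization `Θ` the set `A` is `φ.target × F`, so a slice chart of `F` times the base
gives slice charts of `A`, with model `V × V₁`. The restrictions of the same `Θ` are the local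
trivializations of the bundle; their smoothness is tested after the inclusions of `A` in `TN` and of
`F` in `V`. -/
theorem isFiberSubbundle_of_adapted [FiniteDimensional ℝ V₁] (hF : IsSliceSet 𝓘(ℝ, V) V₁ V₂ F)
    (hne : F.Nonempty) (e : (V₁ × V₂) ≃L[ℝ] V)
    (h : ∀ b : N, ∃ φ Θ, b ∈ φ.source ∧ IsAdaptedTrivialization A F φ Θ) :
    IsFiberSubbundle 𝓘(ℝ, V) A := by
  have hTN : IsManifold 𝓘(ℝ, V).tangent ∞ (TangentBundle 𝓘(ℝ, V) N) := by
    have : IsManifold 𝓘(ℝ, V) (∞ + 1) N := ‹_›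
    infer_instance
  have hA : IsSliceSet 𝓘(ℝ, V).tangent (V × V₁) (PUnit.{1} × V₂) A := by
    refine IsSliceSet.comap (isSliceSet_univ.prod hF) fun X _ => ?_
    obtain ⟨φ, Θ, hX, hΘ⟩ := h X.proj
    refine ⟨Θ, by rw [hΘ.source_eq]; exact hX, hΘ.smooth, fun Y hY => ?_⟩
    rw [hΘ.mem_iff Y hY]
    simp
  have eA : ((V × V₁) × (PUnit.{1} × V₂)) ≃L[ℝ] V × V :=
    (ContinuousLinearEquiv.prodProdProdComm ℝ V V₁ PUnit.{1} V₂).trans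
      ((ContinuousLinearEquiv.prodUnique ℝ V PUnit.{1}).prodCongr e)
  let cA := hA.chartedSpace
  have mA := hA.isManifold
  let cF := hF.chartedSpace
  have mF := hF.isManifold
  have hiA := hA.isImmersion eA
  have hiF := hF.isImmersion e
  obtain ⟨f₀⟩ : Nonempty F := hne.to_subtype
  -- A proper space is second countable, and the fiber `F`, as a subset of `V`, inherits this.
  have hV : ProperSpace V := FiniteDimensional.proper_real V
  have hproj : ContMDiff 𝓘(ℝ, V).tangent 𝓘(ℝ, V) ∞
      (Bundle.TotalSpace.proj : TangentBundle 𝓘(ℝ, V) N → N) :=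
    Bundle.contMDiff_proj (TangentSpace 𝓘(ℝ, V))
  refine ⟨V × V₁, inferInstance, inferInstance, inferInstance, cA, mA, V₁, inferInstance,
    inferInstance, inferInstance, F, inferInstance, inferInstance,
    inferInstance, cF, mF,
    ⟨hiA.isImmersion, Topology.IsEmbedding.subtypeVal⟩, hproj.comp hiA.contMDiff, fun b => ?_,
    fun b => ?_⟩
  · obtain ⟨φ, Θ, hb, hΘ⟩ := h b
    have ht : (φ b, (f₀ : V)) ∈ Θ.target := by
      rw [hΘ.target_eq]; exact ⟨φ.map_source hb, mem_univ _⟩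
    refine ⟨⟨Θ.symm (φ b, f₀), ?_⟩, ?_⟩
    · rw [hΘ.mem_iff _ (Θ.map_target ht), Θ.right_inv ht]; exact f₀.2
    · simp only
      rw [hΘ.proj_symm (φ.map_source hb), φ.left_inv hb]
  · obtain ⟨φ, Θ, hb, hΘ⟩ := h b
    have ht : (φ b, (f₀ : V)) ∈ Θ.target := by
      rw [hΘ.target_eq]; exact ⟨φ.map_source hb, mem_univ _⟩
    have a₀ : A := ⟨Θ.symm (φ b, f₀), by
      rw [hΘ.mem_iff _ (Θ.map_target ht), Θ.right_inv ht]; exact f₀.2⟩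
    refine ⟨hΘ.trivialization f₀ a₀, hb, ?_, ?_⟩
    · have hs : ∀ X ∈ (hΘ.trivialization f₀ a₀).source,
          (X : TangentBundle 𝓘(ℝ, V) N) ∈ Θ.source := by
        intro X hX
        rw [hΘ.source_eq]; exact hX
      refine ContMDiffOn.prodMk (hproj.comp hiA.contMDiff).contMDiffOn ?_
      refine (hF.contMDiffOn_iff e (hΘ.trivialization f₀ a₀).open_source).2 ?_
      have h1 : ContMDiffOn 𝓘(ℝ, V × V₁) 𝓘(ℝ, V) ∞ (fun X : A => (Θ X).2)
          (hΘ.trivialization f₀ a₀).source :=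
        (contDiff_snd.contMDiff (n := ∞)).comp_contMDiffOn
          (hΘ.smooth.1.comp hiA.contMDiff.contMDiffOn hs)
      exact h1.congr fun X hX => hΘ.trivialization_snd f₀ a₀ hX
    · refine (hA.contMDiffOn_iff eA (hΘ.trivialization f₀ a₀).open_target).2 ?_
      have h1 : ContMDiffOn (𝓘(ℝ, V).prod 𝓘(ℝ, V₁)) 𝓘(ℝ, V).tangent ∞
          (fun mf : N × F => Θ.symm (φ mf.1, (mf.2 : V))) (φ.source ×ˢ univ) := by
        refine hΘ.smooth.2.comp (ContMDiffOn.prodMk_space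
          (hΘ.smooth_base.1.comp contMDiff_fst.contMDiffOn fun x hx => hx.1)
          (hiF.contMDiff.comp contMDiff_snd).contMDiffOn) ?_
        rintro ⟨m, f⟩ ⟨hm, -⟩
        change _ ∈ Θ.target
        rw [hΘ.target_eq]; exact ⟨φ.map_source hm, mem_univ _⟩
      exact h1.congr fun mf hmf => hΘ.coe_trivialization_symm f₀ a₀ hmf.1 mf.2

end Criterion

/-! ### Frames and the isometry group -/

theorem form_comm (κ : SignType) (x y : R4) : form κ x y = form κ y x := by
  simp only [form]; ring

/-- `(p; v, a, b)` is a positively oriented orthonormal frame of `M_κ` at `p`. -/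
structure IsFrame (κ : SignType) (p v a b : R4) : Prop where
  mem : p ∈ spaceForm κ
  tv : v ∈ tangentAt κ p
  ta : a ∈ tangentAt κ p
  tb : b ∈ tangentAt κ p
  vv : form κ v v = 1
  aa : form κ a a = 1
  bb : form κ b b = 1
  va : form κ v a = 0
  vb : form κ v b = 0
  ab : form κ a b = 0
  pos : 0 < (Matrix.of ![p, v, a, b]).det

/-- The matrix with columns `p, v, a, b`. -/
def frameMatrix (p v a b : R4) : Matrix (Fin 4) (Fin 4) ℝ := (Matrix.of ![p, v, a, b])ᵀ

theorem frameMatrix_mulVec (p v a b x : R4) :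
    frameMatrix p v a b *ᵥ x = x 0 • p + x 1 • v + x 2 • a + x 3 • b := by
  funext i
  simp [frameMatrix, Matrix.mulVec, dotProduct, Fin.sum_univ_four]
  ring

theorem form_comb (κ : SignType) (p v a b x y : R4) :
    form κ (x 0 • p + x 1 • v + x 2 • a + x 3 • b) (y 0 • p + y 1 • v + y 2 • a + y 3 • b)
      = x 0 * y 0 * form κ p p + (x 0 * y 1 + x 1 * y 0) * form κ p v
        + (x 0 * y 2 + x 2 * y 0) * form κ p a + (x 0 * y 3 + x 3 * y 0) * form κ p b
        + x 1 * y 1 * form κ v v + x 2 * y 2 * form κ a a + x 3 * y 3 * form κ b b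
        + (x 1 * y 2 + x 2 * y 1) * form κ v a + (x 1 * y 3 + x 3 * y 1) * form κ v b
        + (x 2 * y 3 + x 3 * y 2) * form κ a b := by
  simp only [form, Pi.add_apply, Pi.smul_apply, smul_eq_mul]
  ring

/-- Invariance says `gᵀ J g = J` for `J = diag (κ, 1, 1, 1)`, which is invertible only because `κ ≠
0`; take determinants. -/
theorem sq_det_eq_one_of_form {κ : SignType} (hκ : κ ≠ 0) {g : Matrix (Fin 4) (Fin 4) ℝ}
    (h : ∀ x y, form κ (g *ᵥ x) (g *ᵥ y) = form κ x y) : g.det ^ 2 = 1 := by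
  have hm : gᵀ * Matrix.diagonal ![(κ : ℝ), 1, 1, 1] * g = Matrix.diagonal ![(κ : ℝ), 1, 1, 1] := by
    ext i j
    have := h (Pi.single i 1) (Pi.single j 1)
    simp only [form, Matrix.mulVec_single_one, Matrix.col_apply] at this
    rw [Matrix.mul_assoc, Matrix.mul_apply, Fin.sum_univ_four]
    simp only [Matrix.diagonal_mul, Matrix.transpose_apply]
    fin_cases i <;> fin_cases j <;> simp at this ⊢ <;> linarith
  have hd := congrArg Matrix.det hm
  rw [Matrix.det_mul, Matrix.det_mul, Matrix.det_transpose] at hd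
  have h0 : (Matrix.diagonal ![(κ : ℝ), 1, 1, 1]).det ≠ 0 := by
    rw [Matrix.det_diagonal]
    rcases κ with _ | _ | _
    · exact absurd rfl hκ
    all_goals simp [Fin.prod_univ_four]
  have : g.det ^ 2 * (Matrix.diagonal ![(κ : ℝ), 1, 1, 1]).det
      = 1 * (Matrix.diagonal ![(κ : ℝ), 1, 1, 1]).det := by
    rw [one_mul]; nth_rewrite 2 [← hd]; ring
  exact mul_right_cancel₀ h0 this

/-- For `κ = ±1` a frame has the same Gram matrix as the canonical basis, so the form is preserved;
the squared determinant is `1` and positivity fixes its sign. For `κ = 0` the form is degenerate,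
and the block shape is used instead: the first row is `(1, 0, 0, 0)`, and the `3 × 3` block is
orthogonal with the same determinant as the whole matrix. -/
theorem IsFrame.frameMatrix_mem {κ : SignType} {p v a b : R4} (h : IsFrame κ p v a b) :
    frameMatrix p v a b ∈ isometryGroup κ := by
  obtain ⟨hp, hv, ha, hb, h1, h2, h3, h4, h5, h6, hd⟩ := h
  have hdet : 0 < (frameMatrix p v a b).det := by rwa [frameMatrix, Matrix.det_transpose]
  rcases κ with _ | _ | _
  · have hp : p 0 = 1 := hp
    have hv : v 0 = 0 := hv
    have ha : a 0 = 0 := ha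
    have hb : b 0 = 0 := hb
    have ho : (frameMatrix p v a b).submatrix Fin.succ Fin.succ
        ∈ Matrix.orthogonalGroup (Fin 3) ℝ := by
      rw [Matrix.mem_orthogonalGroup_iff']
      simp only [form, SignType.zero_eq_zero, SignType.coe_zero, zero_mul, zero_add]
        at h1 h2 h3 h4 h5 h6
      ext i j
      fin_cases i <;> fin_cases j <;>
        simp [Matrix.mul_apply, frameMatrix, Fin.sum_univ_three] <;> linarith
    have hs : (frameMatrix p v a b).det
        = ((frameMatrix p v a b).submatrix Fin.succ Fin.succ).det := by
      rw [Matrix.det_succ_row_zero, Fin.sum_univ_four]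
      simp [frameMatrix, hp, hv, ha, hb]
    refine ⟨by simpa [frameMatrix] using hp, fun i => ?_, ?_⟩
    · fin_cases i
      · simpa [frameMatrix] using hv
      · simpa [frameMatrix] using ha
      · simpa [frameMatrix] using hb
    · rw [Matrix.mem_specialOrthogonalGroup_iff]
      refine ⟨ho, ?_⟩
      rw [Matrix.mem_orthogonalGroup_iff'] at ho
      have := congrArg Matrix.det ho
      rw [Matrix.det_mul, Matrix.det_transpose, Matrix.det_one] at this
      rw [hs] at hdet
      nlinarith
  · have e1 : form SignType.neg p p = -1 := hp.1
    have e2 : form SignType.neg p v = 0 := hv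
    have e3 : form SignType.neg p a = 0 := ha
    have e4 : form SignType.neg p b = 0 := hb
    have hf : ∀ x y, form (-1) (frameMatrix p v a b *ᵥ x) (frameMatrix p v a b *ᵥ y)
        = form (-1) x y := by
      intro x y
      change form SignType.neg _ _ = form SignType.neg _ _
      rw [frameMatrix_mulVec, frameMatrix_mulVec, form_comb, e1, e2, e3, e4, h1, h2, h3, h4, h5, h6]
      simp only [form, SignType.neg_eq_neg_one, SignType.coe_neg, SignType.coe_one]
      ring
    have hs := sq_det_eq_one_of_form (κ := -1) (by decide) hf
    refine ⟨hf, by nlinarith, ?_⟩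
    rw [frameMatrix_mulVec]
    simpa using hp.2
  · have e1 : form SignType.pos p p = 1 := hp
    have e2 : form SignType.pos p v = 0 := hv
    have e3 : form SignType.pos p a = 0 := ha
    have e4 : form SignType.pos p b = 0 := hb
    have hf : ∀ x y, form 1 (frameMatrix p v a b *ᵥ x) (frameMatrix p v a b *ᵥ y)
        = form 1 x y := by
      intro x y
      change form SignType.pos _ _ = form SignType.pos _ _
      rw [frameMatrix_mulVec, frameMatrix_mulVec, form_comb, e1, e2, e3, e4, h1, h2, h3, h4, h5, h6]
      simp only [form, SignType.pos_eq_one, SignType.coe_one]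
      ring
    have hs := sq_det_eq_one_of_form (κ := 1) (by decide) hf
    exact ⟨hf, by nlinarith⟩

theorem isometryGroup_det {κ : SignType} {g : Matrix (Fin 4) (Fin 4) ℝ}
    (hg : g ∈ isometryGroup κ) : g.det = 1 := by
  rcases κ with _ | _ | _
  · obtain ⟨h0, h1, h2⟩ := hg
    rw [Matrix.mem_specialOrthogonalGroup_iff] at h2
    rw [Matrix.det_succ_row_zero, Fin.sum_univ_succ, ← h2.2]
    have : (Fin.succAbove 0 : Fin 3 → Fin 4) = Fin.succ := by
      funext i
      simp
    simp [h0, h1, this]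
  · exact hg.2.1
  · exact hg.2

theorem mulVec_mem_tangentAt {κ : SignType} {g : Matrix (Fin 4) (Fin 4) ℝ}
    (hg : g ∈ isometryGroup κ) {p v : R4} (hv : v ∈ tangentAt κ p) :
    g *ᵥ v ∈ tangentAt κ (g *ᵥ p) := by
  rcases κ with _ | _ | _
  · have hv : v 0 = 0 := hv
    have h1 := hg.2.1 0
    have h2 := hg.2.1 1
    have h3 := hg.2.1 2
    change (g *ᵥ v) 0 = 0
    simp only [Fin.isValue, Fin.succ_zero_eq_one, Fin.succ_one_eq_two,
      show Fin.succ (2 : Fin 3) = (3 : Fin 4) from rfl] at h1 h2 h3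
    simp [Matrix.mulVec, dotProduct, Fin.sum_univ_four, hv, h1, h2, h3]
  · exact (hg.1 p v).trans hv
  · exact (hg.1 p v).trans hv

theorem IsFrame.mulVec {κ : SignType} {p v a b : R4} (h : IsFrame κ p v a b)
    {g : Matrix (Fin 4) (Fin 4) ℝ} (hg : g ∈ isometryGroup κ) :
    IsFrame κ (g *ᵥ p) (g *ᵥ v) (g *ᵥ a) (g *ᵥ b) := by
  obtain ⟨hp, hv, ha, hb, h1, h2, h3, h4, h5, h6, hd⟩ := h
  refine ⟨mulVec_mem_spaceForm hg hp, mulVec_mem_tangentAt hg hv, mulVec_mem_tangentAt hg ha,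
    mulVec_mem_tangentAt hg hb, by rwa [form_mulVec hg hv hv], by rwa [form_mulVec hg ha ha],
    by rwa [form_mulVec hg hb hb], by rwa [form_mulVec hg hv ha], by rwa [form_mulVec hg hv hb],
    by rwa [form_mulVec hg ha hb], ?_⟩
  have : Matrix.of ![g *ᵥ p, g *ᵥ v, g *ᵥ a, g *ᵥ b] = Matrix.of ![p, v, a, b] * gᵀ := by
    ext i j
    fin_cases i <;> simp [Matrix.mul_apply, Matrix.mulVec, dotProduct, mul_comm]
  rw [this, Matrix.det_mul, Matrix.det_transpose, isometryGroup_det hg, mul_one]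
  exact hd

theorem isFrame_standard (κ : SignType) :
    IsFrame κ ![1, 0, 0, 0] ![0, 1, 0, 0] ![0, 0, 1, 0] ![0, 0, 0, 1] := by
  have hd : Matrix.of ![![1, 0, 0, 0], ![0, 1, 0, 0], ![0, 0, 1, 0], ![0, 0, 0, 1]]
      = (1 : Matrix (Fin 4) (Fin 4) ℝ) := by
    ext i j
    fin_cases i <;> fin_cases j <;> simp
  refine ⟨?_, ?_, ?_, ?_, ?_, ?_, ?_, ?_, ?_, ?_, by rw [hd]; simp⟩ <;>
    first
    | simp [form]
    | rcases κ with _ | _ | _ <;> simp [spaceForm, tangentAt, form]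

/-! ### `G_κ` as a group, through frames -/

theorem frameMatrix_columns (g : Matrix (Fin 4) (Fin 4) ℝ) :
    frameMatrix (g *ᵥ ![1, 0, 0, 0]) (g *ᵥ ![0, 1, 0, 0]) (g *ᵥ ![0, 0, 1, 0])
      (g *ᵥ ![0, 0, 0, 1]) = g := by
  ext i j
  fin_cases j <;> simp [frameMatrix, Matrix.mulVec, dotProduct, Fin.sum_univ_four]

/-- Both factors carry frames to frames, so the columns of the product are a frame. This avoids a
case distinction on `κ`. -/
theorem mul_mem_isometryGroup {κ : SignType} {g h : Matrix (Fin 4) (Fin 4) ℝ}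
    (hg : g ∈ isometryGroup κ) (hh : h ∈ isometryGroup κ) : g * h ∈ isometryGroup κ := by
  have := (((isFrame_standard κ).mulVec hh).mulVec hg).frameMatrix_mem
  simp only [Matrix.mulVec_mulVec] at this
  rwa [frameMatrix_columns] at this

/-- For `κ = ±1` the invariance of the form passes to the inverse at once. For `κ = 0` invariance is
known only on vectors with `x₀ = 0`, so the inverse is recognized instead by the frame formed by its
columns. -/
theorem inv_mem_isometryGroup {κ : SignType} {g : Matrix (Fin 4) (Fin 4) ℝ}
    (hg : g ∈ isometryGroup κ) : g⁻¹ ∈ isometryGroup κ := by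
  have hd := isometryGroup_det hg
  have hu : IsUnit g.det := by rw [hd]; exact isUnit_one
  have hi : ∀ x : R4, g *ᵥ (g⁻¹ *ᵥ x) = x := fun x => by
    rw [Matrix.mulVec_mulVec, Matrix.mul_nonsing_inv g hu, Matrix.one_mulVec]
  have hd' : g⁻¹.det = 1 := by rw [Matrix.det_nonsing_inv, hd, Ring.inverse_one]
  rcases κ with _ | _ | _
  · obtain ⟨h0, h1, h2⟩ := id hg
    have hz : ∀ x : R4, (g⁻¹ *ᵥ x) 0 = x 0 := by
      intro x
      have := congrFun (hi x) 0
      have a1 := h1 0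
      have a2 := h1 1
      have a3 := h1 2
      simp only [Fin.isValue, Fin.succ_zero_eq_one, Fin.succ_one_eq_two,
        show Fin.succ (2 : Fin 3) = (3 : Fin 4) from rfl] at a1 a2 a3
      rw [Matrix.mulVec, dotProduct, Fin.sum_univ_four, h0, a1, a2, a3] at this
      linarith
    have ht : ∀ x : R4, x 0 = 0 → g⁻¹ *ᵥ x ∈ tangentAt SignType.zero 0 := fun x hx =>
      (hz x).trans hx
    have hf : ∀ x y : R4, x 0 = 0 → y 0 = 0 →
        form SignType.zero (g⁻¹ *ᵥ x) (g⁻¹ *ᵥ y) = form SignType.zero x y := by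
      intro x y hx hy
      have := form_mulVec hg (ht x hx) (ht y hy)
      rw [hi, hi] at this
      exact this.symm
    rw [← frameMatrix_columns g⁻¹]
    refine IsFrame.frameMatrix_mem ⟨hz _, hz _, hz _, hz _, ?_, ?_, ?_, ?_, ?_, ?_, ?_⟩
    any_goals
      rw [hf _ _ rfl rfl]
      simp [form]
    have := congrArg Matrix.det (frameMatrix_columns g⁻¹)
    rw [frameMatrix, Matrix.det_transpose, hd'] at this
    rw [this]
    exact one_pos
  · have hf : ∀ x y, form (-1) (g⁻¹ *ᵥ x) (g⁻¹ *ᵥ y) = form (-1) x y := fun x y => by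
      rw [← hg.1, hi, hi]
    refine ⟨hf, hd', ?_⟩
    -- Pairing `g⁻¹ e₀` with `e₀` equals pairing `e₀` with `g e₀`. Hence `g` and `g⁻¹` have the same
    -- `(0, 0)` entry, and both preserve the upper sheet.
    have h1 := hg.1 (g⁻¹ *ᵥ ![1, 0, 0, 0]) ![1, 0, 0, 0]
    rw [hi] at h1
    have h2 := hg.2.2
    simp [form] at h1
    rw [← h1]
    exact h2
  · exact ⟨fun x y => by rw [← hg.1, hi, hi], hd'⟩

/-! ### Orthonormalization and transitivity -/

theorem form_add_right (κ : SignType) (x y z : R4) : form κ x (y + z) = form κ x y + form κ x z := by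
  simp only [form, Pi.add_apply]; ring

theorem form_sub_right (κ : SignType) (x y z : R4) : form κ x (y - z) = form κ x y - form κ x z := by
  simp only [form, Pi.sub_apply]; ring

theorem form_smul_right (κ : SignType) (c : ℝ) (x y : R4) : form κ x (c • y) = c * form κ x y := by
  simp only [form, Pi.smul_apply, smul_eq_mul]; ring

theorem form_smul_left (κ : SignType) (c : ℝ) (x y : R4) : form κ (c • x) y = c * form κ x y := by
  simp only [form, Pi.smul_apply, smul_eq_mul]; ring

theorem dualForm_add_right (κ : SignType) (x y z : R4) :
    dualForm κ x (y + z) = dualForm κ x y + dualForm κ x z := by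
  simp only [dualForm, Pi.add_apply]; ring

theorem dualForm_sub_right (κ : SignType) (x y z : R4) :
    dualForm κ x (y - z) = dualForm κ x y - dualForm κ x z := by
  simp only [dualForm, Pi.sub_apply]; ring

theorem dualForm_smul_right (κ : SignType) (c : ℝ) (x y : R4) :
    dualForm κ x (c • y) = c * dualForm κ x y := by
  simp only [dualForm, Pi.smul_apply, smul_eq_mul]; ring

theorem tangentAt_smul {κ : SignType} {p v : R4} (hp : p ∈ spaceForm κ) (hv : v ∈ tangentAt κ p)
    (c : ℝ) : c • v ∈ tangentAt κ p := by
  rw [mem_tangentAt_iff hp] at hv ⊢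
  rw [dualForm_smul_right, hv, mul_zero]

theorem tangentAt_sub {κ : SignType} {p v w : R4} (hp : p ∈ spaceForm κ) (hv : v ∈ tangentAt κ p)
    (hw : w ∈ tangentAt κ p) : v - w ∈ tangentAt κ p := by
  rw [mem_tangentAt_iff hp] at hv hw ⊢
  rw [dualForm_sub_right, hv, hw, sub_zero]

theorem tangentAt_add {κ : SignType} {p v w : R4} (hp : p ∈ spaceForm κ) (hv : v ∈ tangentAt κ p)
    (hw : w ∈ tangentAt κ p) : v + w ∈ tangentAt κ p := by
  rw [mem_tangentAt_iff hp] at hv hw ⊢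
  rw [dualForm_add_right, hv, hw, add_zero]

/-- `x / |x|`. -/
noncomputable def unitVector (κ : SignType) (x : R4) : R4 := (√(form κ x x))⁻¹ • x

theorem form_unitVector {κ : SignType} {x : R4} (h : 0 < form κ x x) :
    form κ (unitVector κ x) (unitVector κ x) = 1 := by
  have h1 : 0 < √(form κ x x) := Real.sqrt_pos.2 h
  have h2 := Real.mul_self_sqrt h.le
  rw [unitVector, form_smul_left, form_smul_right]
  field_simp
  linarith

/-- The multiple of `x` in `M_κ`. -/
noncomputable def orthoPoint (κ : SignType) (x : R4) : R4 := (√(dualForm κ x x))⁻¹ • x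

/-- The component of `y` tangent to `M_κ` at `p`. -/
def tangentPart (κ : SignType) (p y : R4) : R4 := y - dualForm κ p y • p

/-- The component of `y` orthogonal to `v`. -/
def orthoPart (κ : SignType) (v y : R4) : R4 := y - form κ v y • v

theorem orthoPoint_mem {κ : SignType} {x : R4} (h : 0 < dualForm κ x x) (h0 : κ ≠ 1 → 0 < x 0) :
    orthoPoint κ x ∈ spaceForm κ := by
  have h1 : 0 < √(dualForm κ x x) := Real.sqrt_pos.2 h
  have h2 := Real.mul_self_sqrt h.le
  rw [mem_spaceForm_iff]
  refine ⟨?_, fun hκ => ?_⟩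
  · rw [orthoPoint, dualForm_smul_right, dualForm_comm κ (_ • x) x, dualForm_smul_right]
    field_simp
    linarith
  · have := h0 hκ
    simp only [orthoPoint, Pi.smul_apply, smul_eq_mul]
    positivity

theorem tangentPart_mem {κ : SignType} {p : R4} (hp : p ∈ spaceForm κ) (y : R4) :
    tangentPart κ p y ∈ tangentAt κ p := by
  rw [mem_tangentAt_iff hp, tangentPart, dualForm_sub_right, dualForm_smul_right,
    ((mem_spaceForm_iff κ p).1 hp).1, mul_one, sub_self]

theorem form_orthoPart {κ : SignType} {v : R4} (hv : form κ v v = 1) (y : R4) :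
    form κ v (orthoPart κ v y) = 0 := by
  rw [orthoPart, form_sub_right, form_smul_right, hv, mul_one, sub_self]

theorem orthoPart_mem {κ : SignType} {p v y : R4} (hp : p ∈ spaceForm κ) (hv : v ∈ tangentAt κ p)
    (hy : y ∈ tangentAt κ p) : orthoPart κ v y ∈ tangentAt κ p :=
  tangentAt_sub hp hy (tangentAt_smul hp hv _)

/-- Gram–Schmidt is left multiplication by a lower triangular matrix. With unit diagonal this shows
that no intermediate vector vanishes; with positive diagonal it shows that the orientation is kept.
-/
theorem det_triangular (x₀ x₁ x₂ x₃ : R4) (c₀ c₁ c₂ c₃ a b c d e f : ℝ) :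
    (Matrix.of ![c₀ • x₀, c₁ • x₁ + a • x₀, c₂ • x₂ + b • x₁ + c • x₀,
      c₃ • x₃ + d • x₂ + e • x₁ + f • x₀]).det
      = c₀ * c₁ * c₂ * c₃ * (Matrix.of ![x₀, x₁, x₂, x₃]).det := by
  have : Matrix.of ![c₀ • x₀, c₁ • x₁ + a • x₀, c₂ • x₂ + b • x₁ + c • x₀,
      c₃ • x₃ + d • x₂ + e • x₁ + f • x₀]
      = Matrix.of ![![c₀, 0, 0, 0], ![a, c₁, 0, 0], ![c, b, c₂, 0], ![f, e, d, c₃]]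
        * Matrix.of ![x₀, x₁, x₂, x₃] := by
    ext i j
    fin_cases i <;> simp [Matrix.mul_apply, Fin.sum_univ_four] <;> ring
  rw [this, Matrix.det_mul]
  congr 1
  simp [Matrix.det_succ_row_zero, Fin.sum_univ_succ]
  ring

/-- The orthonormal frame obtained from a basis of `ℝ⁴` by the Gram–Schmidt process. -/
noncomputable def gramSchmidtFrame (κ : SignType) (x₀ x₁ x₂ x₃ : R4) : Fin 4 → R4 :=
  let p := orthoPoint κ x₀
  let v := unitVector κ (tangentPart κ p x₁)
  let a := unitVector κ (orthoPart κ v (tangentPart κ p x₂))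
  let b := unitVector κ (orthoPart κ a (orthoPart κ v (tangentPart κ p x₃)))
  ![p, v, a, b]

/-- Each `wᵢ` is `xᵢ` plus a combination of the earlier vectors. If it vanished, `det_triangular`
would make the determinant zero. Being tangent and nonzero it has positive square, as the form is
positive definite on tangent spaces. The three positivity facts are part of the conclusion because
the smooth dependence of the normalizations rests on them. -/
theorem gramSchmidtFrame_spec {κ : SignType} {x₀ x₁ x₂ x₃ : R4} (h : 0 < dualForm κ x₀ x₀)
    (h0 : κ ≠ 1 → 0 < x₀ 0) (hd : 0 < (Matrix.of ![x₀, x₁, x₂, x₃]).det) :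
    let w₁ := tangentPart κ (orthoPoint κ x₀) x₁
    let v := unitVector κ w₁
    let w₂ := orthoPart κ v (tangentPart κ (orthoPoint κ x₀) x₂)
    let a := unitVector κ w₂
    let w₃ := orthoPart κ a (orthoPart κ v (tangentPart κ (orthoPoint κ x₀) x₃))
    0 < form κ w₁ w₁ ∧ 0 < form κ w₂ w₂ ∧ 0 < form κ w₃ w₃ ∧
      IsFrame κ (orthoPoint κ x₀) v a (unitVector κ w₃) := by
  intro w₁ v w₂ a w₃
  set p := orthoPoint κ x₀ with hp
  have hpM : p ∈ spaceForm κ := orthoPoint_mem h h0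
  set c₀ := (√(dualForm κ x₀ x₀))⁻¹ with hc₀
  have hc₀p : 0 < c₀ := inv_pos.2 (Real.sqrt_pos.2 h)
  have hpx : p = c₀ • x₀ := rfl
  have e1 : ∃ α : ℝ, w₁ = x₁ + α • x₀ :=
    ⟨-(dualForm κ p x₁) * c₀, by
      change x₁ - dualForm κ p x₁ • p = _
      generalize dualForm κ p x₁ = q
      rw [hpx]
      module⟩
  obtain ⟨α, e1⟩ := e1
  have t1 : w₁ ∈ tangentAt κ p := tangentPart_mem hpM _
  have n1 : w₁ ≠ 0 := by
    intro h0
    have := det_triangular x₀ x₁ x₂ x₃ 1 1 1 1 α 0 0 0 0 0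
    rw [one_smul ℝ x₁, ← e1, h0, Matrix.det_eq_zero_of_row_eq_zero 1 (fun j => by simp)] at this
    simp at this
    linarith
  have f1 : 0 < form κ w₁ w₁ := form_pos hpM t1 n1
  have tv : v ∈ tangentAt κ p := tangentAt_smul hpM t1 _
  have vv : form κ v v = 1 := form_unitVector f1
  set c₁ := (√(form κ w₁ w₁))⁻¹ with hc₁
  have hc₁p : 0 < c₁ := inv_pos.2 (Real.sqrt_pos.2 f1)
  have ev : v = c₁ • x₁ + (c₁ * α) • x₀ := by
    change c₁ • w₁ = _
    rw [e1]; module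
  have e2 : ∃ β γ : ℝ, w₂ = x₂ + β • x₁ + γ • x₀ := by
    refine ⟨-(form κ v (tangentPart κ p x₂)) * c₁,
      -(form κ v (tangentPart κ p x₂)) * (c₁ * α) - dualForm κ p x₂ * c₀, ?_⟩
    change tangentPart κ p x₂ - form κ v (tangentPart κ p x₂) • v = _
    generalize form κ v (tangentPart κ p x₂) = q
    simp only [ev, tangentPart, hpx]
    module
  obtain ⟨β, γ, e2⟩ := e2
  have t2 : w₂ ∈ tangentAt κ p := orthoPart_mem hpM tv (tangentPart_mem hpM _)
  have n2 : w₂ ≠ 0 := by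
    intro h0
    have := det_triangular x₀ x₁ x₂ x₃ 1 1 1 1 0 β γ 0 0 0
    rw [one_smul ℝ x₂, ← e2, h0, Matrix.det_eq_zero_of_row_eq_zero 2 (fun j => by simp)] at this
    simp at this
    linarith
  have f2 : 0 < form κ w₂ w₂ := form_pos hpM t2 n2
  have ta : a ∈ tangentAt κ p := tangentAt_smul hpM t2 _
  have aa : form κ a a = 1 := form_unitVector f2
  have va : form κ v a = 0 := by
    change form κ v (_ • w₂) = 0
    rw [form_smul_right, form_orthoPart vv, mul_zero]
  set c₂ := (√(form κ w₂ w₂))⁻¹ with hc₂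
  have hc₂p : 0 < c₂ := inv_pos.2 (Real.sqrt_pos.2 f2)
  have ea : a = c₂ • x₂ + (c₂ * β) • x₁ + (c₂ * γ) • x₀ := by
    change c₂ • w₂ = _
    rw [e2]; module
  have e3 : ∃ δ ε ζ : ℝ, w₃ = x₃ + δ • x₂ + ε • x₁ + ζ • x₀ := by
    set y := orthoPart κ v (tangentPart κ p x₃) with hy
    refine ⟨-(form κ a y) * c₂,
      -(form κ a y) * (c₂ * β) - form κ v (tangentPart κ p x₃) * c₁,
      -(form κ a y) * (c₂ * γ) - form κ v (tangentPart κ p x₃) * (c₁ * α)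
        - dualForm κ p x₃ * c₀, ?_⟩
    change y - form κ a y • a = _
    generalize form κ a y = q
    rw [hy]
    change tangentPart κ p x₃ - form κ v (tangentPart κ p x₃) • v - _ = _
    generalize form κ v (tangentPart κ p x₃) = q'
    simp only [ea, ev, tangentPart, hpx]
    module
  obtain ⟨δ, ε, ζ, e3⟩ := e3
  have t3 : w₃ ∈ tangentAt κ p :=
    orthoPart_mem hpM ta (orthoPart_mem hpM tv (tangentPart_mem hpM _))
  have n3 : w₃ ≠ 0 := by
    intro h0
    have := det_triangular x₀ x₁ x₂ x₃ 1 1 1 1 0 0 0 δ ε ζ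
    rw [one_smul ℝ x₃, ← e3, h0, Matrix.det_eq_zero_of_row_eq_zero 3 (fun j => by simp)] at this
    simp at this
    linarith
  have f3 : 0 < form κ w₃ w₃ := form_pos hpM t3 n3
  set c₃ := (√(form κ w₃ w₃))⁻¹ with hc₃
  have hc₃p : 0 < c₃ := inv_pos.2 (Real.sqrt_pos.2 f3)
  have eb : unitVector κ w₃
      = c₃ • x₃ + (c₃ * δ) • x₂ + (c₃ * ε) • x₁ + (c₃ * ζ) • x₀ := by
    change c₃ • w₃ = _
    rw [e3]; module
  refine ⟨f1, f2, f3, hpM, tv, ta, tangentAt_smul hpM t3 _, vv, aa, form_unitVector f3, va, ?_, ?_,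
    ?_⟩
  · have : form κ v w₃ = 0 := by
      change form κ v (_ - form κ a _ • a) = 0
      rw [form_sub_right, form_smul_right, form_orthoPart vv, va]
      simp
    rw [unitVector, form_smul_right, this, mul_zero]
  · rw [unitVector, form_smul_right, form_orthoPart aa, mul_zero]
  · rw [hpx, ev, ea, eb, det_triangular]
    positivity

/-- The determinants of `p, v, e_k, e_l` are, up to sign, the coordinates of `p ∧ v`, and exchanging
`k` and `l` changes the sign. Since `p ∧ v ≠ 0`, some pair gives a positive basis, and Gram–Schmidt
leaves `p` and `v` as they are. -/
theorem exists_isFrame {κ : SignType} {p v : R4} (hp : p ∈ spaceForm κ) (hv : v ∈ tangentAt κ p)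
    (h1 : form κ v v = 1) : ∃ a b, IsFrame κ p v a b := by
  obtain ⟨k, l, hd⟩ : ∃ k l : Fin 4,
      0 < (Matrix.of ![p, v, Pi.single k 1, Pi.single l 1] : Matrix (Fin 4) (Fin 4) ℝ).det := by
    by_contra! H
    obtain ⟨i, j, hij⟩ := exists_wedge_ne_zero hp hv h1
    apply hij
    have a01 := H 0 1
    have a10 := H 1 0
    have a02 := H 0 2
    have a20 := H 2 0
    have a03 := H 0 3
    have a30 := H 3 0
    have a12 := H 1 2
    have a21 := H 2 1
    have a13 := H 1 3
    have a31 := H 3 1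
    have a23 := H 2 3
    have a32 := H 3 2
    simp [Matrix.det_succ_row_zero, Fin.sum_univ_succ, Fin.succAbove, Pi.single_apply]
      at a01 a10 a02 a20 a03 a30 a12 a21 a13 a31 a23 a32
    simp only [wedge]
    fin_cases i <;> fin_cases j <;> simp <;> linarith
  obtain ⟨hpp, hp0⟩ := (mem_spaceForm_iff κ p).1 hp
  have h := (gramSchmidtFrame_spec (by rw [hpp]; exact one_pos) hp0 hd).2.2.2
  have e0 : orthoPoint κ p = p := by simp [orthoPoint, hpp]
  have e1 : unitVector κ (tangentPart κ p v) = v := by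
    simp [unitVector, tangentPart, (mem_tangentAt_iff hp v).1 hv, h1]
  rw [e0, e1] at h
  exact ⟨_, _, h⟩

theorem mkGeodesic_eq_of_init {κ : SignType} {σ₁ σ₂ : UnitGeodesic κ} (h : σ₁.1 0 = σ₂.1 0)
    (h' : deriv σ₁.1 0 = deriv σ₂.1 0) : mkGeodesic σ₁ = mkGeodesic σ₂ :=
  mkGeodesic_eq_of_wedge one_pos fun i j => by rw [h, h', one_mul]

theorem deriv_mulVec {κ : SignType} (g : Matrix (Fin 4) (Fin 4) ℝ) (σ : UnitGeodesic κ) (t : ℝ) :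
    deriv (fun t => g *ᵥ σ.1 t) t = g *ᵥ deriv σ.1 t :=
  ((LinearMap.toContinuousLinearMap g.mulVecLin).hasFDerivAt.comp_hasDerivAt t
    (contDiff_hasDerivAt σ.2.1 t).1).deriv

/-- The geodesic `g ∘ σ`. -/
def UnitGeodesic.map {κ : SignType} (g : isometryGroup κ) (σ : UnitGeodesic κ) : UnitGeodesic κ :=
  ⟨fun t => g.1 *ᵥ σ.1 t, isUnitGeodesic_mulVec g.2 σ⟩

theorem act_mk {κ : SignType} (g : isometryGroup κ) (σ : UnitGeodesic κ) :
    act g (mkGeodesic σ) = mkGeodesic (σ.map g) := rfl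

theorem standardGeodesic_zero (κ : SignType) : (standardGeodesic κ).1 0 = ![1, 0, 0, 0] ∧
    deriv (standardGeodesic κ).1 0 = ![0, 1, 0, 0] :=
  UnitGeodesic.ofInit_zero _ _ _

theorem mulVec_e0 (p v a b : R4) : frameMatrix p v a b *ᵥ ![1, 0, 0, 0] = p := by
  rw [frameMatrix_mulVec]; simp

theorem mulVec_e1 (p v a b : R4) : frameMatrix p v a b *ᵥ ![0, 1, 0, 0] = v := by
  rw [frameMatrix_mulVec]; simp

/-- The matrix sends `e₀, e₁` to `p, v`, and a geodesic is determined by its oriented plane. The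
factor `r` is allowed because chart inverses are known only through bivectors up to a positive
multiple. -/
theorem act_frameMatrix {κ : SignType} {p v a b : R4} (h : IsFrame κ p v a b) {σ : UnitGeodesic κ}
    {r : ℝ} (hr : 0 < r)
    (hσ : ∀ i j, wedge p v i j = r * wedge (σ.1 0) (deriv σ.1 0) i j) :
    act ⟨frameMatrix p v a b, h.frameMatrix_mem⟩ (mkGeodesic (standardGeodesic κ))
      = mkGeodesic σ := by
  rw [act_mk]
  refine mkGeodesic_eq_of_wedge hr fun i j => ?_
  simp only [UnitGeodesic.map, deriv_mulVec, (standardGeodesic_zero κ).1,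
    (standardGeodesic_zero κ).2, mulVec_e0, mulVec_e1, hσ]

theorem exists_act_eq {κ : SignType} (l : OrientedGeodesic κ) :
    ∃ g : isometryGroup κ, act g (mkGeodesic (standardGeodesic κ)) = l := by
  obtain ⟨σ, rfl⟩ := exists_mk l
  obtain ⟨hp, hv, h1⟩ := σ.frame
  obtain ⟨a, b, h⟩ := exists_isFrame hp hv h1
  exact ⟨_, act_frameMatrix h one_pos fun i j => (one_mul _).symm⟩

/-! ### Smoothness of the action -/

theorem wedge_mulVec (g : Matrix (Fin 4) (Fin 4) ℝ) (x y : R4) (i j : Fin 4) :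
    wedge (g *ᵥ x) (g *ᵥ y) i j = ∑ k, ∑ l, g i k * g j l * wedge x y k l := by
  simp only [wedge, Matrix.mulVec, dotProduct, Fin.sum_univ_four]
  ring

/-- The action on bivectors is linear, so proportionality of `plucker l` to any `x ∧ y` is preserved
with the same factor. -/
theorem plucker_act {κ : SignType} (g : isometryGroup κ) {l : OrientedGeodesic κ} {x y : R4} {r : ℝ}
    (h : ∀ i j, plucker l i j = r * wedge x y i j) (i j : Fin 4) :
    plucker (act g l) i j = r * wedge (g.1 *ᵥ x) (g.1 *ᵥ y) i j := by
  obtain ⟨σ, rfl⟩ := exists_mk l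
  rw [act_mk, plucker_mk]
  simp only [UnitGeodesic.map, deriv_mulVec]
  rw [plucker_mk] at h
  rw [wedge_mulVec, wedge_mulVec, Finset.mul_sum]
  refine Finset.sum_congr rfl fun k _ => ?_
  rw [Finset.mul_sum]
  refine Finset.sum_congr rfl fun l _ => ?_
  rw [h]
  ring

/-! ### The chart of the tangent bundle induced by a chart -/

section TangentChart

variable {V : Type*} [NormedAddCommGroup V] [NormedSpace ℝ V]
  {N : Type*} [TopologicalSpace N] [ChartedSpace V N] [IsManifold 𝓘(ℝ, V) ∞ N]

/-- This is the chain rule for germs: a chart and its inverse compose to the identity only near a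
point, so an equality of maps near the base point has to suffice. -/
theorem tangentMap_comp_local {N' N'' : Type*} [TopologicalSpace N'] [ChartedSpace V N']
    [TopologicalSpace N''] [ChartedSpace V N'']
    {f : N → N'} {g : N' → N''} {h : N → N''} {X : TangentBundle 𝓘(ℝ, V) N}
    (hf : MDifferentiableAt 𝓘(ℝ, V) 𝓘(ℝ, V) f X.proj)
    (hg : MDifferentiableAt 𝓘(ℝ, V) 𝓘(ℝ, V) g (f X.proj))
    (hfg : h =ᶠ[𝓝 X.proj] g ∘ f) :
    tangentMap 𝓘(ℝ, V) 𝓘(ℝ, V) h X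
      = tangentMap 𝓘(ℝ, V) 𝓘(ℝ, V) g (tangentMap 𝓘(ℝ, V) 𝓘(ℝ, V) f X) := by
  rw [← tangentMap_comp_at X hg hf]
  obtain ⟨x, v⟩ := X
  have h0 : h x = (g ∘ f) x := hfg.eq_of_nhds
  have h1 := hfg.mfderiv_eq (I := 𝓘(ℝ, V)) (I' := 𝓘(ℝ, V))
  unfold tangentMap
  simp only at h1 ⊢
  -- The tangent spaces at all points are by definition the same `V`, so the equality of fiber
  -- components needs no transport.
  refine Bundle.TotalSpace.ext h0 ?_
  rw [h1]
  exact HEq.rfl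

theorem tangentMap_id_local {h : N → N} {X : TangentBundle 𝓘(ℝ, V) N}
    (hh : h =ᶠ[𝓝 X.proj] id) : tangentMap 𝓘(ℝ, V) 𝓘(ℝ, V) h X = X := by
  have := tangentMap_comp_local (g := id) (f := id) (h := h) (X := X) mdifferentiableAt_id
    mdifferentiableAt_id hh
  rw [this]
  simp

theorem IsSmoothPartial.mdifferentiableAt {φ : OpenPartialHomeomorph N V}
    (h : IsSmoothPartial 𝓘(ℝ, V) 𝓘(ℝ, V) φ) {x : N} (hx : x ∈ φ.source) :
    MDifferentiableAt 𝓘(ℝ, V) 𝓘(ℝ, V) φ x :=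
  (h.1.contMDiffAt (φ.open_source.mem_nhds hx)).mdifferentiableAt (by simp)

theorem IsSmoothPartial.mdifferentiableAt_symm {φ : OpenPartialHomeomorph N V}
    (h : IsSmoothPartial 𝓘(ℝ, V) 𝓘(ℝ, V) φ) {z : V} (hz : z ∈ φ.target) :
    MDifferentiableAt 𝓘(ℝ, V) 𝓘(ℝ, V) φ.symm z :=
  (h.2.contMDiffAt (φ.open_target.mem_nhds hz)).mdifferentiableAt (by simp)

theorem contMDiffOn_tangentMap {N' : Type*} [TopologicalSpace N'] [ChartedSpace V N']
    [IsManifold 𝓘(ℝ, V) ∞ N'] {f : N → N'} {s : Set N} (hs : IsOpen s)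
    (hf : ContMDiffOn 𝓘(ℝ, V) 𝓘(ℝ, V) ∞ f s) :
    ContMDiffOn 𝓘(ℝ, V).tangent 𝓘(ℝ, V).tangent ∞ (tangentMap 𝓘(ℝ, V) 𝓘(ℝ, V) f)
      (Bundle.TotalSpace.proj ⁻¹' s) := by
  have : IsManifold 𝓘(ℝ, V) 1 N := IsManifold.of_le (n := ∞) (by simp)
  have : IsManifold 𝓘(ℝ, V) 1 N' := IsManifold.of_le (n := ∞) (by simp)
  refine (hf.contMDiffOn_tangentMapWithin (m := ∞) (by simp) hs.uniqueMDiffOn).congr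
    fun X hX => ?_
  exact (tangentMapWithin_eq_tangentMap (hs.uniqueMDiffWithinAt hX)
    ((hf.contMDiffAt (hs.mem_nhds hX)).mdifferentiableAt (by simp))).symm

theorem contMDiff_mk_tangentBundle :
    ContMDiff 𝓘(ℝ, V × V) 𝓘(ℝ, V).tangent ∞
      (fun q : V × V => (⟨q.1, q.2⟩ : TangentBundle 𝓘(ℝ, V) V)) := by
  intro q
  rw [Bundle.contMDiffAt_totalSpace]
  refine ⟨contDiff_fst.contMDiff.contMDiffAt, ?_⟩
  simp only [trivializationAt_model_space_apply]
  exact contDiff_snd.contMDiff.contMDiffAt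

/-- The chart of `TN` induced by a chart of `N`. -/
noncomputable def tangentChart (φ : OpenPartialHomeomorph N V)
    (h : IsSmoothPartial 𝓘(ℝ, V) 𝓘(ℝ, V) φ) :
    OpenPartialHomeomorph (TangentBundle 𝓘(ℝ, V) N) (V × V) where
  toFun X := (φ X.proj, (tangentMap 𝓘(ℝ, V) 𝓘(ℝ, V) φ X).2)
  invFun q := tangentMap 𝓘(ℝ, V) 𝓘(ℝ, V) φ.symm ⟨q.1, q.2⟩
  source := Bundle.TotalSpace.proj ⁻¹' φ.source
  target := φ.target ×ˢ univ
  map_source' X hX := ⟨φ.map_source hX, mem_univ _⟩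
  map_target' q hq := φ.map_target hq.1
  left_inv' X hX := by
    change tangentMap 𝓘(ℝ, V) 𝓘(ℝ, V) φ.symm (tangentMap 𝓘(ℝ, V) 𝓘(ℝ, V) φ X) = X
    rw [← tangentMap_comp_local (h := φ.symm ∘ φ) (h.mdifferentiableAt hX)
      (h.mdifferentiableAt_symm (φ.map_source hX)) Filter.EventuallyEq.rfl]
    exact tangentMap_id_local (φ.eventually_left_inverse hX)
  right_inv' q hq := by
    have h1 : tangentMap 𝓘(ℝ, V) 𝓘(ℝ, V) φ (tangentMap 𝓘(ℝ, V) 𝓘(ℝ, V) φ.symm ⟨q.1, q.2⟩)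
        = (⟨q.1, q.2⟩ : TangentBundle 𝓘(ℝ, V) V) := by
      rw [← tangentMap_comp_local (h := φ ∘ φ.symm)
        (X := (⟨q.1, q.2⟩ : TangentBundle 𝓘(ℝ, V) V)) (h.mdifferentiableAt_symm hq.1)
        (h.mdifferentiableAt (φ.map_target hq.1)) Filter.EventuallyEq.rfl]
      exact tangentMap_id_local (φ.eventually_right_inverse hq.1)
    exact congrArg (fun X : TangentBundle 𝓘(ℝ, V) V => ((X.1, X.2) : V × V)) h1
  open_source := φ.open_source.preimage (FiberBundle.continuous_proj V (TangentSpace 𝓘(ℝ, V)))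
  open_target := φ.open_target.prod isOpen_univ
  continuousOn_toFun := by
    have h1 := (contMDiffOn_tangentMap φ.open_source h.1)
    refine ContinuousOn.prodMk (φ.continuousOn.comp
      (FiberBundle.continuous_proj V (TangentSpace 𝓘(ℝ, V))).continuousOn fun X hX => hX) ?_
    exact ((contMDiff_snd_tangentBundle_modelSpace V 𝓘(ℝ, V) (n := ∞)).comp_contMDiffOn
      h1).continuousOn
  continuousOn_invFun :=
    ((contMDiffOn_tangentMap φ.open_target h.2).comp contMDiff_mk_tangentBundle.contMDiffOn
      fun q hq => hq.1).continuousOn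

theorem isSmoothPartial_tangentChart (φ : OpenPartialHomeomorph N V)
    (h : IsSmoothPartial 𝓘(ℝ, V) 𝓘(ℝ, V) φ) :
    IsSmoothPartial 𝓘(ℝ, V).tangent 𝓘(ℝ, V × V) (tangentChart φ h) := by
  constructor
  · refine ContMDiffOn.prodMk_space (h.1.comp
      (Bundle.contMDiff_proj (TangentSpace 𝓘(ℝ, V))).contMDiffOn fun X hX => hX) ?_
    exact (contMDiff_snd_tangentBundle_modelSpace V 𝓘(ℝ, V) (n := ∞)).comp_contMDiffOn
      (contMDiffOn_tangentMap φ.open_source h.1)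
  · exact (contMDiffOn_tangentMap φ.open_target h.2).comp contMDiff_mk_tangentBundle.contMDiffOn
      fun q hq => hq.1

end TangentChart

/-! ### The action is smooth -/

/-- The chart `geodesicChart κ τ` as a partial homeomorphism. -/
noncomputable def grassmannChart (κ : SignType) (τ : Equiv.Perm (Fin 4)) :
    OpenPartialHomeomorph (OrientedGeodesic κ) (Fin 4 → ℝ) :=
  (geodesicCore κ).openPartialHomeomorph (geodesicChart κ τ) (mem_range_self τ)

theorem isSmoothPartial_grassmannChart (κ : SignType) (τ : Equiv.Perm (Fin 4)) :
    IsSmoothPartial 𝓘(ℝ, Fin 4 → ℝ) 𝓘(ℝ, Fin 4 → ℝ) (grassmannChart κ τ) := by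
  refine isSmoothPartial_of_mem_maximalAtlas (IsManifold.subset_maximalAtlas ?_)
  exact mem_iUnion₂.2 ⟨geodesicChart κ τ, mem_range_self τ, rfl⟩

theorem grassmannChart_apply (κ : SignType) (τ : Equiv.Perm (Fin 4)) (l : OrientedGeodesic κ) :
    grassmannChart κ τ l = graphCoord τ (plucker l) := rfl

theorem mem_grassmannChart_source {κ : SignType} {τ : Equiv.Perm (Fin 4)} {l : OrientedGeodesic κ} :
    l ∈ (grassmannChart κ τ).source ↔ 0 < plucker l (τ 0) (τ 1) := Iff.rfl

theorem plucker_grassmannChart_symm {κ : SignType} {τ : Equiv.Perm (Fin 4)} {z : Fin 4 → ℝ}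
    (hz : z ∈ (grassmannChart κ τ).target) : ∃ r : ℝ, 0 < r ∧ ∀ i j,
      plucker ((grassmannChart κ τ).symm z) i j = r * wedge (graphU τ z) (graphW τ z) i j :=
  plucker_geodesicChart_symm hz

/-- The expression of the action of `g` in the charts `τ` and `τ'`. -/
noncomputable def actCoord (τ τ' : Equiv.Perm (Fin 4)) (g : Matrix (Fin 4) (Fin 4) ℝ)
    (z : Fin 4 → ℝ) : Fin 4 → ℝ :=
  graphCoord τ' (wedge (g *ᵥ graphU τ z) (g *ᵥ graphW τ z))

/-- The bivector of the chart inverse is known up to a positive factor, which drops out because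
`graphCoord` is a quotient of bivector coordinates. -/
theorem grassmannChart_act_symm {κ : SignType} {τ τ' : Equiv.Perm (Fin 4)} (g : isometryGroup κ)
    {z : Fin 4 → ℝ} (hz : z ∈ (grassmannChart κ τ).target) :
    grassmannChart κ τ' (act g ((grassmannChart κ τ).symm z)) = actCoord τ τ' g z := by
  obtain ⟨r, hr, h⟩ := plucker_grassmannChart_symm hz
  exact graphCoord_smul τ' hr.ne' (plucker_act g h)

theorem act_symm_mem_source_iff {κ : SignType} {τ τ' : Equiv.Perm (Fin 4)} (g : isometryGroup κ)
    {z : Fin 4 → ℝ} (hz : z ∈ (grassmannChart κ τ).target) :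
    act g ((grassmannChart κ τ).symm z) ∈ (grassmannChart κ τ').source ↔
      0 < wedge (g.1 *ᵥ graphU τ z) (g.1 *ᵥ graphW τ z) (τ' 0) (τ' 1) := by
  obtain ⟨r, hr, h⟩ := plucker_grassmannChart_symm hz
  rw [mem_grassmannChart_source, plucker_act g h]
  exact mul_pos_iff_of_pos_left hr

theorem contDiffAt_graphCoord {E : Type*} [NormedAddCommGroup E] [NormedSpace ℝ E] {x y : E → R4}
    {e : E} (τ : Equiv.Perm (Fin 4)) (hx : ContDiffAt ℝ ∞ x e) (hy : ContDiffAt ℝ ∞ y e)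
    (h : wedge (x e) (y e) (τ 0) (τ 1) ≠ 0) :
    ContDiffAt ℝ ∞ (fun e => graphCoord τ (wedge (x e) (y e))) e := by
  have hw : ∀ i j, ContDiffAt ℝ ∞ (fun e => wedge (x e) (y e) i j) e := fun i j =>
    ((contDiffAt_pi.1 hx i).mul (contDiffAt_pi.1 hy j)).sub
      ((contDiffAt_pi.1 hx j).mul (contDiffAt_pi.1 hy i))
  rw [contDiffAt_pi]
  intro k
  fin_cases k <;> exact (hw _ _).div (hw _ _) h

theorem contDiff_mulVec (g : Matrix (Fin 4) (Fin 4) ℝ) : ContDiff ℝ ∞ (fun x : R4 => g *ᵥ x) :=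
  (LinearMap.toContinuousLinearMap g.mulVecLin).contDiff

theorem contDiffAt_actCoord {τ τ' : Equiv.Perm (Fin 4)} {g : Matrix (Fin 4) (Fin 4) ℝ}
    {z : Fin 4 → ℝ} (h : wedge (g *ᵥ graphU τ z) (g *ᵥ graphW τ z) (τ' 0) (τ' 1) ≠ 0) :
    ContDiffAt ℝ ∞ (actCoord τ τ' g) z :=
  contDiffAt_graphCoord τ' ((contDiff_mulVec g).comp (contDiff_graph τ).1).contDiffAt
    ((contDiff_mulVec g).comp (contDiff_graph τ).2).contDiffAt h

/-- In the charts the action is a quotient of polynomials in `z`, with denominator positive at the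
point considered. -/
theorem contMDiff_act {κ : SignType} (g : isometryGroup κ) :
    ContMDiff 𝓘(ℝ, Fin 4 → ℝ) 𝓘(ℝ, Fin 4 → ℝ) ∞ (act g) := by
  intro l
  obtain ⟨τ, hτ⟩ := exists_mem_geodesicChart_source l
  obtain ⟨τ', hτ'⟩ := exists_mem_geodesicChart_source (act g l)
  change l ∈ (grassmannChart κ τ).source at hτ
  change act g l ∈ (grassmannChart κ τ').source at hτ'
  set c := grassmannChart κ τ with hc
  have hz : c l ∈ c.target := c.map_source hτ
  have hw : 0 < wedge (g.1 *ᵥ graphU τ (c l)) (g.1 *ᵥ graphW τ (c l)) (τ' 0) (τ' 1) := by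
    rw [← act_symm_mem_source_iff g hz, ← hc, c.left_inv hτ]
    exact hτ'
  have h1 : ContMDiffAt 𝓘(ℝ, Fin 4 → ℝ) 𝓘(ℝ, Fin 4 → ℝ) ∞ (fun m => actCoord τ τ' g (c m)) l :=
    (contDiffAt_actCoord hw.ne').contMDiffAt.comp l
      ((isSmoothPartial_grassmannChart κ τ).1.contMDiffAt (c.open_source.mem_nhds hτ))
  have e0 : ∀ m ∈ c.source, actCoord τ τ' g (c m) = grassmannChart κ τ' (act g m) := by
    intro m hm
    rw [← grassmannChart_act_symm g (c.map_source hm), ← hc, c.left_inv hm]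
  have h2 : ContMDiffAt 𝓘(ℝ, Fin 4 → ℝ) 𝓘(ℝ, Fin 4 → ℝ) ∞
      (fun m => (grassmannChart κ τ').symm (actCoord τ τ' g (c m))) l := by
    refine ContMDiffAt.comp l ((isSmoothPartial_grassmannChart κ τ').2.contMDiffAt
      ((grassmannChart κ τ').open_target.mem_nhds ?_)) h1
    rw [e0 l hτ]
    exact (grassmannChart κ τ').map_source hτ'
  refine h2.congr_of_eventuallyEq ?_
  -- Continuity keeps this coordinate positive near `l`, so that `act g m` stays in the domain of
  -- the second chart.
  have hcw : ContinuousAt (fun m => wedge (g.1 *ᵥ graphU τ (c m)) (g.1 *ᵥ graphW τ (c m))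
      (τ' 0) (τ' 1)) l := by
    have : Continuous (fun z => wedge (g.1 *ᵥ graphU τ z) (g.1 *ᵥ graphW τ z) (τ' 0) (τ' 1)) := by
      have hu := continuous_pi_iff.1 ((contDiff_mulVec g.1).comp (contDiff_graph τ).1).continuous
      have hw := continuous_pi_iff.1 ((contDiff_mulVec g.1).comp (contDiff_graph τ).2).continuous
      exact ((hu _).mul (hw _)).sub ((hu _).mul (hw _))
    exact this.continuousAt.comp (c.continuousAt hτ)
  filter_upwards [c.open_source.mem_nhds hτ, hcw.eventually (lt_mem_nhds hw)] with m hm hm'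
  rw [e0 m hm, (grassmannChart κ τ').left_inv]
  rw [← act_symm_mem_source_iff g (c.map_source hm), ← hc, c.left_inv hm] at hm'
  exact hm'

/-! ### Composition, inverses and the induced action on the tangent bundle -/

/-- The product of two elements of `G_κ`. -/
def isometryMul {κ : SignType} (g h : isometryGroup κ) : isometryGroup κ :=
  ⟨g.1 * h.1, mul_mem_isometryGroup g.2 h.2⟩

/-- The inverse of an element of `G_κ`. -/
noncomputable def isometryInv {κ : SignType} (g : isometryGroup κ) : isometryGroup κ :=
  ⟨g.1⁻¹, inv_mem_isometryGroup g.2⟩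

theorem act_isometryMul {κ : SignType} (g h : isometryGroup κ) :
    act (isometryMul g h) = act g ∘ act h := by
  funext l
  obtain ⟨σ, rfl⟩ := exists_mk l
  simp only [Function.comp_apply, act_mk]
  congr 1
  simp only [UnitGeodesic.map, isometryMul, Matrix.mulVec_mulVec]

theorem isUnit_isometry_det {κ : SignType} (g : isometryGroup κ) : IsUnit g.1.det := by
  rw [isometryGroup_det g.2]
  exact isUnit_one

theorem act_isometryInv_act {κ : SignType} (g : isometryGroup κ) (l : OrientedGeodesic κ) :
    act (isometryInv g) (act g l) = l := by
  obtain ⟨σ, rfl⟩ := exists_mk l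
  simp only [act_mk]
  congr 1
  simp only [UnitGeodesic.map, isometryInv, Matrix.mulVec_mulVec,
    Matrix.nonsing_inv_mul _ (isUnit_isometry_det g), Matrix.one_mulVec]

theorem act_act_isometryInv {κ : SignType} (g : isometryGroup κ) (l : OrientedGeodesic κ) :
    act g (act (isometryInv g) l) = l := by
  obtain ⟨σ, rfl⟩ := exists_mk l
  simp only [act_mk]
  congr 1
  simp only [UnitGeodesic.map, isometryInv, Matrix.mulVec_mulVec,
    Matrix.mul_nonsing_inv _ (isUnit_isometry_det g), Matrix.one_mulVec]

theorem mdifferentiable_act {κ : SignType} (g : isometryGroup κ) :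
    MDifferentiable 𝓘(ℝ, Fin 4 → ℝ) 𝓘(ℝ, Fin 4 → ℝ) (act g) :=
  (contMDiff_act g).mdifferentiable (by simp)

/-- The action of `G_κ` on `T𝒢_κ`. -/
noncomputable def tangentAct {κ : SignType} (g : isometryGroup κ) :
    TangentGeodesic κ → TangentGeodesic κ :=
  tangentMap 𝓘(ℝ, Fin 4 → ℝ) 𝓘(ℝ, Fin 4 → ℝ) (act g)

theorem tangentAct_isometryMul {κ : SignType} (g h : isometryGroup κ) (X : TangentGeodesic κ) :
    tangentAct (isometryMul g h) X = tangentAct g (tangentAct h X) := by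
  unfold tangentAct
  rw [act_isometryMul]
  exact tangentMap_comp_at X (mdifferentiable_act g _) (mdifferentiable_act h _)

theorem tangentAct_isometryInv_tangentAct {κ : SignType} (g : isometryGroup κ)
    (X : TangentGeodesic κ) : tangentAct (isometryInv g) (tangentAct g X) = X := by
  unfold tangentAct
  rw [← tangentMap_comp_at X (mdifferentiable_act _ _) (mdifferentiable_act g _)]
  exact tangentMap_id_local (Filter.Eventually.of_forall fun l => act_isometryInv_act g l)

theorem tangentAct_tangentAct_isometryInv {κ : SignType} (g : isometryGroup κ)
    (X : TangentGeodesic κ) : tangentAct g (tangentAct (isometryInv g) X) = X := by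
  unfold tangentAct
  rw [← tangentMap_comp_at X (mdifferentiable_act _ _) (mdifferentiable_act _ _)]
  exact tangentMap_id_local (Filter.Eventually.of_forall fun l => act_act_isometryInv g l)

theorem contMDiff_tangentAct {κ : SignType} (g : isometryGroup κ) :
    ContMDiff 𝓘(ℝ, Fin 4 → ℝ).tangent 𝓘(ℝ, Fin 4 → ℝ).tangent ∞ (tangentAct g) := by
  have := contMDiffOn_tangentMap isOpen_univ (contMDiff_act g).contMDiffOn
  rwa [preimage_univ, contMDiffOn_univ] at this

/-- The homeomorphism of `𝒢_κ` given by an element of `G_κ`. -/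
noncomputable def actHomeomorph {κ : SignType} (g : isometryGroup κ) :
    OrientedGeodesic κ ≃ₜ OrientedGeodesic κ where
  toFun := act g
  invFun := act (isometryInv g)
  left_inv := act_isometryInv_act g
  right_inv := act_act_isometryInv g
  continuous_toFun := (contMDiff_act g).continuous
  continuous_invFun := (contMDiff_act _).continuous

/-- The homeomorphism of `T𝒢_κ` given by an element of `G_κ`. -/
noncomputable def tangentActHomeomorph {κ : SignType} (g : isometryGroup κ) :
    TangentGeodesic κ ≃ₜ TangentGeodesic κ where
  toFun := tangentAct g
  invFun := tangentAct (isometryInv g)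
  left_inv := tangentAct_isometryInv_tangentAct g
  right_inv := tangentAct_tangentAct_isometryInv g
  continuous_toFun := (contMDiff_tangentAct g).continuous
  continuous_invFun := (contMDiff_tangentAct _).continuous

/-! ### Helicoidal curves -/

/-- The two sides differ by `(1 - κ²) a₀ v₀`, where `κ² = 1` if `κ = ±1` and `a₀ = 0` if `κ = 0`. -/
theorem dualForm_of_mem_tangentAt {κ : SignType} {p a : R4} (ha : a ∈ tangentAt κ p) (v : R4) :
    dualForm κ a v = κ * form κ a v := by
  rcases κ with _ | _ | _
  · have : a 0 = 0 := ha
    simp [dualForm, this]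
  · simp only [dualForm, form, SignType.neg_eq_neg_one, SignType.coe_neg, SignType.coe_one]
    ring
  · simp only [dualForm, form, SignType.pos_eq_one, SignType.coe_one]
    ring

theorem cast_mul_form_of_mem_tangentAt {κ : SignType} {p v : R4} (hv : v ∈ tangentAt κ p) :
    (κ : ℝ) * form κ v p = 0 := by
  rw [form_comm]
  rcases κ with _ | _ | _
  · simp
  · have : form SignType.neg p v = 0 := hv
    rw [this, mul_zero]
  · have : form SignType.pos p v = 0 := hv
    rw [this, mul_zero]

/-- A vector orthogonal to both `p` and `a` is orthogonal to all points of the axis `cos_κ t p +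
sin_κ t a`, so as a constant vector it stays tangent along it. Frames are listed here as `(p; v, b,
a)`: the fields `ta`, `aa`, `va` concern `b`, and `tb`, `bb`, `vb` concern the axis direction `a`.
-/
theorem IsFrame.tangent_cos_add_sin {κ : SignType} {p v b a w : R4} (h : IsFrame κ p v b a)
    (hw : w ∈ tangentAt κ p) (haw : form κ a w = 0) (t : ℝ) :
    w ∈ tangentAt κ (cosK κ t • p + sinK κ t • a) := by
  rw [mem_tangentAt_iff ((isUnitGeodesic_cos_add_sin h.mem h.tb h.bb).1.2.1 t), dualForm_comm,
    dualForm_add_right, dualForm_smul_right, dualForm_smul_right, dualForm_comm κ w p,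
    (mem_tangentAt_iff h.mem w).1 hw, dualForm_of_mem_tangentAt hw, form_comm κ w a, haw]
  simp

theorem IsFrame.helicoid_tangent {κ : SignType} {p v b a : R4} (h : IsFrame κ p v b a) (x t : ℝ) :
    Real.cos x • v + Real.sin x • b ∈ tangentAt κ (cosK κ t • p + sinK κ t • a) := by
  have hM := (isUnitGeodesic_cos_add_sin h.mem h.tb h.bb).1.2.1 t
  refine tangentAt_add hM (tangentAt_smul hM (h.tangent_cos_add_sin h.tv ?_ t) _)
    (tangentAt_smul hM (h.tangent_cos_add_sin h.ta ?_ t) _)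
  · rw [form_comm, h.vb]
  · rw [form_comm, h.ab]

theorem IsFrame.helicoid_unit {κ : SignType} {p v b a : R4} (h : IsFrame κ p v b a) (x : ℝ) :
    form κ (Real.cos x • v + Real.sin x • b) (Real.cos x • v + Real.sin x • b) = 1 := by
  rw [form_add_right, form_smul_right, form_smul_right, form_comm κ _ v, form_comm κ _ b,
    form_add_right, form_add_right]
  simp only [form_smul_right, h.vv, h.aa, h.va, form_comm κ b v]
  have := Real.cos_sq_add_sin_sq x
  linarith

/-- The rays of the helicoidal surface with orthonormal frame `(p; v, b, a)`. -/
noncomputable def helicoid {κ : SignType} {p v b a : R4} (h : IsFrame κ p v b a) (α t : ℝ) :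
    UnitGeodesic κ :=
  UnitGeodesic.ofInit ((isUnitGeodesic_cos_add_sin h.mem h.tb h.bb).1.2.1 t)
    (h.helicoid_tangent (α * t) t) (h.helicoid_unit (α * t))

theorem helicoid_zero {κ : SignType} {p v b a : R4} (h : IsFrame κ p v b a) (α t : ℝ) :
    (helicoid h α t).1 0 = cosK κ t • p + sinK κ t • a ∧
      deriv (helicoid h α t).1 0 = Real.cos (α * t) • v + Real.sin (α * t) • b :=
  UnitGeodesic.ofInit_zero _ _ _

/-- A cyclic permutation of three rows is even. This reconciles the order `(p; v, b, a)` of the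
frames with the order `(p, A, v, B)` in `IsCross`. -/
theorem det_rotate (p v b a : R4) :
    (Matrix.of ![p, v, b, a]).det = (Matrix.of ![p, a, v, b]).det := by
  simp [Matrix.det_succ_row_zero, Fin.sum_univ_succ, Fin.succAbove]
  ring

theorem IsFrame.isParallelAlong {κ : SignType} {p v b a w : R4} (h : IsFrame κ p v b a)
    (hw : w ∈ tangentAt κ p) (haw : form κ a w = 0) :
    IsParallelAlong κ (UnitGeodesic.ofInit h.mem h.tb h.bb).1 (fun _ => w) :=
  ⟨contDiff_const, h.tangent_cos_add_sin hw haw, fun t u _ => by simp [form]⟩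

theorem IsFrame.isHelicoidalSurface {κ : SignType} {p v b a : R4} (h : IsFrame κ p v b a) (α : ℝ)
    {σ : UnitGeodesic κ} (h0 : σ.1 0 = p) (h1 : deriv σ.1 0 = v) :
    IsHelicoidalSurface κ α σ a (helicoid h α) := by
  have e0 := UnitGeodesic.ofInit_zero h.mem h.tb h.bb
  rw [IsHelicoidalSurface, h0, h1]
  refine ⟨h.tb, h.bb, by rw [form_comm, h.vb], UnitGeodesic.ofInit h.mem h.tb h.bb, fun _ => v,
    fun _ => b, e0.1, e0.2, h.isParallelAlong h.tv (by rw [form_comm, h.vb]), rfl,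
    h.isParallelAlong h.ta (by rw [form_comm, h.ab]),
    ⟨h.ta, h.aa, by rw [form_comm, h.ab], h.va, by rw [← det_rotate]; exact h.pos⟩,
    fun t => helicoid_zero h α t⟩

/-- The product of `V` with `c'` is constant along the geodesic, hence zero. Differentiating the
tangency relation between `c` and `V` then shows that `V'` is tangent to `M_κ`. Its tangential part
vanishes as `V` is parallel, so `V' = 0` by positive definiteness. -/
theorem IsParallelAlong.eq_const {κ : SignType} {c : UnitGeodesic κ} {V : ℝ → R4}
    (hV : IsParallelAlong κ c.1 V) (h0 : form κ (V 0) (deriv c.1 0) = 0) (t : ℝ) : V t = V 0 := by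
  obtain ⟨hs, hT, hp⟩ := hV
  obtain ⟨hc, hM, hu, hd⟩ := (isUnitGeodesic_iff κ c.1).1 c.2
  have hcT := deriv_mem_tangentAt hc hM
  have dc := fun t => contDiff_hasDerivAt hc t
  have dV := fun t => (contDiff_hasDerivAt hs t).1
  have hf : ∀ t, HasDerivAt (fun s => form κ (V s) (deriv c.1 s)) 0 t := by
    intro t
    refine (hasDerivAt_form (dV t) (dc t).2).congr_deriv ?_
    rw [hp t _ (hcT t), hd t, form_smul_right, neg_mul, cast_mul_form_of_mem_tangentAt (hT t)]
    simp
  have hf0 : ∀ t, form κ (V t) (deriv c.1 t) = 0 := fun t => by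
    rw [← h0]
    exact is_const_of_deriv_eq_zero (fun s => (hf s).differentiableAt) (fun s => (hf s).deriv) t 0
  have hV' : ∀ t, deriv V t = 0 := by
    intro t
    have h1 := hasDerivAt_dualForm (κ := κ) (dc t).1 (dV t)
    have h2 : (fun s => dualForm κ (c.1 s) (V s)) = fun _ => 0 := by
      funext s
      exact (mem_tangentAt_iff (hM s) _).1 (hT s)
    rw [h2] at h1
    have h3 := h1.unique (hasDerivAt_const t (0 : ℝ))
    rw [dualForm_of_mem_tangentAt (hcT t), form_comm, hf0, mul_zero, zero_add] at h3
    have h4 : deriv V t ∈ tangentAt κ (c.1 t) := (mem_tangentAt_iff (hM t) _).2 h3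
    by_contra hne
    exact (form_pos (hM t) h4 hne).ne' (hp t _ h4)
  exact is_const_of_deriv_eq_zero (fun s => (dV s).differentiableAt) hV' t 0

/-- The fields `V` and `B` are both orthogonal to the axis, hence constant, so each ray has the
initial data of the explicit helicoid. Only the values of `φ t` and its derivative at `0` enter. -/
theorem IsHelicoidalSurface.exists_isFrame {κ : SignType} {α : ℝ} {σ : UnitGeodesic κ} {A : R4}
    {φ : ℝ → UnitGeodesic κ} (hφ : IsHelicoidalSurface κ α σ A φ) :
    ∃ b, ∃ h : IsFrame κ (σ.1 0) (deriv σ.1 0) b A,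
      ∀ t, mkGeodesic (φ t) = mkGeodesic (helicoid h α t) := by
  obtain ⟨hA, hA1, hAv, c, V, B, c0, c1, hV, hV0, hB, ⟨b1, b2, b3, b4, b5⟩, ht⟩ := hφ
  obtain ⟨hp, hv, hvv⟩ := σ.frame
  have h : IsFrame κ (σ.1 0) (deriv σ.1 0) (B 0) A :=
    ⟨hp, hv, b1, hA, hvv, b2, hA1, b4, by rw [form_comm, hAv], by rw [form_comm, b3],
      by rw [det_rotate]; exact b5⟩
  refine ⟨B 0, h, fun t => mkGeodesic_eq_of_init ?_ ?_⟩
  · rw [(ht t).1, (c.eq_cos_add_sin t).1, c0, c1, (helicoid_zero h α t).1]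
  · rw [(ht t).2, (helicoid_zero h α t).2, ← hV0, hV.eq_const (by rw [c1, hV0, form_comm, hAv]),
      hB.eq_const (by rw [c1, form_comm, b3])]

/-- The initial data of the rays are linear combinations of the frame vectors with coefficients
depending only on `t`, and `g` is linear. -/
theorem act_helicoid {κ : SignType} {p v b a p' v' b' a' : R4} (h : IsFrame κ p v b a)
    (h' : IsFrame κ p' v' b' a') (g : isometryGroup κ) (e0 : g.1 *ᵥ p = p') (e1 : g.1 *ᵥ v = v')
    (e2 : g.1 *ᵥ b = b') (e3 : g.1 *ᵥ a = a') (α t : ℝ) :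
    act g (mkGeodesic (helicoid h α t)) = mkGeodesic (helicoid h' α t) := by
  rw [act_mk]
  refine mkGeodesic_eq_of_init ?_ ?_
  · simp only [UnitGeodesic.map, (helicoid_zero _ α t).1, Matrix.mulVec_add, Matrix.mulVec_smul,
      e0, e3]
  · simp only [UnitGeodesic.map, deriv_mulVec, (helicoid_zero _ α t).2, Matrix.mulVec_add,
      Matrix.mulVec_smul, e1, e2]

/-! ### Initial velocities -/

theorem IsInitialVelocity.unique {κ : SignType} {Γ : ℝ → OrientedGeodesic κ}
    {X Y : TangentGeodesic κ} (hX : IsInitialVelocity Γ X) (hY : IsInitialVelocity Γ Y) : X = Y := by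
  obtain ⟨v, hv, rfl⟩ := hX
  obtain ⟨w, hw, rfl⟩ := hY
  have h := hasMFDerivAt_unique hv hw
  have h1 := congrArg (fun L : ℝ →L[ℝ] TangentSpace 𝓘(ℝ, Fin 4 → ℝ) (Γ 0) => L 1) h
  simp only [ContinuousLinearMap.toSpanSingleton_apply, one_smul] at h1
  rw [h1]

theorem IsInitialVelocity.act {κ : SignType} {Γ : ℝ → OrientedGeodesic κ} {X : TangentGeodesic κ}
    (hX : IsInitialVelocity Γ X) (g : isometryGroup κ) :
    IsInitialVelocity (fun t => act g (Γ t)) (tangentAct g X) := by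
  obtain ⟨v, hv, rfl⟩ := hX
  refine ⟨mfderiv 𝓘(ℝ, Fin 4 → ℝ) 𝓘(ℝ, Fin 4 → ℝ) (Helicoidal.act g) (Γ 0) v, ?_, rfl⟩
  refine (((mdifferentiable_act g (Γ 0)).hasMFDerivAt).comp 0 hv).congr_mfderiv ?_
  refine ContinuousLinearMap.ext fun r : ℝ => ?_
  exact map_smul (mfderiv 𝓘(ℝ, Fin 4 → ℝ) 𝓘(ℝ, Fin 4 → ℝ) (Helicoidal.act g) (Γ 0)) r v

theorem isInitialVelocity_of_eventuallyEq {κ : SignType}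
    {φ : OpenPartialHomeomorph (OrientedGeodesic κ) (Fin 4 → ℝ)}
    (hφ : IsSmoothPartial 𝓘(ℝ, Fin 4 → ℝ) 𝓘(ℝ, Fin 4 → ℝ) φ) {Γ : ℝ → OrientedGeodesic κ}
    {γ : ℝ → Fin 4 → ℝ} {w : Fin 4 → ℝ} (hΓ : Γ =ᶠ[𝓝 0] φ.symm ∘ γ) (hγ : HasDerivAt γ w 0)
    (h0 : γ 0 ∈ φ.target) :
    IsInitialVelocity Γ (tangentMap 𝓘(ℝ, Fin 4 → ℝ) 𝓘(ℝ, Fin 4 → ℝ) φ.symm ⟨γ 0, w⟩) := by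
  have e0 : Γ 0 = φ.symm (γ 0) := hΓ.eq_of_nhds
  have h1 := (((hφ.mdifferentiableAt_symm h0).hasMFDerivAt).comp (0 : ℝ)
    hγ.hasFDerivAt.hasMFDerivAt).congr_of_eventuallyEq hΓ
  refine ⟨mfderiv 𝓘(ℝ, Fin 4 → ℝ) 𝓘(ℝ, Fin 4 → ℝ) φ.symm (γ 0) w, ?_,
    Bundle.TotalSpace.ext e0.symm HEq.rfl⟩
  refine h1.congr_mfderiv ?_
  refine ContinuousLinearMap.ext fun r : ℝ => ?_
  exact map_smul (mfderiv 𝓘(ℝ, Fin 4 → ℝ) 𝓘(ℝ, Fin 4 → ℝ) φ.symm (γ 0)) r w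

/-- The velocity, in the chart of the graphs over the plane `(0, 1)`, of a helicoidal curve whose
initial ray is the standard geodesic. -/
def chartVelocity (α : ℝ) (p v b a : R4) : Fin 4 → ℝ :=
  ![a 2 * v 1 - α * p 1 * b 2, α * p 0 * b 2 - a 2 * v 0,
    a 3 * v 1 - α * p 1 * b 3, α * p 0 * b 3 - a 3 * v 0]

/-- `(p; v, b, a)` is a frame whose first two vectors span the oriented plane of the standard
geodesic. -/
structure IsStandardFrame (κ : SignType) (p v b a : R4) : Prop extends IsFrame κ p v b a where
  wedge_eq : ∀ i j, wedge p v i j = wedge ![1, 0, 0, 0] ![0, 1, 0, 0] i j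
  p2 : p 2 = 0
  p3 : p 3 = 0
  v2 : v 2 = 0
  v3 : v 3 = 0
  a0 : a 0 = 0
  a1 : a 1 = 0
  b0 : b 0 = 0
  b1 : b 1 = 0

theorem isStandardFrame_standard (κ : SignType) :
    IsStandardFrame κ ![1, 0, 0, 0] ![0, 1, 0, 0] ![0, 0, 1, 0] ![0, 0, 0, 1] where
  toIsFrame := isFrame_standard κ
  wedge_eq _ _ := rfl
  p2 := rfl
  p3 := rfl
  v2 := rfl
  v3 := rfl
  a0 := rfl
  a1 := rfl
  b0 := rfl
  b1 := rfl

/-- The chart coordinates are quotients of bivector coordinates by the `(0, 1)` one, which is `cos_κ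
t cos (α t)`. This denominator has value `1` and derivative `0` at `t = 0`, so only the derivatives
of the numerators remain. -/
theorem IsStandardFrame.isInitialVelocity {κ : SignType} {p v b a : R4}
    (h : IsStandardFrame κ p v b a) (α : ℝ) :
    IsInitialVelocity (fun t => mkGeodesic (helicoid h.toIsFrame α t))
      (tangentMap 𝓘(ℝ, Fin 4 → ℝ) 𝓘(ℝ, Fin 4 → ℝ) (grassmannChart κ 1).symm
        ⟨0, chartVelocity α p v b a⟩) := by
  have hd : p 0 * v 1 - p 1 * v 0 = 1 := by
    have := h.wedge_eq 0 1
    simpa [wedge] using this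
  have hw : ∀ t, wedge ((helicoid h.toIsFrame α t).1 0) (deriv (helicoid h.toIsFrame α t).1 0) 0 1
      = cosK κ t * Real.cos (α * t) := by
    intro t
    rw [(helicoid_zero _ α t).1, (helicoid_zero _ α t).2]
    simp only [wedge, Pi.add_apply, Pi.smul_apply, smul_eq_mul, h.a0, h.a1, h.b0, h.b1]
    linear_combination cosK κ t * Real.cos (α * t) * hd
  set γ : ℝ → Fin 4 → ℝ := fun t => grassmannChart κ 1 (mkGeodesic (helicoid h.toIsFrame α t))
    with hγ
  have hc1 := hasDerivAt_cosK κ 0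
  have hs1 := hasDerivAt_sinK κ 0
  have hm : HasDerivAt (fun t : ℝ => α * t) α 0 := by
    simpa using (hasDerivAt_id (0 : ℝ)).const_mul α
  have hc2 := hm.cos
  have hs2 := hm.sin
  have hev : ∀ᶠ t in 𝓝 (0 : ℝ), 0 < cosK κ t * Real.cos (α * t) := by
    refine (hc1.continuousAt.mul hc2.continuousAt).eventually (lt_mem_nhds ?_)
    simp
  have hsrc : ∀ t, 0 < cosK κ t * Real.cos (α * t) →
      mkGeodesic (helicoid h.toIsFrame α t) ∈ (grassmannChart κ 1).source := by
    intro t ht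
    rw [mem_grassmannChart_source, plucker_mk]
    exact (hw t).symm ▸ ht
  have hγ0 : γ 0 = 0 := by
    simp only [hγ, grassmannChart_apply, plucker_mk, (helicoid_zero _ α 0).1,
      (helicoid_zero _ α 0).2]
    funext k
    fin_cases k <;> simp [graphCoord, wedge, h.p2, h.p3, h.v2, h.v3]
  have hder : HasDerivAt γ (chartVelocity α p v b a) 0 := by
    have hden := hc1.mul hc2
    -- Here `x` and `y` are the coefficients of the two first-order terms, with derivatives `1` and
    -- `α` at `0`; the product of the two sines is of second order. The numerator vanishes at `0`.
    have key : ∀ i j x y, (∀ t, wedge ((helicoid h.toIsFrame α t).1 0)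
        (deriv (helicoid h.toIsFrame α t).1 0) i j
          = x * (sinK κ t * Real.cos (α * t)) + y * (cosK κ t * Real.sin (α * t))
            + (a i * b j - a j * b i) * (sinK κ t * Real.sin (α * t))) →
        HasDerivAt (fun t => wedge ((helicoid h.toIsFrame α t).1 0)
          (deriv (helicoid h.toIsFrame α t).1 0) i j
          / wedge ((helicoid h.toIsFrame α t).1 0) (deriv (helicoid h.toIsFrame α t).1 0) 0 1)
          (x + y * α) 0 := by
      intro i j x y e
      have h1 := (((hs1.mul hc2).const_mul x).add ((hc1.mul hs2).const_mul y)).add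
        ((hs1.mul hs2).const_mul (a i * b j - a j * b i))
      have h2 := h1.div hden (by simp)
      simp only [e, hw]
      refine h2.congr_deriv ?_
      simp
    rw [hasDerivAt_pi]
    intro k
    fin_cases k
    · refine (key 2 1 (a 2 * v 1) (- p 1 * b 2) fun t => ?_).congr_deriv ?_
      · rw [(helicoid_zero _ α t).1, (helicoid_zero _ α t).2]
        simp only [wedge, Pi.add_apply, Pi.smul_apply, smul_eq_mul, h.p2, h.v2, h.a1, h.b1]
        ring
      · simp [chartVelocity]; ring
    · refine (key 0 2 (- a 2 * v 0) (p 0 * b 2) fun t => ?_).congr_deriv ?_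
      · rw [(helicoid_zero _ α t).1, (helicoid_zero _ α t).2]
        simp only [wedge, Pi.add_apply, Pi.smul_apply, smul_eq_mul, h.p2, h.v2, h.a0, h.b0]
        ring
      · simp [chartVelocity]; ring
    · refine (key 3 1 (a 3 * v 1) (- p 1 * b 3) fun t => ?_).congr_deriv ?_
      · rw [(helicoid_zero _ α t).1, (helicoid_zero _ α t).2]
        simp only [wedge, Pi.add_apply, Pi.smul_apply, smul_eq_mul, h.p3, h.v3, h.a1, h.b1]
        ring
      · simp [chartVelocity]; ring
    · refine (key 0 3 (- a 3 * v 0) (p 0 * b 3) fun t => ?_).congr_deriv ?_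
      · rw [(helicoid_zero _ α t).1, (helicoid_zero _ α t).2]
        simp only [wedge, Pi.add_apply, Pi.smul_apply, smul_eq_mul, h.p3, h.v3, h.a0, h.b0]
        ring
      · simp [chartVelocity]; ring
  rw [← hγ0]
  refine isInitialVelocity_of_eventuallyEq (isSmoothPartial_grassmannChart κ 1) ?_ hder
    ((grassmannChart κ 1).map_source (hsrc 0 hev.self_of_nhds))
  filter_upwards [hev] with t ht
  exact ((grassmannChart κ 1).left_inv (hsrc t ht)).symm

/-! ### The admissible set is an orbit -/

/-- The initial velocity of the standard helicoidal curve. -/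
noncomputable def standardVelocity (κ : SignType) (α : ℝ) : TangentGeodesic κ :=
  tangentMap 𝓘(ℝ, Fin 4 → ℝ) 𝓘(ℝ, Fin 4 → ℝ) (grassmannChart κ 1).symm
    ⟨0, chartVelocity α ![1, 0, 0, 0] ![0, 1, 0, 0] ![0, 0, 1, 0] ![0, 0, 0, 1]⟩

theorem isHelicoidalCurve_standard (κ : SignType) (α : ℝ) :
    IsHelicoidalCurve κ α (standardGeodesic κ) ![0, 0, 0, 1]
      (fun t => mkGeodesic (helicoid (isFrame_standard κ) α t)) :=
  ⟨_, (isFrame_standard κ).isHelicoidalSurface α (standardGeodesic_zero κ).1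
    (standardGeodesic_zero κ).2, fun _ => rfl⟩

theorem isInitialVelocity_standard (κ : SignType) (α : ℝ) :
    IsInitialVelocity (fun t => mkGeodesic (helicoid (isFrame_standard κ) α t))
      (standardVelocity κ α) :=
  (isStandardFrame_standard κ).isInitialVelocity α

theorem mulVec_e2 (p v a b : R4) : frameMatrix p v a b *ᵥ ![0, 0, 1, 0] = a := by
  rw [frameMatrix_mulVec]; simp

theorem mulVec_e3 (p v a b : R4) : frameMatrix p v a b *ᵥ ![0, 0, 0, 1] = b := by
  rw [frameMatrix_mulVec]; simp

/-- The frame of a helicoidal surface is the image of the standard frame under its own frame matrix,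
so equivariance makes the curve a translate of the standard one, and initial velocities are unique.
Conversely any `g` carries the standard frame to a frame. -/
theorem admissible_eq_range (κ : SignType) (α : ℝ) :
    admissible κ α = range (fun g : isometryGroup κ => tangentAct g (standardVelocity κ α)) := by
  ext X
  constructor
  · rintro ⟨σ, A, Γ, ⟨φ, hφ, hΓ⟩, hX⟩
    obtain ⟨b, h, hh⟩ := hφ.exists_isFrame
    refine ⟨⟨_, h.frameMatrix_mem⟩, ?_⟩
    refine ((isInitialVelocity_standard κ α).act ⟨_, h.frameMatrix_mem⟩).unique ?_
    have e : Γ = fun t => act ⟨_, h.frameMatrix_mem⟩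
        (mkGeodesic (helicoid (isFrame_standard κ) α t)) := by
      funext t
      rw [hΓ, hh, act_helicoid _ h _ (mulVec_e0 _ _ _ _) (mulVec_e1 _ _ _ _) (mulVec_e2 _ _ _ _)
        (mulVec_e3 _ _ _ _)]
    rwa [e] at hX
  · rintro ⟨g, rfl⟩
    have h := (isFrame_standard κ).mulVec g.2
    refine ⟨(standardGeodesic κ).map g, _, _, ⟨_, h.isHelicoidalSurface α ?_ ?_, ?_⟩,
      (isInitialVelocity_standard κ α).act g⟩
    · simp only [UnitGeodesic.map, (standardGeodesic_zero κ).1]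
    · simp only [UnitGeodesic.map, deriv_mulVec, (standardGeodesic_zero κ).2]
    · intro t
      exact act_helicoid _ h g rfl rfl rfl rfl α t

theorem tangentAct_mem_admissible_iff {κ : SignType} {α : ℝ} (g : isometryGroup κ)
    {X : TangentGeodesic κ} : tangentAct g X ∈ admissible κ α ↔ X ∈ admissible κ α := by
  have key : ∀ (g : isometryGroup κ) (X : TangentGeodesic κ), X ∈ admissible κ α →
      tangentAct g X ∈ admissible κ α := by
    intro g X hX
    rw [admissible_eq_range] at hX ⊢
    obtain ⟨h, rfl⟩ := hX
    exact ⟨isometryMul g h, tangentAct_isometryMul g h _⟩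
  refine ⟨fun h => ?_, key g X⟩
  have := key (isometryInv g) _ h
  rwa [tangentAct_isometryInv_tangentAct] at this

/-! ### A local section of `G_κ → 𝒢_κ` -/

/-- The graphs near the plane of the standard geodesic over which the section is defined. -/
def sectionDomain (κ : SignType) : Set (Fin 4 → ℝ) :=
  {z | 0 < dualForm κ (graphU 1 z) (graphU 1 z)}

theorem graphU_one (z : Fin 4 → ℝ) : graphU 1 z = ![1, 0, z 0, z 2] := rfl

theorem graphW_one (z : Fin 4 → ℝ) : graphW 1 z = ![0, 1, z 1, z 3] := rfl

theorem graphU_one_zero : graphU 1 0 = ![1, 0, 0, 0] := rfl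

theorem graphW_one_zero : graphW 1 0 = ![0, 1, 0, 0] := rfl

theorem zero_mem_sectionDomain (κ : SignType) : (0 : Fin 4 → ℝ) ∈ sectionDomain κ := by
  simp [sectionDomain, graphU_one_zero, dualForm]

/-! ### Smooth dependence of the Gram–Schmidt steps -/

section ContDiffForms

variable {E : Type*} [NormedAddCommGroup E] [NormedSpace ℝ E] {x y : E → R4} {e : E}

theorem contDiffAt_form (κ : SignType) (hx : ContDiffAt ℝ ∞ x e) (hy : ContDiffAt ℝ ∞ y e) :
    ContDiffAt ℝ ∞ (fun e => form κ (x e) (y e)) e := by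
  have hx := contDiffAt_pi.1 hx
  have hy := contDiffAt_pi.1 hy
  exact (((contDiffAt_const.mul ((hx 0).mul (hy 0))).add ((hx 1).mul (hy 1))).add
    ((hx 2).mul (hy 2))).add ((hx 3).mul (hy 3))

theorem contDiffAt_dualForm (κ : SignType) (hx : ContDiffAt ℝ ∞ x e) (hy : ContDiffAt ℝ ∞ y e) :
    ContDiffAt ℝ ∞ (fun e => dualForm κ (x e) (y e)) e := by
  have hx := contDiffAt_pi.1 hx
  have hy := contDiffAt_pi.1 hy
  exact ((hx 0).mul (hy 0)).add (contDiffAt_const.mul ((((hx 1).mul (hy 1)).add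
    ((hx 2).mul (hy 2))).add ((hx 3).mul (hy 3))))

theorem contDiffAt_unitVector (κ : SignType) (hx : ContDiffAt ℝ ∞ x e)
    (h : 0 < form κ (x e) (x e)) : ContDiffAt ℝ ∞ (fun e => unitVector κ (x e)) e :=
  (((contDiffAt_form κ hx hx).sqrt h.ne').inv (Real.sqrt_pos.2 h).ne').smul hx

theorem contDiffAt_orthoPoint (κ : SignType) (hx : ContDiffAt ℝ ∞ x e)
    (h : 0 < dualForm κ (x e) (x e)) : ContDiffAt ℝ ∞ (fun e => orthoPoint κ (x e)) e :=
  (((contDiffAt_dualForm κ hx hx).sqrt h.ne').inv (Real.sqrt_pos.2 h).ne').smul hx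

theorem contDiffAt_tangentPart (κ : SignType) (hx : ContDiffAt ℝ ∞ x e)
    (hy : ContDiffAt ℝ ∞ y e) : ContDiffAt ℝ ∞ (fun e => tangentPart κ (x e) (y e)) e :=
  hy.sub ((contDiffAt_dualForm κ hx hy).smul hx)

theorem contDiffAt_orthoPart (κ : SignType) (hx : ContDiffAt ℝ ∞ x e)
    (hy : ContDiffAt ℝ ∞ y e) : ContDiffAt ℝ ∞ (fun e => orthoPart κ (x e) (y e)) e :=
  hy.sub ((contDiffAt_form κ hx hy).smul hx)

end ContDiffForms

theorem isOpen_sectionDomain (κ : SignType) : IsOpen (sectionDomain κ) :=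
  isOpen_lt continuous_const (continuous_iff_continuousAt.2 fun _ =>
    (contDiffAt_dualForm κ (contDiff_graph 1).1.contDiffAt
      (contDiff_graph 1).1.contDiffAt).continuousAt)

/-- The chart target asks that some vector of the plane be positive for `dualForm`; on the smaller
domain the first basis vector is, so Gram–Schmidt can start from it. -/
theorem sectionDomain_subset (κ : SignType) : sectionDomain κ ⊆ (grassmannChart κ 1).target := by
  intro z hz
  change z ∈ (geodesicChart κ 1).target
  rw [geodesicChart_target]
  exact ⟨1, 0, by simpa using! hz⟩

/-- The orthonormal frame adapted to the graph with parameters `z`. -/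
noncomputable def sectionFrame (κ : SignType) (z : Fin 4 → ℝ) : Fin 4 → R4 :=
  gramSchmidtFrame κ (graphU 1 z) (graphW 1 z) ![0, 0, 1, 0] ![0, 0, 0, 1]

theorem det_graph (z : Fin 4 → ℝ) :
    (Matrix.of ![graphU 1 z, graphW 1 z, ![0, 0, 1, 0], ![0, 0, 0, 1]]).det = 1 := by
  rw [graphU_one, graphW_one]
  simp [Matrix.det_succ_row_zero, Fin.sum_univ_succ, Fin.succAbove]

theorem sectionFrame_spec {κ : SignType} {z : Fin 4 → ℝ} (hz : z ∈ sectionDomain κ) :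
    let w₁ := tangentPart κ (orthoPoint κ (graphU 1 z)) (graphW 1 z)
    let v := unitVector κ w₁
    let w₂ := orthoPart κ v (tangentPart κ (orthoPoint κ (graphU 1 z)) ![0, 0, 1, 0])
    let a := unitVector κ w₂
    let w₃ := orthoPart κ a (orthoPart κ v
      (tangentPart κ (orthoPoint κ (graphU 1 z)) ![0, 0, 0, 1]))
    0 < form κ w₁ w₁ ∧ 0 < form κ w₂ w₂ ∧ 0 < form κ w₃ w₃ ∧
      IsFrame κ (orthoPoint κ (graphU 1 z)) v a (unitVector κ w₃) :=
  gramSchmidtFrame_spec (x₁ := graphW 1 z) (x₂ := ![0, 0, 1, 0]) (x₃ := ![0, 0, 0, 1])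
    (show 0 < dualForm κ (graphU 1 z) (graphU 1 z) from hz)
    (fun _ => by rw [graphU_one]; exact one_pos) (by rw [det_graph]; exact one_pos)

theorem isFrame_sectionFrame {κ : SignType} {z : Fin 4 → ℝ} (hz : z ∈ sectionDomain κ) :
    IsFrame κ (sectionFrame κ z 0) (sectionFrame κ z 1) (sectionFrame κ z 2)
      (sectionFrame κ z 3) :=
  (sectionFrame_spec hz).2.2.2

/-- The first two Gram–Schmidt vectors span the same oriented plane as the first two basis vectors:
subtracting a multiple of `p` does not change the wedge with `p`, so only the two positive
normalizing factors appear. -/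
theorem exists_wedge_sectionFrame {κ : SignType} {z : Fin 4 → ℝ} (hz : z ∈ sectionDomain κ) :
    ∃ r : ℝ, 0 < r ∧ ∀ i j, wedge (sectionFrame κ z 0) (sectionFrame κ z 1) i j
      = r * wedge (graphU 1 z) (graphW 1 z) i j := by
  have h1 := (sectionFrame_spec hz).1
  have h0 : 0 < dualForm κ (graphU 1 z) (graphU 1 z) := hz
  refine ⟨_, mul_pos (inv_pos.2 (Real.sqrt_pos.2 h0)) (inv_pos.2 (Real.sqrt_pos.2 h1)),
    fun i j => ?_⟩
  change wedge (orthoPoint κ (graphU 1 z)) (unitVector κ (tangentPart κ _ (graphW 1 z))) i j = _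
  simp only [unitVector]
  generalize (√(form κ _ _))⁻¹ = s
  simp only [tangentPart, orthoPoint]
  generalize (√(dualForm κ _ _))⁻¹ = r
  generalize dualForm κ _ _ = q
  simp only [wedge, Pi.smul_apply, Pi.sub_apply, smul_eq_mul]
  ring

theorem contDiffAt_sectionFrame {κ : SignType} {z : Fin 4 → ℝ} (hz : z ∈ sectionDomain κ)
    (k : Fin 4) : ContDiffAt ℝ ∞ (fun z => sectionFrame κ z k) z := by
  obtain ⟨f1, f2, f3, -⟩ := sectionFrame_spec hz
  have hp : ContDiffAt ℝ ∞ (fun z => orthoPoint κ (graphU 1 z)) z :=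
    contDiffAt_orthoPoint κ (contDiff_graph 1).1.contDiffAt hz
  have hv := contDiffAt_unitVector κ
    (contDiffAt_tangentPart κ hp (contDiff_graph 1).2.contDiffAt) f1
  have ha := contDiffAt_unitVector κ
    (contDiffAt_orthoPart κ hv (contDiffAt_tangentPart κ hp contDiffAt_const)) f2
  have hb := contDiffAt_unitVector κ
    (contDiffAt_orthoPart κ ha (contDiffAt_orthoPart κ hv
      (contDiffAt_tangentPart κ hp contDiffAt_const))) f3
  fin_cases k
  · exact hp
  · exact hv
  · exact ha
  · exact hb

/-- The matrix of `sectionFrame`. -/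
noncomputable def sectionMatrix (κ : SignType) (z : Fin 4 → ℝ) : Matrix (Fin 4) (Fin 4) ℝ :=
  frameMatrix (sectionFrame κ z 0) (sectionFrame κ z 1) (sectionFrame κ z 2) (sectionFrame κ z 3)

theorem sectionMatrix_mem {κ : SignType} {z : Fin 4 → ℝ} (hz : z ∈ sectionDomain κ) :
    sectionMatrix κ z ∈ isometryGroup κ :=
  (isFrame_sectionFrame hz).frameMatrix_mem

/-- The class of the standard geodesic. -/
noncomputable def standardRay (κ : SignType) : OrientedGeodesic κ := mkGeodesic (standardGeodesic κ)

theorem plucker_standardRay (κ : SignType) :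
    plucker (standardRay κ) = wedge ![1, 0, 0, 0] ![0, 1, 0, 0] := by
  rw [standardRay, plucker_mk, (standardGeodesic_zero κ).1, (standardGeodesic_zero κ).2]

theorem standardRay_mem_source (κ : SignType) : standardRay κ ∈ (grassmannChart κ 1).source := by
  rw [mem_grassmannChart_source, plucker_standardRay]
  simp [wedge]

theorem grassmannChart_standardRay (κ : SignType) : grassmannChart κ 1 (standardRay κ) = 0 := by
  rw [grassmannChart_apply, plucker_standardRay]
  funext k
  fin_cases k <;> simp [graphCoord, wedge]

theorem grassmannChart_symm_zero (κ : SignType) : (grassmannChart κ 1).symm 0 = standardRay κ := by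
  rw [← grassmannChart_standardRay κ, (grassmannChart κ 1).left_inv (standardRay_mem_source κ)]

theorem act_sectionMatrix {κ : SignType} {z : Fin 4 → ℝ} (hz : z ∈ sectionDomain κ) :
    act ⟨sectionMatrix κ z, sectionMatrix_mem hz⟩ (standardRay κ) = (grassmannChart κ 1).symm z := by
  obtain ⟨σ, hσ⟩ := exists_mk ((grassmannChart κ 1).symm z)
  obtain ⟨r, hr, h⟩ := plucker_grassmannChart_symm (sectionDomain_subset κ hz)
  obtain ⟨s, hs, h'⟩ := exists_wedge_sectionFrame hz
  rw [← hσ]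
  rw [← hσ, plucker_mk] at h
  -- The frame has bivector `s` times that of the graph, the geodesic `σ` has `r` times it; hence
  -- the factor `s / r`.
  refine act_frameMatrix (isFrame_sectionFrame hz) (div_pos hs hr) fun i j => ?_
  rw [h', h]
  field_simp

/-! ### The local trivialization of the tangent bundle -/

/-- The differential at the standard geodesic of the section, in the chart. -/
noncomputable def sectionDeriv (κ : SignType) (z : Fin 4 → ℝ) : (Fin 4 → ℝ) →L[ℝ] (Fin 4 → ℝ) :=
  fderiv ℝ (actCoord 1 1 (sectionMatrix κ z)) 0

theorem wedge_sectionMatrix_ne_zero {κ : SignType} {z : Fin 4 → ℝ} (hz : z ∈ sectionDomain κ) :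
    wedge (sectionMatrix κ z *ᵥ graphU 1 0) (sectionMatrix κ z *ᵥ graphW 1 0) 0 1 ≠ 0 := by
  obtain ⟨s, hs, h'⟩ := exists_wedge_sectionFrame hz
  rw [graphU_one_zero, graphW_one_zero, sectionMatrix, mulVec_e0, mulVec_e1, h']
  have := wedge_graph 1 z
  simp only [Equiv.Perm.coe_one, id_eq] at this
  rw [this, mul_one]
  exact hs.ne'

/-- It is the partial derivative at `y = 0` of the map `(z, y) ↦ g_z · y`, read in the chart, which
is jointly smooth near `(z, 0)`. -/
theorem contDiffAt_sectionDeriv {κ : SignType} {z : Fin 4 → ℝ} (hz : z ∈ sectionDomain κ) :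
    ContDiffAt ℝ ∞ (sectionDeriv κ) z := by
  refine ContDiffAt.fderiv (f := fun z => actCoord 1 1 (sectionMatrix κ z)) (n := ∞) ?_
    contDiffAt_const (by simp)
  have hm : ∀ x : (Fin 4 → ℝ) → R4, ContDiff ℝ ∞ x →
      ContDiffAt ℝ ∞ (fun q : (Fin 4 → ℝ) × (Fin 4 → ℝ) => sectionMatrix κ q.1 *ᵥ x q.2)
        (z, (0 : Fin 4 → ℝ)) := by
    intro x hx
    simp only [sectionMatrix, frameMatrix_mulVec]
    have hs : ∀ k, ContDiffAt ℝ ∞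
        (fun q : (Fin 4 → ℝ) × (Fin 4 → ℝ) => sectionFrame κ q.1 k) (z, (0 : Fin 4 → ℝ)) :=
      fun k => (contDiffAt_sectionFrame hz k).comp (z, (0 : Fin 4 → ℝ)) contDiffAt_fst
    have hx' : ∀ k, ContDiffAt ℝ ∞
        (fun q : (Fin 4 → ℝ) × (Fin 4 → ℝ) => x q.2 k) (z, (0 : Fin 4 → ℝ)) :=
      fun k => ((contDiff_pi.1 hx k).comp contDiff_snd).contDiffAt
    exact ((((hx' 0).smul (hs 0)).add ((hx' 1).smul (hs 1))).add ((hx' 2).smul (hs 2))).add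
      ((hx' 3).smul (hs 3))
  exact contDiffAt_graphCoord 1 (hm _ (contDiff_graph 1).1) (hm _ (contDiff_graph 1).2)
    (wedge_sectionMatrix_ne_zero hz)

/-- The tangent vector at the standard geodesic with coordinates `w`. -/
noncomputable def standardTangent (κ : SignType) (w : Fin 4 → ℝ) : TangentGeodesic κ :=
  tangentMap 𝓘(ℝ, Fin 4 → ℝ) 𝓘(ℝ, Fin 4 → ℝ) (grassmannChart κ 1).symm ⟨0, w⟩

/-- The tangent chart of the graphs over the plane `(0, 1)`. -/
noncomputable def grassmannTangentChart (κ : SignType) :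
    OpenPartialHomeomorph (TangentGeodesic κ) ((Fin 4 → ℝ) × (Fin 4 → ℝ)) :=
  tangentChart (grassmannChart κ 1) (isSmoothPartial_grassmannChart κ 1)

theorem zero_mem_target (κ : SignType) : (0 : Fin 4 → ℝ) ∈ (grassmannChart κ 1).target :=
  sectionDomain_subset κ (zero_mem_sectionDomain κ)

theorem standardTangent_injective (κ : SignType) : Function.Injective (standardTangent κ) := by
  intro w w' h
  have := (grassmannTangentChart κ).symm.injOn
    (show ((0 : Fin 4 → ℝ), w) ∈ _ from ⟨zero_mem_target κ, mem_univ _⟩)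
    (show ((0 : Fin 4 → ℝ), w') ∈ _ from ⟨zero_mem_target κ, mem_univ _⟩) h
  exact (Prod.ext_iff.1 this).2

theorem tangentAct_standardTangent_mem {κ : SignType} {z : Fin 4 → ℝ} (hz : z ∈ sectionDomain κ)
    (w : Fin 4 → ℝ) : tangentAct ⟨sectionMatrix κ z, sectionMatrix_mem hz⟩ (standardTangent κ w)
      ∈ (grassmannTangentChart κ).source := by
  change act _ ((grassmannChart κ 1).symm 0) ∈ (grassmannChart κ 1).source
  rw [grassmannChart_symm_zero, act_sectionMatrix hz]
  exact (grassmannChart κ 1).map_target (sectionDomain_subset κ hz)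

/-- In the tangent chart, the differential of `g_z` takes the fiber over the standard ray to the
fiber over `z` by `sectionDeriv κ z`. This turns the section into a trivialization. -/
theorem grassmannTangentChart_tangentAct {κ : SignType} {z : Fin 4 → ℝ} (hz : z ∈ sectionDomain κ)
    (w : Fin 4 → ℝ) : grassmannTangentChart κ
      (tangentAct ⟨sectionMatrix κ z, sectionMatrix_mem hz⟩ (standardTangent κ w))
        = (z, sectionDeriv κ z w) := by
  set g : isometryGroup κ := ⟨sectionMatrix κ z, sectionMatrix_mem hz⟩ with hg
  set c := grassmannChart κ 1 with hc
  have h0 := zero_mem_target κ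
  have hs := isSmoothPartial_grassmannChart κ 1
  have e1 : act g (c.symm 0) = c.symm z := by
    rw [hc, grassmannChart_symm_zero, act_sectionMatrix hz]
  have hsrc : act g (c.symm 0) ∈ c.source := by
    rw [e1]
    exact c.map_target (sectionDomain_subset κ hz)
  have hz' : c (act g (c.symm 0)) = z := by
    rw [e1, c.right_inv (sectionDomain_subset κ hz)]
  -- Near `0`, `actCoord` is the action conjugated by the chart, so the two sides agree by the chain
  -- rule for germs.
  have key : tangentMap 𝓘(ℝ, Fin 4 → ℝ) 𝓘(ℝ, Fin 4 → ℝ) (actCoord 1 1 g.1)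
      (⟨0, w⟩ : TangentBundle 𝓘(ℝ, Fin 4 → ℝ) (Fin 4 → ℝ))
      = tangentMap 𝓘(ℝ, Fin 4 → ℝ) 𝓘(ℝ, Fin 4 → ℝ) c (tangentAct g (standardTangent κ w)) := by
    unfold tangentAct standardTangent
    rw [← tangentMap_comp_at _ (mdifferentiable_act g _) (hs.mdifferentiableAt_symm h0)]
    refine tangentMap_comp_local ((mdifferentiable_act g _).comp _ (hs.mdifferentiableAt_symm h0))
      (hs.mdifferentiableAt hsrc) ?_
    filter_upwards [c.open_target.mem_nhds h0] with y hy
    exact (grassmannChart_act_symm g hy).symm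
  refine Prod.ext hz' ?_
  change (tangentMap 𝓘(ℝ, Fin 4 → ℝ) 𝓘(ℝ, Fin 4 → ℝ) c
    (tangentAct g (standardTangent κ w))).2 = _
  rw [← key]
  change mfderiv 𝓘(ℝ, Fin 4 → ℝ) 𝓘(ℝ, Fin 4 → ℝ) (actCoord 1 1 g.1) 0 w = _
  rw [mfderiv_eq_fderiv]
  rfl

/-- The action on tangent vectors is invertible and charts are injective, so `sectionDeriv κ z` is
injective, hence bijective in dimension four. -/
theorem exists_equiv_sectionDeriv {κ : SignType} {z : Fin 4 → ℝ} (hz : z ∈ sectionDomain κ) :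
    ∃ e : (Fin 4 → ℝ) ≃L[ℝ] (Fin 4 → ℝ), (e : (Fin 4 → ℝ) →L[ℝ] (Fin 4 → ℝ))
      = sectionDeriv κ z := by
  have hi : Function.Injective (sectionDeriv κ z) := by
    intro w w' h
    refine standardTangent_injective κ ?_
    have h1 := (grassmannTangentChart κ).injOn (tangentAct_standardTangent_mem hz w)
      (tangentAct_standardTangent_mem hz w')
      (by rw [grassmannTangentChart_tangentAct hz, grassmannTangentChart_tangentAct hz, h])
    have h2 := congrArg (tangentAct (isometryInv ⟨sectionMatrix κ z, sectionMatrix_mem hz⟩)) h1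
    rwa [tangentAct_isometryInv_tangentAct, tangentAct_isometryInv_tangentAct] at h2
  refine ⟨(LinearEquiv.ofInjectiveEndo (sectionDeriv κ z).toLinearMap hi).toContinuousLinearEquiv,
    ?_⟩
  ext w
  rfl

/-- The fiberwise normalization of tangent vectors by the section. -/
noncomputable def fiberNormalization (κ : SignType) :
    OpenPartialHomeomorph ((Fin 4 → ℝ) × (Fin 4 → ℝ)) ((Fin 4 → ℝ) × (Fin 4 → ℝ)) where
  toFun q := (q.1, (sectionDeriv κ q.1).inverse q.2)
  invFun q := (q.1, sectionDeriv κ q.1 q.2)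
  source := sectionDomain κ ×ˢ univ
  target := sectionDomain κ ×ˢ univ
  map_source' q hq := ⟨hq.1, mem_univ _⟩
  map_target' q hq := ⟨hq.1, mem_univ _⟩
  left_inv' q hq := by
    obtain ⟨e, he⟩ := exists_equiv_sectionDeriv hq.1
    simp [← he]
  right_inv' q hq := by
    obtain ⟨e, he⟩ := exists_equiv_sectionDeriv hq.1
    simp [← he]
  open_source := (isOpen_sectionDomain κ).prod isOpen_univ
  open_target := (isOpen_sectionDomain κ).prod isOpen_univ
  continuousOn_toFun := fun q hq => by
    obtain ⟨e, he⟩ := exists_equiv_sectionDeriv hq.1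
    have hinv : ContDiffAt ℝ ∞ ContinuousLinearMap.inverse (sectionDeriv κ q.1) :=
      he ▸ contDiffAt_map_inverse e
    have h1 := hinv.comp q.1 (contDiffAt_sectionDeriv hq.1)
    exact (continuousAt_fst.prodMk
      ((h1.continuousAt.comp continuousAt_fst).clm_apply continuousAt_snd)).continuousWithinAt
  continuousOn_invFun := fun q hq =>
    (continuousAt_fst.prodMk (((contDiffAt_sectionDeriv hq.1).continuousAt.comp
      continuousAt_fst).clm_apply continuousAt_snd)).continuousWithinAt

theorem isSmoothPartial_fiberNormalization (κ : SignType) :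
    IsSmoothPartial 𝓘(ℝ, (Fin 4 → ℝ) × (Fin 4 → ℝ)) 𝓘(ℝ, (Fin 4 → ℝ) × (Fin 4 → ℝ))
      (fiberNormalization κ) := by
  constructor
  · rw [contMDiffOn_iff_contDiffOn]
    intro q hq
    obtain ⟨e, he⟩ := exists_equiv_sectionDeriv hq.1
    have hinv : ContDiffAt ℝ ∞ ContinuousLinearMap.inverse (sectionDeriv κ q.1) :=
      he ▸ contDiffAt_map_inverse e
    have h1 := hinv.comp q.1 (contDiffAt_sectionDeriv hq.1)
    exact (contDiffAt_fst.prodMk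
      ((h1.comp q contDiffAt_fst).clm_apply contDiffAt_snd)).contDiffWithinAt
  · rw [contMDiffOn_iff_contDiffOn]
    intro q hq
    exact (contDiffAt_fst.prodMk (((contDiffAt_sectionDeriv hq.1).comp q
      contDiffAt_fst).clm_apply contDiffAt_snd)).contDiffWithinAt

/-- The coordinates of the admissible vectors at the standard geodesic. -/
def admissibleFiber (κ : SignType) (α : ℝ) : Set (Fin 4 → ℝ) :=
  {w | standardTangent κ w ∈ admissible κ α}

theorem isSmoothPartial_ofSet {V : Type*} [NormedAddCommGroup V] [NormedSpace ℝ V] {s : Set V}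
    (hs : IsOpen s) : IsSmoothPartial 𝓘(ℝ, V) 𝓘(ℝ, V) (OpenPartialHomeomorph.ofSet s hs) :=
  ⟨contMDiffOn_id, contMDiffOn_id⟩

/-- Every tangent vector over `z` is `dg_z` of a vector `w` at the standard ray, and `w` is the
fiber component of the trivialization. Since the admissible set is invariant under `G_κ`, membership
depends on `w` alone. -/
theorem isAdaptedTrivialization_standard (κ : SignType) (α : ℝ) :
    IsAdaptedTrivialization (admissible κ α) (admissibleFiber κ α)
      ((grassmannChart κ 1).trans
        (OpenPartialHomeomorph.ofSet (sectionDomain κ) (isOpen_sectionDomain κ)))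
      ((grassmannTangentChart κ).trans (fiberNormalization κ)) where
  smooth_base := (isSmoothPartial_grassmannChart κ 1).trans (isSmoothPartial_ofSet _)
  smooth := (isSmoothPartial_tangentChart _ _).trans (isSmoothPartial_fiberNormalization κ)
  source_eq := by
    ext X
    simp only [OpenPartialHomeomorph.trans_source, mem_inter_iff, mem_preimage]
    exact and_congr_right fun _ => ⟨fun h => h.1, fun h => ⟨h, mem_univ _⟩⟩
  target_eq := by
    ext q
    simp only [OpenPartialHomeomorph.trans_target, mem_inter_iff, mem_preimage, mem_prod, mem_univ,
      and_true]
    exact ⟨fun h => ⟨h.1.1, h.2.1⟩, fun h => ⟨⟨h.1, mem_univ _⟩, ⟨h.2, mem_univ _⟩⟩⟩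
  fst_eq _ _ := rfl
  mem_iff X hX := by
    have hX1 : X ∈ (grassmannTangentChart κ).source := hX.1
    have hz : (grassmannTangentChart κ X).1 ∈ sectionDomain κ := hX.2.1
    set z := (grassmannTangentChart κ X).1
    obtain ⟨e, he⟩ := exists_equiv_sectionDeriv hz
    change _ ↔ (sectionDeriv κ z).inverse (grassmannTangentChart κ X).2 ∈ admissibleFiber κ α
    set w := (sectionDeriv κ z).inverse (grassmannTangentChart κ X).2 with hw
    have h1 : sectionDeriv κ z w = (grassmannTangentChart κ X).2 := by
      rw [hw, ← he]
      simp
    have h2 : X = tangentAct ⟨sectionMatrix κ z, sectionMatrix_mem hz⟩ (standardTangent κ w) := by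
      refine (grassmannTangentChart κ).injOn hX1 (tangentAct_standardTangent_mem hz w) ?_
      rw [grassmannTangentChart_tangentAct hz, h1]
    rw [h2, tangentAct_mem_admissible_iff]
    rfl

/-- By transitivity `l` is a translate of the standard ray; the trivialization there is precomposed
with `g⁻¹`, which preserves the admissible set. -/
theorem exists_isAdaptedTrivialization (κ : SignType) (α : ℝ) (l : OrientedGeodesic κ) :
    ∃ φ Θ, l ∈ φ.source ∧
      IsAdaptedTrivialization (admissible κ α) (admissibleFiber κ α) φ Θ := by
  obtain ⟨g, rfl⟩ := exists_act_eq l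
  have h := isAdaptedTrivialization_standard κ α
  set φ := (grassmannChart κ 1).trans
    (OpenPartialHomeomorph.ofSet (sectionDomain κ) (isOpen_sectionDomain κ)) with hφ
  set Θ := (grassmannTangentChart κ).trans (fiberNormalization κ)
  have s1 : IsSmoothPartial 𝓘(ℝ, Fin 4 → ℝ) 𝓘(ℝ, Fin 4 → ℝ)
      (actHomeomorph g).symm.toOpenPartialHomeomorph :=
    ⟨(contMDiff_act _).contMDiffOn, (contMDiff_act g).contMDiffOn⟩
  have s2 : IsSmoothPartial 𝓘(ℝ, Fin 4 → ℝ).tangent 𝓘(ℝ, Fin 4 → ℝ).tangent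
      (tangentActHomeomorph g).symm.toOpenPartialHomeomorph :=
    ⟨(contMDiff_tangentAct _).contMDiffOn, (contMDiff_tangentAct g).contMDiffOn⟩
  refine ⟨(actHomeomorph g).symm.toOpenPartialHomeomorph.trans φ,
    (tangentActHomeomorph g).symm.toOpenPartialHomeomorph.trans Θ, ?_, s1.trans h.smooth_base,
    s2.trans h.smooth, ?_, ?_, fun X hX => ?_, fun X hX => ?_⟩
  · rw [OpenPartialHomeomorph.trans_source]
    refine ⟨mem_univ _, ?_⟩
    change act (isometryInv g) (act g (standardRay κ)) ∈ φ.source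
    rw [act_isometryInv_act, hφ, OpenPartialHomeomorph.trans_source]
    refine ⟨standardRay_mem_source κ, ?_⟩
    change grassmannChart κ 1 (standardRay κ) ∈ sectionDomain κ
    rw [grassmannChart_standardRay]
    exact zero_mem_sectionDomain κ
  · rw [OpenPartialHomeomorph.trans_source, h.source_eq]
    rfl
  · change Θ.target ∩ Θ.symm ⁻¹' univ = (φ.target ∩ φ.symm ⁻¹' univ) ×ˢ univ
    rw [preimage_univ, preimage_univ, inter_univ, inter_univ, h.target_eq]
  · rw [OpenPartialHomeomorph.trans_source] at hX
    exact h.fst_eq _ hX.2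
  · rw [OpenPartialHomeomorph.trans_source] at hX
    rw [← tangentAct_mem_admissible_iff (isometryInv g)]
    exact h.mem_iff _ hX.2

/-! ### The fiber over the standard geodesic -/

theorem cast_pow_three (κ : SignType) : (κ : ℝ) ^ 3 = κ := by
  rcases κ with _ | _ | _ <;> norm_num

/-- The coordinates of a tangent vector at the standard geodesic as a pair of complex numbers. -/
def complexCoord : (Fin 4 → ℝ) ≃ₗ[ℝ] ℂ × ℂ where
  toFun w := (⟨w 0, w 2⟩, ⟨w 1, w 3⟩)
  invFun q := ![q.1.re, q.2.re, q.1.im, q.2.im]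
  map_add' _ _ := rfl
  map_smul' r w := by
    refine Prod.ext (Complex.ext ?_ ?_) (Complex.ext ?_ ?_) <;> simp
  left_inv w := by
    funext k
    fin_cases k <;> rfl
  right_inv _ := rfl

theorem complexCoord_apply (w : Fin 4 → ℝ) : complexCoord w = (⟨w 0, w 2⟩, ⟨w 1, w 3⟩) := rfl

/-- The admissible vectors at the standard geodesic, in complex coordinates. -/
noncomputable def fiberPoint (κ : SignType) (α θ s : ℝ) : ℂ × ℂ :=
  (Complex.exp (θ * Complex.I) * (cosK κ s * Complex.I - α * sinK κ s),
    Complex.exp (θ * Complex.I) * (α * cosK κ s + κ * sinK κ s * Complex.I))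

/-- As a linear map into `ℂ`, the velocity sends `p` to `a = i e^{iθ}` and `v` to `α b = α e^{iθ}`.
The two coordinates are its values at `e₀ = cos_κ s p - sin_κ s v` and `e₁ = κ sin_κ s p + cos_κ s
v`. -/
theorem complexCoord_chartVelocity (κ : SignType) (α θ s : ℝ) :
    complexCoord (chartVelocity α ![cosK κ s, sinK κ s, 0, 0] ![-(κ : ℝ) * sinK κ s, cosK κ s, 0, 0]
      ![0, 0, Real.cos θ, Real.sin θ] ![0, 0, -Real.sin θ, Real.cos θ])
      = fiberPoint κ α θ s := by
  have hκ : ((κ : ℂ)) = ((κ : ℝ) : ℂ) := by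
    rcases κ with _ | _ | _ <;> simp
  rw [fiberPoint, Complex.exp_mul_I, ← Complex.ofReal_cos, ← Complex.ofReal_sin, hκ]
  refine Prod.ext (Complex.ext ?_ ?_) (Complex.ext ?_ ?_) <;>
    simp [complexCoord_apply, chartVelocity, -Complex.ofReal_cos, -Complex.ofReal_sin] <;> ring

theorem tangent_eq_zero {κ : SignType} {s : ℝ} {x : R4}
    (h1 : dualForm κ ![cosK κ s, sinK κ s, 0, 0] x = 0)
    (h2 : form κ ![-(κ : ℝ) * sinK κ s, cosK κ s, 0, 0] x = 0) : x 0 = 0 ∧ x 1 = 0 := by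
  have hκ := cast_pow_three κ
  have h := cosK_sq κ s
  simp [dualForm, form] at h1 h2
  set c := cosK κ s
  set S := sinK κ s
  constructor
  · linear_combination c * h1 - S * κ * h2 - x 0 * h - S ^ 2 * x 0 * hκ
  · linear_combination c * h2 + κ ^ 2 * S * h1 - x 1 * h - S ^ 2 * x 1 * hκ

theorem isStandardFrame_angle (κ : SignType) (θ s : ℝ) :
    IsStandardFrame κ ![cosK κ s, sinK κ s, 0, 0] ![-(κ : ℝ) * sinK κ s, cosK κ s, 0, 0]
      ![0, 0, Real.cos θ, Real.sin θ] ![0, 0, -Real.sin θ, Real.cos θ] := by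
  have h := cosK_sq κ s
  have h' := Real.cos_sq_add_sin_sq θ
  have e0 := (standardGeodesic κ).eq_cos_add_sin s
  rw [(standardGeodesic_zero κ).1, (standardGeodesic_zero κ).2] at e0
  have ep : ![cosK κ s, sinK κ s, 0, 0] = (standardGeodesic κ).1 s := by
    rw [e0.1]; funext k; fin_cases k <;> simp
  have ev : ![-(κ : ℝ) * sinK κ s, cosK κ s, 0, 0] = deriv (standardGeodesic κ).1 s := by
    rw [e0.2]; funext k; fin_cases k <;> simp
  have hM : ![cosK κ s, sinK κ s, 0, 0] ∈ spaceForm κ := ep ▸ (standardGeodesic κ).2.2.1 s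
  refine { mem := hM, tv := ?_, ta := ?_, tb := ?_, vv := ?_, aa := ?_, bb := ?_, va := ?_, vb := ?_,
           ab := ?_, pos := ?_, wedge_eq := fun i j => ?_, p2 := rfl, p3 := rfl, v2 := rfl,
           v3 := rfl, a0 := rfl, a1 := rfl, b0 := rfl, b1 := rfl }
  · rw [ep, ev]
    exact deriv_mem_tangentAt (standardGeodesic κ).2.1 (standardGeodesic κ).2.2.1 s
  · rw [mem_tangentAt_iff hM]
    simp [dualForm]
  · rw [mem_tangentAt_iff hM]
    simp [dualForm]
  · rw [ev]
    exact (standardGeodesic κ).2.2.2.1 s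
  · simp [form]
    linarith
  · simp [form]
    linarith
  · simp [form]
  · simp [form]
  · simp [form]
    ring
  · have : (Matrix.of ![![cosK κ s, sinK κ s, 0, 0], ![-(κ : ℝ) * sinK κ s, cosK κ s, 0, 0],
      ![0, 0, Real.cos θ, Real.sin θ], ![0, 0, -Real.sin θ, Real.cos θ]]).det
        = (cosK κ s ^ 2 + κ * sinK κ s ^ 2) * (Real.cos θ ^ 2 + Real.sin θ ^ 2) := by
      simp [Matrix.det_succ_row_zero, Fin.sum_univ_succ, Fin.succAbove]
      linear_combination (cosK κ s ^ 2 + κ * sinK κ s ^ 2) * h'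
    rw [this, h, h']
    norm_num
  · rw [ep, ev, e0.1, e0.2, wedge_comb]
    linear_combination wedge ![1, 0, 0, 0] ![0, 1, 0, 0] i j * h

/-- Orthogonality to the point and the velocity of the standard geodesic puts `b` and `a` in the
plane `(e₂, e₃)`, where they form a positive orthonormal pair, that is, a rotation of `(e₂, e₃)`. -/
theorem IsFrame.exists_angle {κ : SignType} {s : ℝ} {b a : R4}
    (h : IsFrame κ ![cosK κ s, sinK κ s, 0, 0] ![-(κ : ℝ) * sinK κ s, cosK κ s, 0, 0] b a) :
    ∃ θ : ℝ, b = ![0, 0, Real.cos θ, Real.sin θ] ∧ a = ![0, 0, -Real.sin θ, Real.cos θ] := by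
  obtain ⟨b0, b1⟩ := tangent_eq_zero ((mem_tangentAt_iff h.mem _).1 h.ta) h.va
  obtain ⟨a0, a1⟩ := tangent_eq_zero ((mem_tangentAt_iff h.mem _).1 h.tb) h.vb
  have hb := h.aa
  have ha := h.bb
  have hab := h.ab
  have hd := h.pos
  have hc := cosK_sq κ s
  rw [show (Matrix.of ![![cosK κ s, sinK κ s, 0, 0], ![-(κ : ℝ) * sinK κ s, cosK κ s, 0, 0],
      b, a]).det = (cosK κ s ^ 2 + κ * sinK κ s ^ 2) * (b 2 * a 3 - b 3 * a 2) by
      simp [Matrix.det_succ_row_zero, Fin.sum_univ_succ, Fin.succAbove]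
      ring, hc, one_mul] at hd
  simp only [form, b0, b1, a0, a1] at hb ha hab
  obtain ⟨θ, h2, h3⟩ := Helicoidal.exists_angle (κ := SignType.pos) (a := b 2) (b := b 3)
    (by simp; linarith) (fun h => absurd rfl h)
  have h2 : Real.cos θ = b 2 := h2
  have h3 : Real.sin θ = b 3 := h3
  -- Lagrange's identity gives the square, and the orientation gives the sign.
  have hd1 : b 2 * a 3 - b 3 * a 2 = 1 := by
    have : (b 2 * a 3 - b 3 * a 2) ^ 2 = 1 := by
      linear_combination (a 2 ^ 2 + a 3 ^ 2) * hb + ha - (b 2 * a 2 + b 3 * a 3) * hab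
    nlinarith
  refine ⟨θ, ?_, ?_⟩
  · funext k
    fin_cases k <;> simp [b0, b1, h2, h3]
  · have e2 : a 2 = - b 3 := by linear_combination -a 2 * hb + b 2 * hab - b 3 * hd1
    have e3 : a 3 = b 2 := by linear_combination -a 3 * hb + b 3 * hab + b 2 * hd1
    funext k
    fin_cases k <;> simp [a0, a1, h2, h3, e2, e3]

/-- The frames lying over the standard ray are parametrized by a shift `s` along it and a rotation
`θ` about it, and their velocities have been computed in the chart. -/
theorem mem_admissibleFiber_iff {κ : SignType} {α : ℝ} {w : Fin 4 → ℝ} :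
    w ∈ admissibleFiber κ α ↔ ∃ θ s, complexCoord w = fiberPoint κ α θ s := by
  constructor
  · rintro ⟨σ, A, Γ, ⟨φ, hφ, hΓ⟩, hX⟩
    obtain ⟨b, h, hh⟩ := hφ.exists_isFrame
    have hΓ' : Γ = fun t => mkGeodesic (helicoid h α t) := funext fun t => (hΓ t).trans (hh t)
    -- The base point of the velocity is the standard ray, so the initial ray `σ` is a
    -- reparametrization of it; its shift is the parameter `s`.
    have e0 : mkGeodesic σ = standardRay κ := by
      obtain ⟨u, -, hu⟩ := hX
      have h1 : (grassmannChart κ 1).symm 0 = Γ 0 := congrArg Bundle.TotalSpace.proj hu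
      rw [grassmannChart_symm_zero, hΓ'] at h1
      rw [h1]
      refine mkGeodesic_eq_of_init ?_ ?_
      · simp [(helicoid_zero h α 0).1]
      · simp [(helicoid_zero h α 0).2]
    obtain ⟨s, hs⟩ := Quotient.exact e0
    have ep : σ.1 0 = ![cosK κ s, sinK κ s, 0, 0] := by
      rw [hs, zero_add, ((standardGeodesic κ).eq_cos_add_sin s).1, (standardGeodesic_zero κ).1,
        (standardGeodesic_zero κ).2]
      funext k
      fin_cases k <;> simp
    have ev : deriv σ.1 0 = ![-(κ : ℝ) * sinK κ s, cosK κ s, 0, 0] := by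
      rw [deriv_shift hs, ((standardGeodesic κ).eq_cos_add_sin s).2, (standardGeodesic_zero κ).1,
        (standardGeodesic_zero κ).2]
      funext k
      fin_cases k <;> simp
    subst hΓ'
    generalize σ.1 0 = p at *
    generalize deriv σ.1 0 = v at *
    subst ep ev
    obtain ⟨θ, rfl, rfl⟩ := h.exists_angle
    refine ⟨θ, s, ?_⟩
    rw [← complexCoord_chartVelocity]
    exact congrArg _ (standardTangent_injective κ
      (hX.unique ((isStandardFrame_angle κ θ s).isInitialVelocity α)))
  · rintro ⟨θ, s, h⟩
    rw [← complexCoord_chartVelocity] at h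
    rw [complexCoord.injective h]
    have hf := isStandardFrame_angle κ θ s
    exact ⟨UnitGeodesic.ofInit hf.mem hf.tv hf.vv, _, _, ⟨_, hf.toIsFrame.isHelicoidalSurface α
      (UnitGeodesic.ofInit_zero _ _ _).1 (UnitGeodesic.ofInit_zero _ _ _).2, fun _ => rfl⟩,
      hf.isInitialVelocity α⟩

theorem admissibleFiber_nonempty (κ : SignType) (α : ℝ) : (admissibleFiber κ α).Nonempty :=
  ⟨complexCoord.symm (fiberPoint κ α 0 0),
    mem_admissibleFiber_iff.2 ⟨0, 0, complexCoord.apply_symm_apply _⟩⟩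

/-! ### Slice subsets of the complex plane -/

theorem isSmoothPartial_iff_contDiffOn {V W : Type*} [NormedAddCommGroup V] [NormedSpace ℝ V]
    [NormedAddCommGroup W] [NormedSpace ℝ W] {φ : OpenPartialHomeomorph V W} :
    IsSmoothPartial 𝓘(ℝ, V) 𝓘(ℝ, W) φ ↔
      ContDiffOn ℝ ∞ φ φ.source ∧ ContDiffOn ℝ ∞ φ.symm φ.target := by
  rw [IsSmoothPartial, contMDiffOn_iff_contDiffOn, contMDiffOn_iff_contDiffOn]

theorem isSliceSet_singleton {E : Type*} [NormedAddCommGroup E] [NormedSpace ℝ E] (x : E) :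
    IsSliceSet 𝓘(ℝ, E) PUnit.{1} E {x} := fun _ _ =>
  ⟨(Homeomorph.addRight (-x)).toOpenPartialHomeomorph.trans
      (ContinuousLinearEquiv.uniqueProd ℝ E PUnit.{1}).symm.toHomeomorph.toOpenPartialHomeomorph,
    by simp,
    IsSmoothPartial.trans (isSmoothPartial_iff_contDiffOn.2
      ⟨(contDiff_id.add contDiff_const).contDiffOn, (contDiff_id.add contDiff_const).contDiffOn⟩)
      (isSmoothPartial_continuousLinearEquiv _),
    fun y _ => by simp [← sub_eq_add_neg, sub_eq_zero]⟩

theorem isSliceSet_re (k : ℝ) :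
    IsSliceSet 𝓘(ℝ, ℂ) (PUnit.{1} × ℝ) (ℝ × PUnit.{1}) {z : ℂ | z.re = k} :=
  IsSliceSet.comap ((isSliceSet_singleton k).prod isSliceSet_univ) fun z _ =>
    ⟨Complex.equivRealProdCLM.toHomeomorph.toOpenPartialHomeomorph, by simp,
      isSmoothPartial_continuousLinearEquiv _, fun y _ => by simp⟩

theorem isSmoothPartial_expOpenPartialHomeomorph :
    IsSmoothPartial 𝓘(ℝ, ℂ) 𝓘(ℝ, ℂ) Complex.expOpenPartialHomeomorph :=
  isSmoothPartial_iff_contDiffOn.2 ⟨Complex.contDiff_exp.contDiffOn, fun _ hz =>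
    ((Complex.contDiffAt_log hz).restrict_scalars ℝ).contDiffWithinAt⟩

/-- Near a point `x` of the circle, `y ↦ log (x⁻¹ y)` is a chart taking the circle to the imaginary
axis. The radius must be nonzero for `x` to be invertible. -/
theorem isSliceSet_circle {r : ℝ} (hr : r ≠ 0) :
    IsSliceSet 𝓘(ℝ, ℂ) (PUnit.{1} × ℝ) (ℝ × PUnit.{1}) {z : ℂ | ‖z‖ = |r|} := by
  refine IsSliceSet.comap (isSliceSet_re 0) fun x hx => ?_
  have hx : ‖x‖ = |r| := hx
  have hx0 : x ≠ 0 := by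
    rw [← norm_ne_zero_iff, hx]
    exact abs_ne_zero.2 hr
  refine ⟨(Homeomorph.mulLeft₀ x⁻¹ (inv_ne_zero hx0)).toOpenPartialHomeomorph.trans
    Complex.expOpenPartialHomeomorph.symm, ?_, IsSmoothPartial.trans
      (isSmoothPartial_iff_contDiffOn.2 ⟨(contDiff_const.mul contDiff_id).contDiffOn,
        (contDiff_const.mul contDiff_id).contDiffOn⟩)
      isSmoothPartial_expOpenPartialHomeomorph.symm, fun y hy => ?_⟩
  · rw [OpenPartialHomeomorph.trans_source]
    refine ⟨mem_univ _, ?_⟩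
    change x⁻¹ * x ∈ Complex.slitPlane
    rw [inv_mul_cancel₀ hx0]
    exact Complex.one_mem_slitPlane
  · rw [OpenPartialHomeomorph.trans_source] at hy
    have hy : x⁻¹ * y ∈ Complex.slitPlane := hy.2
    have hn : 0 < ‖x⁻¹ * y‖ := norm_pos_iff.2 (Complex.slitPlane_ne_zero hy)
    change ‖y‖ = |r| ↔ (Complex.log (x⁻¹ * y)).re = 0
    rw [Complex.log_re, Real.log_eq_zero, norm_mul, norm_inv, hx]
    rw [norm_mul, norm_inv, hx] at hn
    have hr' : |r| ≠ 0 := abs_ne_zero.2 hr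
    constructor
    · intro h
      right; left
      rw [h, inv_mul_cancel₀ hr']
    -- The real logarithm vanishes at `0`, `1` and `-1`; the norm is positive, so it is `1`.
    · rintro (h | h | h)
      · exact absurd h hn.ne'
      · field_simp at h
        exact h
      · linarith

/-- The map `(x, y) ↦ (x, x y)` on `{x ≠ 0}`. -/
noncomputable def mulPartialHomeomorph : OpenPartialHomeomorph (ℂ × ℂ) (ℂ × ℂ) where
  toFun q := (q.1, q.1 * q.2)
  invFun q := (q.1, q.1⁻¹ * q.2)
  source := {q | q.1 ≠ 0}
  target := {q | q.1 ≠ 0}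
  map_source' _ hq := hq
  map_target' _ hq := hq
  left_inv' q hq := Prod.ext rfl (inv_mul_cancel_left₀ hq q.2)
  right_inv' q hq := Prod.ext rfl (mul_inv_cancel_left₀ hq q.2)
  open_source := isOpen_ne_fun continuous_fst continuous_const
  open_target := isOpen_ne_fun continuous_fst continuous_const
  continuousOn_toFun := by fun_prop
  continuousOn_invFun := continuousOn_fst.prodMk
    ((continuousOn_fst.inv₀ fun _ hq => hq).mul continuousOn_snd)

theorem isSmoothPartial_mulPartialHomeomorph :
    IsSmoothPartial 𝓘(ℝ, ℂ × ℂ) 𝓘(ℝ, ℂ × ℂ) mulPartialHomeomorph :=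
  isSmoothPartial_iff_contDiffOn.2
    ⟨(contDiff_fst.prodMk (contDiff_fst.mul contDiff_snd)).contDiffOn, fun q hq =>
      (contDiffAt_fst.prodMk (((contDiffAt_inv ℝ hq).comp q contDiffAt_fst).mul
        contDiffAt_snd)).contDiffWithinAt⟩

/-- The sign of `r` is absorbed by the argument of `z / r`, so negative radii such as `1 - α` are
covered; for `r = 0` any angle works. -/
theorem exists_eq_mul_exp {z : ℂ} {r : ℝ} (h : ‖z‖ = |r|) :
    ∃ θ : ℝ, z = r * Complex.exp (θ * Complex.I) := by
  rcases eq_or_ne r 0 with rfl | hr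
  · refine ⟨0, ?_⟩
    rw [abs_zero, norm_eq_zero] at h
    simp [h]
  · refine ⟨Complex.arg (z / r), ?_⟩
    have h1 := Complex.norm_mul_exp_arg_mul_I (z / r)
    rw [norm_div, h, Complex.norm_real, Real.norm_eq_abs, div_self (abs_ne_zero.2 hr),
      Complex.ofReal_one, one_mul] at h1
    rw [h1, mul_div_cancel₀ z (Complex.ofReal_ne_zero.2 hr)]

theorem norm_mul_exp (r θ : ℝ) : ‖(r : ℂ) * Complex.exp (θ * Complex.I)‖ = |r| := by
  rw [norm_mul, Complex.norm_exp_ofReal_mul_I, mul_one, Complex.norm_real, Real.norm_eq_abs]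

/-! ### The set of admissible velocities is a fiber subbundle -/

/-- It remains to find real linear coordinates `M` on `ℂ²` in which the fiber is a known slice set.
The dimension count supplies the identification of `V₁ × V₂` with the model space. -/
theorem isFiberSubbundle_of_isSliceSet {κ : SignType} {α : ℝ} {V₁ V₂ : Type}
    [NormedAddCommGroup V₁] [NormedSpace ℝ V₁] [NormedAddCommGroup V₂] [NormedSpace ℝ V₂]
    [FiniteDimensional ℝ V₁] [FiniteDimensional ℝ V₂]
    (hd : Module.finrank ℝ (V₁ × V₂) = 4) {T : Set (ℂ × ℂ)}
    (hT : IsSliceSet 𝓘(ℝ, ℂ × ℂ) V₁ V₂ T) (M : (ℂ × ℂ) ≃ₗ[ℝ] ℂ × ℂ)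
    (h : ∀ q, (∃ θ s, q = fiberPoint κ α θ s) ↔ M q ∈ T) :
    IsFiberSubbundle 𝓘(ℝ, Fin 4 → ℝ) (admissible κ α) := by
  refine isFiberSubbundle_of_adapted (V₁ := V₁) (V₂ := V₂) (F := admissibleFiber κ α) ?_
    (admissibleFiber_nonempty κ α) (ContinuousLinearEquiv.ofFinrankEq (by simpa using hd))
    (exists_isAdaptedTrivialization κ α)
  refine hT.comap fun w _ => ⟨(complexCoord.trans
    M).toContinuousLinearEquiv.toHomeomorph.toOpenPartialHomeomorph, mem_univ _,
    isSmoothPartial_continuousLinearEquiv _, fun y _ => ?_⟩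
  rw [mem_admissibleFiber_iff]
  exact h (complexCoord y)

/-! ### The fiber for each of the three curvatures -/

theorem fiberPoint_zero (α θ s : ℝ) : fiberPoint 0 α θ s
    = (Complex.exp (θ * Complex.I) * (Complex.I - α * s), α * Complex.exp (θ * Complex.I)) := by
  change (_ * (((1 : ℝ) : ℂ) * _ - α * (s : ℂ)), _ * (α * ((1 : ℝ) : ℂ) + _)) = _
  rw [SignType.coe_zero, Complex.ofReal_one]
  ring_nf

theorem fiberPoint_one (α θ s : ℝ) : fiberPoint 1 α θ s
    = (Complex.exp (θ * Complex.I) * (Complex.cos s * Complex.I - α * Complex.sin s),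
      Complex.exp (θ * Complex.I) * (α * Complex.cos s + Complex.sin s * Complex.I)) := by
  change (_ * ((Real.cos s : ℂ) * _ - α * (Real.sin s : ℂ)),
    _ * (α * (Real.cos s : ℂ) + _ * (Real.sin s : ℂ) * _)) = _
  rw [SignType.coe_one, Complex.ofReal_cos, Complex.ofReal_sin, one_mul]

theorem fiberPoint_neg_one (α θ s : ℝ) : fiberPoint (-1) α θ s
    = (Complex.exp (θ * Complex.I) * (Complex.cosh s * Complex.I - α * Complex.sinh s),
      Complex.exp (θ * Complex.I) * (α * Complex.cosh s - Complex.sinh s * Complex.I)) := by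
  change (_ * ((Real.cosh s : ℂ) * _ - α * (Real.sinh s : ℂ)),
    _ * (α * (Real.cosh s : ℂ) + _ * (Real.sinh s : ℂ) * _)) = _
  rw [SignType.coe_neg_one, Complex.ofReal_cosh, Complex.ofReal_sinh]
  ring_nf

theorem finrank_punit : Module.finrank ℝ PUnit.{1} = 0 := Module.finrank_zero_of_subsingleton

/-- Here `B = α e^{iθ}` runs over a circle, and `A / (i B) = 1 / α + i s` runs over a vertical line
independent of `θ`: the fiber is a cylinder. -/
theorem isFiberSubbundle_admissible_zero_of_ne {α : ℝ} (hα : α ≠ 0) :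
    IsFiberSubbundle 𝓘(ℝ, Fin 4 → ℝ) (admissible 0 α) := by
  -- The pair `(A, B)` becomes `(i B, A)`, so that the inverse of `mulPartialHomeomorph` divides `A`
  -- by `i B`.
  let M : (ℂ × ℂ) ≃ₗ[ℝ] ℂ × ℂ :=
    { toFun := fun q => (Complex.I * q.2, q.1)
      invFun := fun q => (q.2, -Complex.I * q.1)
      map_add' := fun q q' => by ext1 <;> simp [mul_add]
      map_smul' := fun r q => by ext1 <;> simp [mul_left_comm]
      left_inv := fun q => by ext1 <;> simp [← mul_assoc]
      right_inv := fun q => by ext1 <;> simp [← mul_assoc] }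
  have hα' : (α : ℂ) ≠ 0 := Complex.ofReal_ne_zero.2 hα
  refine isFiberSubbundle_of_isSliceSet (V₁ := (PUnit.{1} × ℝ) × (PUnit.{1} × ℝ))
    (V₂ := (ℝ × PUnit.{1}) × (ℝ × PUnit.{1})) (by simp [finrank_punit])
    (T := {q | ‖q.1‖ = |α| ∧ (q.1⁻¹ * q.2).re = α⁻¹}) ?_ M fun q => ?_
  · refine ((isSliceSet_circle hα).prod (isSliceSet_re α⁻¹)).comap fun q hq =>
      ⟨mulPartialHomeomorph.symm, ?_, isSmoothPartial_mulPartialHomeomorph.symm, fun _ _ => Iff.rfl⟩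
    change q.1 ≠ 0
    rw [← norm_ne_zero_iff, hq.1]
    exact abs_ne_zero.2 hα
  · change _ ↔ ‖Complex.I * q.2‖ = |α| ∧ ((Complex.I * q.2)⁻¹ * q.1).re = α⁻¹
    have hI := Complex.I_mul_I
    simp only [fiberPoint_zero]
    constructor
    · rintro ⟨θ, s, rfl⟩
      have hexp := Complex.exp_ne_zero (θ * Complex.I)
      refine ⟨?_, ?_⟩
      · rw [norm_mul, norm_mul_exp, Complex.norm_I, one_mul]
      · have : (Complex.I * (α * Complex.exp (θ * Complex.I)))⁻¹
          * (Complex.exp (θ * Complex.I) * (Complex.I - α * s)) = (α⁻¹ : ℝ) + s * Complex.I := by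
          push_cast
          field_simp
          linear_combination -α * s * hI
        rw [this]
        simp
    · rintro ⟨h1, h2⟩
      obtain ⟨a, b⟩ := q
      simp only at h1 h2
      rw [norm_mul, Complex.norm_I, one_mul] at h1
      obtain ⟨θ, rfl⟩ := exists_eq_mul_exp h1
      have hexp := Complex.exp_ne_zero (θ * Complex.I)
      have h3 := Complex.re_add_im ((Complex.I * (α * Complex.exp (θ * Complex.I)))⁻¹ * a)
      rw [h2] at h3
      refine ⟨θ, ((Complex.I * (α * Complex.exp (θ * Complex.I)))⁻¹ * a).im, Prod.ext ?_ rfl⟩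
      simp only
      generalize ((Complex.I * (α * Complex.exp (θ * Complex.I)))⁻¹ * a).im = s at *
      push_cast at h3
      field_simp at h3
      rw [mul_comm Complex.I (θ : ℂ)] at h3
      linear_combination -h3 + α * Complex.exp (θ * Complex.I) * s * hI

/-- The parameter `s` disappears: translating a line along itself does not affect the velocity of a
translation. The fiber is the circle `A = i e^{iθ}`, `B = 0`. -/
theorem isFiberSubbundle_admissible_zero_zero :
    IsFiberSubbundle 𝓘(ℝ, Fin 4 → ℝ) (admissible 0 0) := by
  refine isFiberSubbundle_of_isSliceSet (V₁ := (PUnit.{1} × ℝ) × PUnit.{1})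
    (V₂ := (ℝ × PUnit.{1}) × ℂ) (by simp [finrank_punit])
    ((isSliceSet_circle one_ne_zero).prod (isSliceSet_singleton (0 : ℂ)))
    (LinearEquiv.refl ℝ (ℂ × ℂ)) fun q => ?_
  change _ ↔ ‖q.1‖ = |1| ∧ q.2 = 0
  simp only [fiberPoint_zero]
  constructor
  · rintro ⟨θ, s, rfl⟩
    simp [Complex.norm_exp_ofReal_mul_I]
  · rintro ⟨h1, h2⟩
    have h3 : ‖-Complex.I * q.1‖ = |1| := by rw [norm_mul, h1]; simp
    obtain ⟨θ, hθ⟩ := exists_eq_mul_exp h3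
    refine ⟨θ, 0, Prod.ext ?_ (by simp [h2])⟩
    rw [Complex.ofReal_one, one_mul] at hθ
    simp only [← hθ, Complex.ofReal_zero]
    linear_combination q.1 * Complex.I_mul_I

/-- In the coordinates `-i A ± B` the velocities are `(1 + α) e^{i(θ + s)}` and `(1 - α) e^{i(θ -
s)}`. The two angles are independent, so the fiber is a product of two circles. -/
theorem isFiberSubbundle_admissible_one (α : ℝ) :
    IsFiberSubbundle 𝓘(ℝ, Fin 4 → ℝ) (admissible 1 α) := by
  let M : (ℂ × ℂ) ≃ₗ[ℝ] ℂ × ℂ :=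
    { toFun := fun q => (-Complex.I * q.1 + q.2, -Complex.I * q.1 - q.2)
      invFun := fun q => (Complex.I / 2 * (q.1 + q.2), (q.1 - q.2) / 2)
      map_add' := fun q q' => by ext1 <;> simp <;> ring
      map_smul' := fun r q => by ext1 <;> simp <;> ring
      left_inv := fun q => by
        ext1
        · simp only
          linear_combination -q.1 * Complex.I_mul_I
        · simp only
          ring
      right_inv := fun q => by
        ext1 <;> simp only <;> linear_combination -(q.1 + q.2) / 2 * Complex.I_mul_I }
  have hM : ∀ q, (∃ θ s, q = fiberPoint 1 α θ s) ↔
      M q ∈ {z : ℂ | ‖z‖ = |1 + α|} ×ˢ {z : ℂ | ‖z‖ = |1 - α|} := by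
    intro q
    change _ ↔ ‖-Complex.I * q.1 + q.2‖ = |1 + α| ∧ ‖-Complex.I * q.1 - q.2‖ = |1 - α|
    have hI := Complex.I_mul_I
    have e1 : ∀ θ s : ℝ, -Complex.I * (fiberPoint 1 α θ s).1 + (fiberPoint 1 α θ s).2
        = (1 + α : ℝ) * Complex.exp ((θ + s : ℝ) * Complex.I) := by
      intro θ s
      rw [fiberPoint_one, Complex.ofReal_add θ s, add_mul, Complex.exp_add,
        Complex.exp_mul_I (s : ℂ)]
      push_cast
      linear_combination -Complex.exp (θ * Complex.I) * Complex.cos s * hI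
    have e2 : ∀ θ s : ℝ, -Complex.I * (fiberPoint 1 α θ s).1 - (fiberPoint 1 α θ s).2
        = (1 - α : ℝ) * Complex.exp ((θ - s : ℝ) * Complex.I) := by
      intro θ s
      rw [fiberPoint_one, Complex.ofReal_sub θ s, sub_mul, sub_eq_add_neg _ (s * Complex.I),
        Complex.exp_add, ← neg_mul, Complex.exp_mul_I (-(s : ℂ)), Complex.cos_neg, Complex.sin_neg]
      push_cast
      linear_combination -Complex.exp (θ * Complex.I) * Complex.cos s * hI
    constructor
    · rintro ⟨θ, s, rfl⟩
      rw [e1, e2, norm_mul_exp, norm_mul_exp]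
      exact ⟨rfl, rfl⟩
    · rintro ⟨h1, h2⟩
      obtain ⟨x, hx⟩ := exists_eq_mul_exp h1
      obtain ⟨y, hy⟩ := exists_eq_mul_exp h2
      -- The solution of `θ + s = x`, `θ - s = y`.
      refine ⟨(x + y) / 2, (x - y) / 2, M.injective (Prod.ext ?_ ?_)⟩
      · change -Complex.I * q.1 + q.2 = -Complex.I * _ + _
        rw [e1, hx]
        ring_nf
      · change -Complex.I * q.1 - q.2 = -Complex.I * _ - _
        rw [e2, hy]
        ring_nf
  have h0 : ∀ r : ℝ, r = 0 → {z : ℂ | ‖z‖ = |r|} = {0} := by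
    rintro _ rfl
    ext z
    simp
  -- For `α = -1` or `α = 1` one circle shrinks to a point and the fiber has dimension one, so the
  -- model spaces change.
  rcases eq_or_ne (1 + α) 0 with hp | hp
  · have hn : 1 - α ≠ 0 := by
      intro h
      linarith
    exact isFiberSubbundle_of_isSliceSet (V₁ := PUnit.{1} × (PUnit.{1} × ℝ))
      (V₂ := ℂ × (ℝ × PUnit.{1})) (by simp [finrank_punit])
      ((isSliceSet_singleton 0).prod (isSliceSet_circle hn)) M
      fun q => h0 _ hp ▸ hM q
  · rcases eq_or_ne (1 - α) 0 with hn | hn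
    · exact isFiberSubbundle_of_isSliceSet (V₁ := (PUnit.{1} × ℝ) × PUnit.{1})
        (V₂ := (ℝ × PUnit.{1}) × ℂ) (by simp [finrank_punit])
        ((isSliceSet_circle hp).prod (isSliceSet_singleton 0)) M
        fun q => h0 _ hn ▸ hM q
    · exact isFiberSubbundle_of_isSliceSet (V₁ := (PUnit.{1} × ℝ) × (PUnit.{1} × ℝ))
        (V₂ := (ℝ × PUnit.{1}) × (ℝ × PUnit.{1})) (by simp [finrank_punit])
        ((isSliceSet_circle hp).prod (isSliceSet_circle hn)) M hM

/-- Here `A + B = (i + α) e^{-s + iθ}`, and the conjugate of `A - B` is `-(i + α) e^{s - iθ}`. Their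
product is constant and nonzero, and the first factor is an arbitrary nonzero complex number. The
conjugation, which cancels both parameters in the product, makes `M` only real linear. -/
theorem isFiberSubbundle_admissible_neg_one (α : ℝ) :
    IsFiberSubbundle 𝓘(ℝ, Fin 4 → ℝ) (admissible (-1) α) := by
  let M : (ℂ × ℂ) ≃ₗ[ℝ] ℂ × ℂ :=
    { toFun := fun q => (q.1 + q.2, starRingEnd ℂ (q.1 - q.2))
      invFun := fun q => ((q.1 + starRingEnd ℂ q.2) / 2, (q.1 - starRingEnd ℂ q.2) / 2)
      map_add' := fun q q' => by ext1 <;> simp <;> ring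
      map_smul' := fun r q => by ext1 <;> (simp; try ring)
      left_inv := fun q => by ext1 <;> simp
      right_inv := fun q => by ext1 <;> simp [map_ofNat] <;> ring }
  have hα : Complex.I + α ≠ 0 := by
    intro h
    simpa using congrArg Complex.im h
  have hI := Complex.I_mul_I
  refine isFiberSubbundle_of_isSliceSet (V₁ := ℂ × PUnit.{1})
    (V₂ := PUnit.{1} × ℂ) (by simp [finrank_punit])
    (T := {q | q.1 * q.2 = -(Complex.I + α) ^ 2}) ?_ M fun q => ?_
  · refine (isSliceSet_univ.prod (isSliceSet_singleton (-(Complex.I + α) ^ 2))).comap fun q hq =>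
      ⟨mulPartialHomeomorph, ?_, isSmoothPartial_mulPartialHomeomorph, fun y _ =>
        ⟨fun h => ⟨mem_univ _, h⟩, fun h => h.2⟩⟩
    intro h
    have hq : q.1 * q.2 = -(Complex.I + α) ^ 2 := hq
    rw [h, zero_mul] at hq
    exact pow_ne_zero 2 hα (neg_eq_zero.1 hq.symm)
  · have e1 : ∀ θ s : ℝ, (M (fiberPoint (-1) α θ s)).1
        = (Complex.I + α) * Complex.exp (-s + θ * Complex.I) := by
      intro θ s
      change (fiberPoint (-1) α θ s).1 + (fiberPoint (-1) α θ s).2 = _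
      rw [fiberPoint_neg_one, Complex.exp_add, ← Complex.cosh_sub_sinh]
      ring
    have e2 : ∀ θ s : ℝ, (M (fiberPoint (-1) α θ s)).2
        = -(Complex.I + α) * Complex.exp (-(-s + θ * Complex.I)) := by
      intro θ s
      change starRingEnd ℂ ((fiberPoint (-1) α θ s).1 - (fiberPoint (-1) α θ s).2) = _
      have : (fiberPoint (-1) α θ s).1 - (fiberPoint (-1) α θ s).2
          = (Complex.I - α) * Complex.exp (s + θ * Complex.I) := by
        rw [fiberPoint_neg_one, Complex.exp_add, ← Complex.cosh_add_sinh (s : ℂ)]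
        ring
      rw [this, map_mul, ← Complex.exp_conj]
      simp
      ring_nf
    constructor
    · rintro ⟨θ, s, rfl⟩
      change (M _).1 * (M _).2 = _
      rw [e1, e2, Complex.exp_neg]
      have := Complex.exp_ne_zero (-s + θ * Complex.I)
      field_simp
    · intro h
      have h : (M q).1 * (M q).2 = -(Complex.I + α) ^ 2 := h
      have hx : (M q).1 ≠ 0 := by
        intro h'
        rw [h', zero_mul] at h
        exact pow_ne_zero 2 hα (neg_eq_zero.1 h.symm)
      -- The equation `A + B = (i + α) e^{-s + iθ}` is solved by a logarithm: `s` is minus its real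
      -- part and `θ` its imaginary part.
      set z := Complex.log ((M q).1 / (Complex.I + α)) with hz
      have hez : (Complex.I + α) * Complex.exp z = (M q).1 := by
        rw [hz, Complex.exp_log (div_ne_zero hx hα), mul_div_cancel₀ _ hα]
      have hz' : -((-z.re : ℝ) : ℂ) + z.im * Complex.I = z := by
        push_cast
        rw [neg_neg, Complex.re_add_im]
      refine ⟨z.im, -z.re, M.injective (Prod.ext ?_ ?_)⟩
      · rw [e1, hz', hez]
      · rw [e2, hz', Complex.exp_neg]
        refine mul_left_cancel₀ hx ?_
        rw [h, ← hez]
        have := Complex.exp_ne_zero z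
        field_simp

theorem isFiberSubbundle_admissible (κ : SignType) (α : ℝ) :
    IsFiberSubbundle 𝓘(ℝ, Fin 4 → ℝ) (admissible κ α) := by
  rcases κ with _ | _ | _
  · rcases eq_or_ne α 0 with rfl | hα
    · exact isFiberSubbundle_admissible_zero_zero
    · exact isFiberSubbundle_admissible_zero_of_ne hα
  · exact isFiberSubbundle_admissible_neg_one α
  · exact isFiberSubbundle_admissible_one α

end Helicoidal

theorem mainTheorem9 (κ : SignType) (α : ℝ) :
    Helicoidal.IsFiberSubbundle 𝓘(ℝ, Fin 4 → ℝ) (Helicoidal.admissible κ α) ∧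
    (∀ g : Helicoidal.isometryGroup κ,
      ContMDiff 𝓘(ℝ, Fin 4 → ℝ) 𝓘(ℝ, Fin 4 → ℝ) ∞ (Helicoidal.act g)) ∧
    ∃ (Γo : ℝ → Helicoidal.OrientedGeodesic κ) (X : Helicoidal.TangentGeodesic κ),
      Helicoidal.IsHelicoidalCurve κ α (Helicoidal.standardGeodesic κ) ![0, 0, 0, 1] Γo ∧
      Helicoidal.IsInitialVelocity Γo X ∧
      Helicoidal.admissible κ α = Set.range (fun g : Helicoidal.isometryGroup κ =>
        tangentMap 𝓘(ℝ, Fin 4 → ℝ) 𝓘(ℝ, Fin 4 → ℝ) (Helicoidal.act g) X) :=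
  ⟨Helicoidal.isFiberSubbundle_admissible κ α, Helicoidal.contMDiff_act, _,
    Helicoidal.standardVelocity κ α, Helicoidal.isHelicoidalCurve_standard κ α,
    Helicoidal.isInitialVelocity_standard κ α, Helicoidal.admissible_eq_range κ α⟩
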